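/- **Conventions.** Algorithms are randomized programs with assignments, conditionals, while-loops and fair coin tosses over binary trees (a programming-language model polynomially equivalent to Turing machines), possibly with an oracle. Each elementary operation, coin toss and oracle call takes one step. All logarithms are to base $2$. An algorithm *runs in time $O(t(n))$* if there is a $T(n)=O(t(n))$, as $n\to\infty$, such that on every input with parameter $n$ it halts after at most $T(n)$ steps with probability $1$. *Linear-3-RL.* A deterministic MDP has a state space with an end state $\bot$, a starting state $s_0$, three actions, transitions $P(s,a)$, reward distributions $R(s,a)$ on $[0,1]$, and a horizon $H$ such that every deterministic stationary policy, from every state, reaches $\bot$ after at most $H$ actions. $V^\pi(s)$ is the expected total reward collected by the policy $\pi$ from $s$ until $\bot$ is reached, $Q^\pi(s,a)$ is the same when the first action is $a$, and $V^*=\sup_\pi V^\pi$, $Q^*=\sup_\pi Q^\pi$. Fix constants $C>0$ and $b\ge 1$. An instance with feature dimension $d$ consists of such an MDP with $H\le C d$ and of features $\psi(s),\psi(s,a)\in\mathbb{Q}^d$ for which some $\theta\in\mathbb{R}^d$ satisfies $V^*(s)=\langle\theta,\psi(s)\rangle$ and $Q^*(s,a)=\langle\theta,\psi(s,a)\rangle$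 for all states $s\ne\bot$ and actions $a$; states are named by bit strings, rewards are rational, and names of states, rewards and feature coordinates have at most $d^b$ bits. The algorithm receives $d$, $H$ and $s_0$, and by oracle calls obtains independent samples from $R(s,a)$, the state $P(s,a)$, and the features $\psi(s)$, $\psi(s,a)$. It has to output the sequence of actions that a policy $\pi$ with $V^\pi(s_0)>V^*(s_0)-1/4$ takes from $s_0$ to $\bot$ (further entries are ignored). It *solves the problem with error $\varepsilon$* if on every instance it does so with probability at least $1-\varepsilon$. *Unique-3-SAT.* Fix a constant $c\in\mathbb{N}$. The input is a 3-CNF formula with $v$ variables and at most $cv$ clauses. An algorithm *solves the problem with error $\varepsilon$* if it answers YES with probability at least $1-\varepsilon$ on formulas with exactly one satisfying assignment, and NO with probability $1$ on unsatisfiable formulas. (The time bound is required on all formulas.) **Proposition.** Let $C>0$, $b\ge 1$ and $c$ be constants. If Linear-3-RL with feature dimension $d$ can be solved in time $O\big(d^{\log d/(32\log\log d)}\big)$ with error $1/10$, then Unique-3-SAT with $v$ variables can be solved in time $2^{O(v/\log v)}$ with error $1/8$. -/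

import Mathlib

open Filter Asymptotics

namespace LinearRL

/-! ### Data: binary trees -/

/-- The values manipulated by programs: unlabelled binary trees (S-expressions over one atom). -/
inductive Data : Type
  | nil : Data
  | cons : Data → Data → Data

namespace Data

/-- Left component (`nil` for the atom). -/
def hd : Data → Data
  | nil => nil
  | cons a _ => a

/-- Right component (`nil` for the atom). -/
def tl : Data → Data
  | nil => nil
  | cons _ b => b

/-- The list `[x₁, …, xₙ]` as the tree `(x₁ . (x₂ . … (xₙ . nil)))`. -/
def ofList : List Data → Data
  | [] => nil
  | x :: xs => cons x (ofList xs)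

/-- A bit: `false` is the atom, `true` is `(nil . nil)`. -/
def ofBool : Bool → Data
  | false => nil
  | true => cons nil nil

/-- A bit string. -/
def ofBits (l : List Bool) : Data := ofList (l.map ofBool)

/-- A natural number in unary. -/
def unary (n : ℕ) : Data := ofList (List.replicate n nil)

/-- A natural number in binary, least significant bit first. -/
def ofNat (n : ℕ) : Data := ofBits n.bits

/-- A rational number in lowest terms: sign, absolute value of the numerator, denominator. -/
def ofRat (q : ℚ) : Data :=
  cons (ofBool (decide (q < 0))) (cons (ofNat q.num.natAbs) (ofNat q.den))

/-- A vector of rational numbers, as the list of its coordinates. -/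
def ofVec {d : ℕ} (x : Fin d → ℚ) : Data := ofList (List.ofFn fun i => ofRat (x i))

theorem ofList_injective : Function.Injective ofList := by
  intro l₁
  induction l₁ with
  | nil => intro l₂ h; cases l₂ with
    | nil => rfl
    | cons y ys => simp [ofList] at h
  | cons x xs ih => intro l₂ h; cases l₂ with
    | nil => simp [ofList] at h
    | cons y ys =>
      simp only [ofList, cons.injEq] at h
      rw [h.1, ih h.2]

theorem ofBool_injective : Function.Injective ofBool := by
  intro a b h
  cases a <;> cases b <;> simp_all [ofBool]

theorem ofBits_injective : Function.Injective ofBits :=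
  ofList_injective.comp (List.map_injective_iff.mpr ofBool_injective)

theorem unary_injective : Function.Injective unary :=
  ofList_injective.comp (List.replicate_left_injective nil)

end Data

/-! ### Randomized oracle programs and their running time -/

/-- Expressions over the program variables `0, 1, 2, …`. -/
inductive Expr : Type
  | var : ℕ → Expr
  | nil : Expr
  | cons : Expr → Expr → Expr
  | hd : Expr → Expr
  | tl : Expr → Expr

/-- The contents of the variables. -/
abbrev Store := ℕ → Data

/-- Value of an expression. -/
def Expr.eval (σ : Store) : Expr → Data
  | .var n => σ n
  | .nil => .nil
  | .cons a b => .cons (a.eval σ) (b.eval σ)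
  | .hd a => (a.eval σ).hd
  | .tl a => (a.eval σ).tl

/-- Randomized WHILE programs over binary trees with access to an oracle. Tests ask whether an
expression evaluates to something other than `nil`. -/
inductive Program : Type
  | skip : Program
  /-- `x := e` -/
  | assign (x : ℕ) (e : Expr) : Program
  /-- `x :=` a fair random bit -/
  | flip (x : ℕ) : Program
  /-- `x :=` the oracle's answer to the query `e` -/
  | query (x : ℕ) (e : Expr) : Program
  | seq (p q : Program) : Program
  | ite (e : Expr) (p q : Program) : Program
  | loop (e : Expr) (p : Program) : Program

/-- A (possibly randomized) oracle; the answers to different calls are independent samples. -/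
abbrev Oracle := Data → PMF Data

/-- The oracle that carries no information. -/
noncomputable def noOracle : Oracle := fun _ => PMF.pure .nil

/-- A configuration: the stack of program pieces still to be executed, and the store. -/
structure Config : Type where
  code : List Program
  store : Store

open Classical in
/-- One step of computation. Evaluating one of the finitely many expressions of the program, a
coin toss and an oracle call each take a single step. A halted configuration does not change. -/
noncomputable def step (O : Oracle) : Config → PMF Config
  | ⟨[], σ⟩ => PMF.pure ⟨[], σ⟩
  | ⟨.skip :: k, σ⟩ => PMF.pure ⟨k, σ⟩
  | ⟨.assign x e :: k, σ⟩ => PMF.pure ⟨k, Function.update σ x (e.eval σ)⟩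
  | ⟨.flip x :: k, σ⟩ =>
      (PMF.uniformOfFintype Bool).map fun b => ⟨k, Function.update σ x (Data.ofBool b)⟩
  | ⟨.query x e :: k, σ⟩ => (O (e.eval σ)).map fun y => ⟨k, Function.update σ x y⟩
  | ⟨.seq p q :: k, σ⟩ => PMF.pure ⟨p :: q :: k, σ⟩
  | ⟨.ite e p q :: k, σ⟩ =>
      if e.eval σ = .nil then PMF.pure ⟨q :: k, σ⟩ else PMF.pure ⟨p :: k, σ⟩
  | ⟨.loop e p :: k, σ⟩ =>
      if e.eval σ = .nil then PMF.pure ⟨k, σ⟩ else PMF.pure ⟨p :: .loop e p :: k, σ⟩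

/-- The distribution of the configuration after `n` steps. -/
noncomputable def run (O : Oracle) : ℕ → Config → PMF Config
  | 0, c => PMF.pure c
  | n + 1, c => (step O c).bind (run O n)

/-- Start of `A` on input `x`: the input is in variable `0`, all other variables are `nil`. -/
def start (A : Program) (x : Data) : Config := ⟨[A], fun n => if n = 0 then x else .nil⟩

/-- With probability one, `A` with oracle `O` halts on input `x` after at most `T` steps. -/
def HaltsWithin (O : Oracle) (A : Program) (x : Data) (T : ℕ) : Prop :=
  ∀ c ∈ (run O T (start A x)).support, c.code = []

/-- The probability that `A` with oracle `O` halts on input `x` after at most `T` steps with an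
output (the final value of variable `0`) in `S`. -/
noncomputable def outputProb (O : Oracle) (A : Program) (x : Data) (T : ℕ) (S : Set Data) : ℝ :=
  ((run O T (start A x)).toOuterMeasure {c | c.code = [] ∧ c.store 0 ∈ S}).toReal

/-! ### Deterministic MDPs with linear optimal value functions -/

/-- A Markov decision process with deterministic transitions, `k` actions, stochastic rewards in
`[0,1]`, and horizon `H`. The end state `⊥` is represented by `none`, so `State` is the set of the
other states; whatever the policy and the first state, `⊥` is reached after at most `H` actions.
Policies are deterministic and stationary. -/
structure MDP (k : ℕ) : Type 1 where
  State : Type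
  start : State
  trans : State → Fin k → Option State
  reward : State → Fin k → PMF ℚ
  reward_mem : ∀ s a, ∀ x ∈ (reward s a).support, 0 ≤ x ∧ x ≤ 1
  horizon : ℕ
  ends : ∀ (π : State → Fin k) (s : State),
    (fun o : Option State => o.bind fun s' => trans s' (π s'))^[horizon] (some s) = none

/-- Expectation of a distribution on the rationals. -/
noncomputable def expect (p : PMF ℚ) : ℝ := ∑' x : ℚ, (p x).toReal * (x : ℝ)

namespace MDP

variable {k : ℕ} (M : MDP k)

/-- Deterministic stationary policies. -/
abbrev Policy := M.State → Fin k

/-- The state `S_t` of the trajectory of the policy `π` from `s`; `none` after the end. -/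
def traj (π : M.Policy) (s : M.State) (t : ℕ) : Option M.State :=
  (fun o : Option M.State => o.bind fun s' => M.trans s' (π s'))^[t] (some s)

/-- The distribution of the sum of the rewards that `π` collects in at most `n` actions, stopping
when the end state is reached. -/
noncomputable def returnDist (π : M.Policy) : ℕ → Option M.State → PMF ℚ
  | 0, _ => PMF.pure 0
  | _ + 1, none => PMF.pure 0
  | n + 1, some s =>
      (M.reward s (π s)).bind fun x => (returnDist π n (M.trans s (π s))).map fun y => x + y

/-- `V^π(s)`. -/
noncomputable def V (π : M.Policy) (s : M.State) : ℝ :=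
  expect (M.returnDist π M.horizon (some s))

/-- `Q^π(s, a)`: the first action is `a`, the later ones are those of `π`. -/
noncomputable def Q (π : M.Policy) (s : M.State) (a : Fin k) : ℝ :=
  expect ((M.reward s a).bind fun x =>
    (M.returnDist π M.horizon (M.trans s a)).map fun y => x + y)

/-- `V^*(s)`. -/
noncomputable def Vstar (s : M.State) : ℝ := ⨆ π : M.Policy, M.V π s

/-- `Q^*(s, a)`. -/
noncomputable def Qstar (s : M.State) (a : Fin k) : ℝ := ⨆ π : M.Policy, M.Q π s a

/-- The sequence of actions `as` describes the policy `π`: these are the actions that `π` takes on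
the way from the starting state to the end state (entries after that are ignored). -/
def Describes (as : List (Fin k)) (π : M.Policy) : Prop :=
  ∀ (t : ℕ) (s : M.State), M.traj π M.start t = some s → as[t]? = some (π s)

/-- Outputs that describe a good policy `π`, that is, `V^π > V^* - 1/4` at the starting state. -/
def goodOutputs : Set Data :=
  {y | ∃ (as : List (Fin k)) (π : M.Policy),
    y = Data.ofList (as.map fun a => Data.unary a) ∧ M.Describes as π ∧
      M.V π M.start > M.Vstar M.start - 1 / 4}

end MDP

/-- Number of bits of a rational number. -/
def bitSize (q : ℚ) : ℕ := q.num.natAbs.size + q.den.size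

/-- What an algorithm for linear RL has access to: an MDP, `d`-dimensional features of states and of
state-action pairs, and names of the states by bit strings. -/
structure FeaturedMDP (k d : ℕ) : Type 1 extends MDP k where
  featS : State → Fin d → ℚ
  featSA : State → Fin k → Fin d → ℚ
  code : State → List Bool
  code_injective : Function.Injective code

namespace FeaturedMDP

variable {k d : ℕ} (M : FeaturedMDP k d)

/-- `V^*` and `Q^*` are linear in the features, with the same coefficient vector. -/
def IsLinear : Prop :=
  ∃ θ : Fin d → ℝ,
    (∀ s, M.Vstar s = ∑ i, θ i * (M.featS s i : ℝ)) ∧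
    (∀ s a, M.Qstar s a = ∑ i, θ i * (M.featSA s a i : ℝ))

/-- Names of states, rewards and features (per coordinate) have at most `B` bits. -/
def SizeBound (B : ℕ) : Prop :=
  (∀ s, (M.code s).length ≤ B) ∧
  (∀ s a, ∀ x ∈ (M.reward s a).support, bitSize x ≤ B) ∧
  (∀ s i, bitSize (M.featS s i) ≤ B) ∧
  (∀ s a i, bitSize (M.featSA s a i) ≤ B)

/-- The tree naming a state. -/
def stateData (s : M.State) : Data := Data.ofBits (M.code s)

/-- The calls an algorithm can make. -/
inductive Call : Type
  | reward (s : M.State) (a : Fin k) : Call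
  | trans (s : M.State) (a : Fin k) : Call
  | featS (s : M.State) : Call
  | featSA (s : M.State) (a : Fin k) : Call

/-- A call as a tree. -/
def Call.toData : M.Call → Data
  | .reward s a => .cons (.unary 0) (.cons (M.stateData s) (.unary a))
  | .trans s a => .cons (.unary 1) (.cons (M.stateData s) (.unary a))
  | .featS s => .cons (.unary 2) (M.stateData s)
  | .featSA s a => .cons (.unary 3) (.cons (M.stateData s) (.unary a))

/-- The answer to a call: a fresh sample of `R(s,a)`, the next state `P(s,a)` (`nil` stands for the
end state, `(nil . s')` for the state `s'`), or a feature vector. -/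
noncomputable def Call.answer : M.Call → PMF Data
  | .reward s a => (M.reward s a).map Data.ofRat
  | .trans s a => PMF.pure <| match M.trans s a with
      | none => .nil
      | some s' => .cons .nil (M.stateData s')
  | .featS s => PMF.pure (Data.ofVec (M.featS s))
  | .featSA s a => PMF.pure (Data.ofVec (M.featSA s a))

theorem stateData_injective : Function.Injective M.stateData :=
  Data.ofBits_injective.comp M.code_injective

/-- A tree is the name of at most one call. -/
theorem Call.toData_injective : Function.Injective (Call.toData M) := by
  have hs := M.stateData_injective
  have hu : ∀ a b : Fin k, Data.unary a = Data.unary b → a = b := fun a b h =>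
    Fin.ext (Data.unary_injective h)
  have ht : ∀ m n : ℕ, Data.unary m = Data.unary n → m = n := fun m n h =>
    Data.unary_injective h
  intro x y h
  cases x <;> cases y <;> simp only [Call.toData, Data.cons.injEq] at h <;>
    first
    | exact absurd (ht _ _ h.1) (by decide)
    | rw [hs h.2.1, hu _ _ h.2.2]
    | rw [hs h.2]

open Classical in
/-- Access to `M` as an oracle; a query that is not a call is answered by `nil`. -/
noncomputable def oracle : Oracle := fun q =>
  if h : ∃ c : M.Call, c.toData = q then h.choose.answer else PMF.pure .nil

/-- The input of an algorithm: the feature dimension, the horizon and the starting state. -/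
def input : Data := .cons (.unary d) (.cons (.unary M.horizon) (M.stateData M.start))

end FeaturedMDP

/-- Linear-`k`-RL, for MDPs with horizon at most `C * d` whose names of states, rewards and feature
coordinates have at most `d ^ b` bits, can be solved by a randomized algorithm in time `O(t d)`,
`d` the feature dimension, with error probability `ε`. -/
def LinearRLSolvable (k : ℕ) (C : ℝ) (b : ℕ) (t : ℕ → ℝ) (ε : ℝ) : Prop :=
  ∃ (A : Program) (T : ℕ → ℕ), (fun d => (T d : ℝ)) =O[atTop] t ∧
    ∀ (d : ℕ) (M : FeaturedMDP k d),
      (M.horizon : ℝ) ≤ C * d → M.SizeBound (d ^ b) → M.IsLinear →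
        HaltsWithin M.oracle A M.input (T d) ∧
        1 - ε ≤ outputProb M.oracle A M.input (T d) M.goodOutputs

/-! ### Unique-3-SAT -/

/-- A literal over `v` variables: a variable and the truth value that makes the literal true. -/
abbrev Literal (v : ℕ) := Fin v × Bool

/-- A clause with three literals (repetitions are allowed). -/
abbrev Clause (v : ℕ) := Fin 3 → Literal v

/-- A 3-CNF formula over `v` variables, as the list of its clauses. -/
abbrev Formula (v : ℕ) := List (Clause v)

/-- The assignment `w` satisfies the formula. -/
def Satisfies {v : ℕ} (w : Fin v → Bool) (φ : Formula v) : Prop :=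
  ∀ c ∈ φ, ∃ i, w (c i).1 = (c i).2

/-- A literal as a tree. -/
def literalData {v : ℕ} (l : Literal v) : Data := .cons (.ofBool l.2) (.unary l.1)

/-- A formula as a tree: the number of variables and the list of the clauses. -/
def formulaData {v : ℕ} (φ : Formula v) : Data :=
  .cons (.unary v)
    (Data.ofList (φ.map fun c => Data.ofList (List.ofFn fun i => literalData (c i))))

/-- Unique-3-SAT, for formulas with `v` variables and at most `c * v` clauses, can be solved by a
randomized algorithm in time `O(t v)` with error probability `ε`. Output `nil` means NO, every other
output YES. -/
def Unique3SATSolvable (c : ℕ) (t : ℕ → ℝ) (ε : ℝ) : Prop :=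
  ∃ (A : Program) (T : ℕ → ℕ), (fun v => (T v : ℝ)) =O[atTop] t ∧
    ∀ (v : ℕ) (φ : Formula v), φ.length ≤ c * v →
      HaltsWithin noOracle A (formulaData φ) (T v) ∧
      ((∃! w, Satisfies w φ) →
        1 - ε ≤ outputProb noOracle A (formulaData φ) (T v) {y | y ≠ .nil}) ∧
      ((¬ ∃ w, Satisfies w φ) →
        outputProb noOracle A (formulaData φ) (T v) {.nil} = 1)

end LinearRL

/-!
Given a satisfying assignment `w₀` of a 3-CNF formula `φ` with `v` variables, consider the game
whose states are pairs `(l, w)` of a counter `l < 2 ^ m` and an assignment `w`. A move raises the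
counter and flips one of the three variables of the first clause violated by `w`; one of the three
moves decreases the Hamming distance `dist w w₀`. The game ends when `w` satisfies `φ` or the
counter is full, and only then is there a reward, which is `0` or `1` and has expectation `((2 ^ m +
v - l - dist w w₀) / (2 ^ m + v)) ^ r`. As no move increases this quantity and some move preserves
it, it is the optimal value of every state. It is the `r`-th power of an affine form in the bits of
the state, hence linear in the `r`-th tensor power of these bits, which does not depend on `w₀`. A
nearly optimal sequence of moves leads from the start to a satisfying assignment, since the value of
the start is close to `1` while a full counter leaves at most `((1 + v) / 2 ^ m) ^ r`.

To decide whether `φ` is satisfiable, run the algorithm for Linear-3-RL on this game, stopping it at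
the first query about a satisfying assignment and answering that all rewards are `0`. Each reward at
a full counter is noticed with probability at most `((1 + v) / 2 ^ m) ^ r`. For `r` about
`v ^ (1 / 3)` and `m` about `(4 / 3) * r * log v`, the dimension `2 ^ m` has room for the features,
and the running time of the algorithm is too small for it to come upon such a reward. All of this
takes time `2 ^ O(m ^ 2)`.
-/

open scoped ENNReal

namespace LinearRL

/-! ### Deterministic stretches of a computation -/

theorem run_add (O : Oracle) (n m : ℕ) (c : Config) :
    run O (n + m) c = (run O n c).bind (run O m) := by
  induction n generalizing c with
  | zero => simp [run]
  | succ n ih => simp only [Nat.succ_add, run, PMF.bind_bind, funext ih]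

/-- From the configuration `c` the computation surely passes through `c'`, after a fixed number of
steps that is at most `t`. -/
def Reaches (O : Oracle) (c c' : Config) (t : ℕ) : Prop :=
  ∃ n ≤ t, run O n c = PMF.pure c'

namespace Reaches

variable {O : Oracle} {c c' c'' : Config} {s t : ℕ}

theorem refl (O : Oracle) (c : Config) : Reaches O c c 0 := ⟨0, le_rfl, rfl⟩

theorem trans (h : Reaches O c c' s) (h' : Reaches O c' c'' t) : Reaches O c c'' (s + t) := by
  obtain ⟨n, hn, h⟩ := h
  obtain ⟨m, hm, h'⟩ := h'
  exact ⟨n + m, by omega, by rw [run_add, h, PMF.pure_bind, h']⟩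

theorem mono (h : Reaches O c c' s) (hst : s ≤ t) : Reaches O c c' t := by
  obtain ⟨n, hn, h⟩ := h
  exact ⟨n, hn.trans hst, h⟩

theorem of_step (h : step O c = PMF.pure c') : Reaches O c c' 1 :=
  ⟨1, le_rfl, by simp [run, h]⟩

theorem seq (O : Oracle) (p q : Program) (k : List Program) (σ : Store) :
    Reaches O ⟨.seq p q :: k, σ⟩ ⟨p :: q :: k, σ⟩ 1 :=
  .of_step (by simp [step])

end Reaches

/-- Big-step semantics of a deterministic program: whatever is on the stack below it, `p` surely
terminates after at most `t` steps and turns the store `σ` into `σ'`. -/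
def Transforms (O : Oracle) (p : Program) (σ σ' : Store) (t : ℕ) : Prop :=
  ∀ k, Reaches O ⟨p :: k, σ⟩ ⟨k, σ'⟩ t

namespace Transforms

variable {O : Oracle} {p q : Program} {e : Expr} {σ σ' σ'' : Store} {s t : ℕ}

theorem mono (h : Transforms O p σ σ' s) (hst : s ≤ t) : Transforms O p σ σ' t :=
  fun k => (h k).mono hst

theorem skip (O : Oracle) (σ : Store) : Transforms O .skip σ σ 1 :=
  fun _ => .of_step (by simp [step])

theorem assign (O : Oracle) (x : ℕ) (e : Expr) (σ : Store) :
    Transforms O (.assign x e) σ (Function.update σ x (e.eval σ)) 1 :=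
  fun _ => .of_step (by simp [step])

theorem seq (hp : Transforms O p σ σ' s) (hq : Transforms O q σ' σ'' t) :
    Transforms O (.seq p q) σ σ'' (s + t + 1) := fun k =>
  ((Reaches.seq ..).trans ((hp (q :: k)).trans (hq k))).mono (by omega)

theorem ite_of_eq_nil (h : e.eval σ = .nil) (hq : Transforms O q σ σ' t) :
    Transforms O (.ite e p q) σ σ' (t + 1) := fun k =>
  ((Reaches.of_step (by simp [step, h])).trans (hq k)).mono (by omega)

theorem ite_of_ne_nil (h : e.eval σ ≠ .nil) (hp : Transforms O p σ σ' t) :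
    Transforms O (.ite e p q) σ σ' (t + 1) := fun k =>
  ((Reaches.of_step (by simp [step, h])).trans (hp k)).mono (by omega)

theorem loop_of_eq_nil (h : e.eval σ = .nil) : Transforms O (.loop e p) σ σ 1 :=
  fun _ => .of_step (by simp [step, h])

theorem loop_of_ne_nil (h : e.eval σ ≠ .nil) (hp : Transforms O p σ σ' s)
    (hloop : Transforms O (.loop e p) σ' σ'' t) :
    Transforms O (.loop e p) σ σ'' (s + t + 1) := fun k =>
  ((Reaches.of_step (by simp [step, h])).trans
    ((hp (.loop e p :: k)).trans (hloop k))).mono (by omega)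

end Transforms

/-! ### Halting probabilities -/

/-- The probability that the computation starting from `c` halts within `n` steps with an output in
`S`. -/
noncomputable def haltProb (O : Oracle) (n : ℕ) (c : Config) (S : Set Data) : ℝ≥0∞ :=
  (run O n c).toOuterMeasure {c | c.code = [] ∧ c.store 0 ∈ S}

section HaltProb

variable {O : Oracle}

open Classical in
theorem haltProb_zero (O : Oracle) (c : Config) (S : Set Data) :
    haltProb O 0 c S = if c.code = [] ∧ c.store 0 ∈ S then 1 else 0 := by
  simp [haltProb, run]

theorem haltProb_succ (O : Oracle) (n : ℕ) (c : Config) (S : Set Data) :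
    haltProb O (n + 1) c S = ∑' c', step O c c' * haltProb O n c' S := by
  simp [haltProb, run, PMF.toOuterMeasure_bind_apply]

theorem haltProb_succ_of_step {c c' : Config} (h : step O c = PMF.pure c') (n : ℕ) (S : Set Data) :
    haltProb O (n + 1) c S = haltProb O n c' S := by
  simp [haltProb, run, h]

theorem haltProb_succ_of_step_map {α : Type*} {c : Config} {μ : PMF α} {g : α → Config}
    (h : step O c = μ.map g) (n : ℕ) (S : Set Data) :
    haltProb O (n + 1) c S = ∑' a, μ a * haltProb O n (g a) S := by
  have hrun : run O (n + 1) c = μ.bind fun a => run O n (g a) := by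
    rw [run, h, PMF.bind_map]; rfl
  simp [haltProb, hrun, PMF.toOuterMeasure_bind_apply]

open Classical in
theorem haltProb_halted (O : Oracle) (n : ℕ) (σ : Store) (S : Set Data) :
    haltProb O n ⟨[], σ⟩ S = if σ 0 ∈ S then 1 else 0 := by
  induction n with
  | zero => simp [haltProb_zero]
  | succ n ih => rw [haltProb_succ_of_step (c' := ⟨[], σ⟩) (by simp [step]), ih]

theorem haltProb_le_one (O : Oracle) (n : ℕ) (c : Config) (S : Set Data) :
    haltProb O n c S ≤ 1 := by
  refine (MeasureTheory.measure_mono (Set.subset_univ _)).trans ?_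
  rw [(PMF.toOuterMeasure_apply_eq_one_iff _ _).2 (Set.subset_univ _)]

theorem haltProb_le_succ (O : Oracle) (n : ℕ) (c : Config) (S : Set Data) :
    haltProb O n c S ≤ haltProb O (n + 1) c S := by
  classical
  induction n generalizing c with
  | zero =>
    rw [haltProb_zero]
    split_ifs with h
    · obtain ⟨k, σ⟩ := c
      obtain ⟨rfl, h⟩ := h
      simp [haltProb_halted, h]
    · exact zero_le
  | succ n ih =>
    rw [haltProb_succ, haltProb_succ O (n + 1)]
    exact ENNReal.tsum_le_tsum fun c' => by gcongr; exact ih c'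

theorem haltProb_mono (O : Oracle) {n m : ℕ} (h : n ≤ m) (c : Config) (S : Set Data) :
    haltProb O n c S ≤ haltProb O m c S :=
  monotone_nat_of_le_succ (f := fun n => haltProb O n c S) (fun n => haltProb_le_succ O n c S) h

theorem Reaches.haltProb_le {c c' : Config} {t m N : ℕ} (h : Reaches O c c' t) (hN : t + m ≤ N)
    (S : Set Data) : haltProb O m c' S ≤ haltProb O N c S := by
  obtain ⟨n, hn, h⟩ := h
  calc haltProb O m c' S = haltProb O (n + m) c S := by simp [haltProb, run_add, h]
    _ ≤ haltProb O N c S := haltProb_mono O (by omega) c S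

theorem haltsWithin_of_one_le_haltProb {A : Program} {x : Data} {T : ℕ}
    (h : 1 ≤ haltProb O T (start A x) Set.univ) : HaltsWithin O A x T := by
  have hsupp := (PMF.toOuterMeasure_apply_eq_one_iff _ _).1
    (le_antisymm (haltProb_le_one _ _ _ _) h)
  exact fun c hc => (hsupp hc).1

theorem outputProb_eq (O : Oracle) (A : Program) (x : Data) (T : ℕ) (S : Set Data) :
    outputProb O A x T S = (haltProb O T (start A x) S).toReal := rfl

end HaltProb

/-! ### A functional language with bounded iteration -/

/-- Simultaneous substitution: replace each variable `n` by the expression `f n`. -/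
def Expr.subst (f : ℕ → Expr) : Expr → Expr
  | .var n => f n
  | .nil => .nil
  | .cons a b => .cons (a.subst f) (b.subst f)
  | .hd a => .hd (a.subst f)
  | .tl a => .tl (a.subst f)

theorem Expr.eval_subst (f : ℕ → Expr) (σ : Store) (e : Expr) :
    (e.subst f).eval σ = e.eval fun n => (f n).eval σ := by
  induction e <;> simp_all [Expr.subst, Expr.eval]

/-- The function of one argument denoted by an expression: all its variables stand for the
argument. -/
def Expr.apply (e : Expr) (x : Data) : Data := e.eval fun _ => x

namespace Data

/-- Left fold over a tree read as a list (its right spine). -/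
def fold (g : Data → Data → Data) : Data → Data → Data
  | nil, acc => acc
  | cons x xs, acc => fold g xs (g x acc)

/-- Length of a tree read as a list. -/
def length : Data → ℕ
  | nil => 0
  | cons _ xs => xs.length + 1

/-- Running time of the loop that computes `fold g`, if the body takes time `w`. -/
def foldCost (g : Data → Data → Data) (w : Data → Data → ℕ) : Data → Data → ℕ
  | nil, _ => 1
  | cons x xs, acc => w x acc + 7 + foldCost g w xs (g x acc)

/-- Each iteration of `fold g` starts with an element and an accumulator that satisfy `P`. -/
def FoldAll (g : Data → Data → Data) (P : Data → Data → Prop) : Data → Data → Prop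
  | nil, _ => True
  | cons x xs, acc => P x acc ∧ FoldAll g P xs (g x acc)

theorem FoldAll.imp {g : Data → Data → Data} {P Q : Data → Data → Prop}
    (hPQ : ∀ x acc, P x acc → Q x acc) {l acc : Data} (h : FoldAll g P l acc) :
    FoldAll g Q l acc := by
  induction l generalizing acc with
  | nil => trivial
  | cons x xs _ ih => exact ⟨hPQ _ _ h.1, ih h.2⟩

theorem foldCost_le {g : Data → Data → Data} {w : Data → Data → ℕ} {W : ℕ} {l acc : Data}
    (h : FoldAll g (fun x acc => w x acc ≤ W) l acc) :
    foldCost g w l acc ≤ l.length * (W + 7) + 1 := by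
  induction l generalizing acc with
  | nil => simp [foldCost]
  | cons x xs _ ih =>
    have hhead : w x acc ≤ W := h.1
    have htail := ih h.2
    simp only [foldCost, length]
    linarith

end Data

/-- Terms of a functional language with bounded iteration, which are compiled to programs. The
argument of a term is an environment, the list of the values of its variables: `comp f g` is
`g ∘ f`, `letIn f g` evaluates `g` in the environment extended by the value of `f`, and `fold l a g`
folds over the list `l`, starting with `a`, the step `g` being evaluated in the environment extended
by the list element and the accumulator. -/
inductive Term : Type
  | expr (e : Expr)
  | comp (f g : Term)
  | letIn (f g : Term)
  | ite (c f g : Term)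
  | fold (l a g : Term)

namespace Term

/-- The function denoted by a term. -/
def eval : Term → Data → Data
  | expr e, x => e.apply x
  | comp f g, x => g.eval (f.eval x)
  | letIn f g, x => g.eval (.cons (f.eval x) x)
  | ite c f g, x => match c.eval x with
    | .nil => g.eval x
    | .cons _ _ => f.eval x
  | fold l a g, x => Data.fold (fun y acc => g.eval (.cons y (.cons acc x))) (l.eval x) (a.eval x)

/-- Running time of the compiled program. -/
def cost : Term → Data → ℕ
  | expr _, _ => 1
  | comp f g, x => f.cost x + g.cost (f.eval x) + 1
  | letIn f g, x => f.cost x + g.cost (.cons (f.eval x) x) + 5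
  | ite c f g, x => c.cost x + 4 + match c.eval x with
    | .nil => g.cost x
    | .cons _ _ => f.cost x
  | fold l a g, x => l.cost x + a.cost x + 8 +
      Data.foldCost (fun y acc => g.eval (.cons y (.cons acc x)))
        (fun y acc => g.cost (.cons y (.cons acc x))) (l.eval x) (a.eval x)

/-- All folds in the evaluation of the term are over lists of length at most `L`. -/
def Bounded (L : ℕ) : Term → Data → Prop
  | expr _, _ => True
  | comp f g, x => f.Bounded L x ∧ g.Bounded L (f.eval x)
  | letIn f g, x => f.Bounded L x ∧ g.Bounded L (.cons (f.eval x) x)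
  | ite c f g, x => c.Bounded L x ∧ match c.eval x with
    | .nil => g.Bounded L x
    | .cons _ _ => f.Bounded L x
  | fold l a g, x => l.Bounded L x ∧ a.Bounded L x ∧ (l.eval x).length ≤ L ∧
      Data.FoldAll (fun y acc => g.eval (.cons y (.cons acc x)))
        (fun y acc => g.Bounded L (.cons y (.cons acc x))) (l.eval x) (a.eval x)

/-- A bound, up to constants, for the number of operations in a term, each fold being counted as one
iteration: the coefficient in `cost_le`. -/
def size : Term → ℕ
  | expr _ => 1
  | comp f g => f.size + g.size + 1
  | letIn f g => f.size + g.size + 5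
  | ite c f g => c.size + f.size + g.size + 4
  | fold l a g => l.size + a.size + g.size + 16

/-- Nesting depth of the folds of a term: the exponent in `cost_le`. -/
def depth : Term → ℕ
  | expr _ => 0
  | comp f g => max f.depth g.depth
  | letIn f g => max f.depth g.depth
  | ite c f g => max c.depth (max f.depth g.depth)
  | fold l a g => max l.depth (max a.depth (g.depth + 1))

theorem cost_le {L : ℕ} (F : Term) (x : Data) (h : F.Bounded L x) :
    F.cost x ≤ F.size * (L + 1) ^ F.depth := by
  have one_le : ∀ n, 1 ≤ (L + 1) ^ n := fun n => Nat.one_le_pow _ _ L.succ_pos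
  have weaken : ∀ {a w m n : ℕ}, a ≤ w * (L + 1) ^ m → m ≤ n → a ≤ w * (L + 1) ^ n := fun h hmn =>
    h.trans (Nat.mul_le_mul_left _ (Nat.pow_le_pow_right L.succ_pos hmn))
  induction F generalizing x with
  | expr e => simp [cost, size, depth]
  | comp f g ihf ihg =>
    have hf := weaken (ihf _ h.1) (le_max_left _ g.depth)
    have hg := weaken (ihg _ h.2) (le_max_right f.depth _)
    simp only [cost, size, depth]
    linarith [one_le (max f.depth g.depth)]
  | letIn f g ihf ihg =>
    have hf := weaken (ihf _ h.1) (le_max_left _ g.depth)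
    have hg := weaken (ihg _ h.2) (le_max_right f.depth _)
    simp only [cost, size, depth]
    linarith [one_le (max f.depth g.depth)]
  | ite c f g ihc ihf ihg =>
    obtain ⟨hcL, hbranch⟩ := h
    have hc := weaken (ihc _ hcL) (show c.depth ≤ (ite c f g).depth by simp [depth])
    simp only [cost, size]
    have hpos := one_le (ite c f g).depth
    split at hbranch
    · have hg := weaken (ihg _ hbranch) (show g.depth ≤ (ite c f g).depth by simp [depth])
      nlinarith
    · have hf := weaken (ihf _ hbranch) (show f.depth ≤ (ite c f g).depth by simp [depth])
      nlinarith
  | fold l a g ihl iha ihg =>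
    obtain ⟨hlL, haL, hlen, hbody⟩ := h
    have hl := weaken (ihl _ hlL) (show l.depth ≤ (fold l a g).depth by simp [depth])
    have ha := weaken (iha _ haL) (show a.depth ≤ (fold l a g).depth by simp [depth])
    have hloop := Data.foldCost_le (hbody.imp fun y acc => ihg _)
    have hiter : (l.eval x).length * (g.size * (L + 1) ^ g.depth + 7) ≤
        (g.size + 7) * (L + 1) ^ (g.depth + 1) := by
      calc (l.eval x).length * (g.size * (L + 1) ^ g.depth + 7)
          ≤ (L + 1) * (g.size * (L + 1) ^ g.depth + 7 * (L + 1) ^ g.depth) := by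
            have := one_le g.depth
            gcongr <;> omega
        _ = (g.size + 7) * (L + 1) ^ (g.depth + 1) := by ring
    have hiter := weaken hiter (show g.depth + 1 ≤ (fold l a g).depth by simp [depth])
    simp only [cost, size]
    linarith [one_le (fold l a g).depth]

/-! ### Compilation of terms -/

/-- Apply the program `p`, which works on variable `2 * j`, to a copy of variable `2 * i`. -/
def call (i j : ℕ) (p : Program) : Program := .seq (.assign (2 * j) (.var (2 * i))) p

/-- The body of the loop that computes a fold: variable `2 * i` holds the environment, `2 * (i + 1)`
the rest of the list, and `2 * (i + 2)` the accumulator; `p` works on variable `2 * (i + 3)`. -/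
def foldBody (i : ℕ) (p : Program) : Program :=
  .seq
    (.seq (.assign (2 * (i + 3))
      (.cons (.hd (.var (2 * (i + 1)))) (.cons (.var (2 * (i + 2))) (.var (2 * i))))) p)
    (.seq (.assign (2 * (i + 2)) (.var (2 * (i + 3))))
      (.assign (2 * (i + 1)) (.tl (.var (2 * (i + 1))))))

/-- The program computing a term, with input and output in variable `2 * i`; the variables `2 * j`
with `j > i` are auxiliary memory. Odd variables are left to a program that uses the result. -/
def compile : Term → ℕ → Program
  | expr e, i => .assign (2 * i) (e.subst fun _ => .var (2 * i))
  | comp f g, i => .seq (f.compile i) (g.compile i)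
  | letIn f g, i =>
    .seq (call i (i + 1) (f.compile (i + 1))) <|
    .seq (.assign (2 * i) (.cons (.var (2 * (i + 1))) (.var (2 * i)))) (g.compile i)
  | ite c f g, i =>
    .seq (call i (i + 1) (c.compile (i + 1))) <|
    .ite (.var (2 * (i + 1))) (f.compile i) (g.compile i)
  | fold l a g, i =>
    .seq (call i (i + 1) (l.compile (i + 1))) <|
    .seq (call i (i + 2) (a.compile (i + 2))) <|
    .seq (.loop (.var (2 * (i + 1))) (foldBody i (g.compile (i + 3)))) <|
    .assign (2 * i) (.var (2 * (i + 2)))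

/-- The stores agree except at the variables `2 * j` with `j ≥ i`. -/
def Frame (i : ℕ) (σ σ' : Store) : Prop := ∀ n, (∀ j ≥ i, n ≠ 2 * j) → σ' n = σ n

namespace Frame

variable {i j : ℕ} {σ σ' σ'' : Store}

theorem refl (i : ℕ) (σ : Store) : Frame i σ σ := fun _ _ => rfl

theorem trans (h : Frame i σ σ') (h' : Frame i σ' σ'') : Frame i σ σ'' :=
  fun n hn => (h' n hn).trans (h n hn)

theorem mono (h : Frame j σ σ') (hij : i ≤ j) : Frame i σ σ' :=
  fun n hn => h n fun a ha => hn a (hij.trans ha)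

theorem update (σ : Store) (x : Data) (hij : i ≤ j) : Frame i σ (Function.update σ (2 * j) x) :=
  fun _ hn => Function.update_of_ne (hn j hij) _ _

theorem eq (h : Frame j σ σ') (hij : i < j) : σ' (2 * i) = σ (2 * i) :=
  h _ fun a ha => by omega

end Frame

/-- The program `p` computes the function `f` in time `w`, with input and output in variable `2 * i`
and the variables `2 * j`, `j > i`, as auxiliary memory. -/
def Computes (O : Oracle) (p : Program) (i : ℕ) (f : Data → Data) (w : Data → ℕ) : Prop :=
  ∀ σ, ∃ σ', Transforms O p σ σ' (w (σ (2 * i))) ∧ σ' (2 * i) = f (σ (2 * i)) ∧ Frame i σ σ'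

namespace Computes

variable {O : Oracle} {p q r : Program} {i j : ℕ} {f g h : Data → Data} {w w' w'' : Data → ℕ}

theorem expr (O : Oracle) (e : Expr) (i : ℕ) :
    Computes O (.assign (2 * i) (e.subst fun _ => .var (2 * i))) i e.apply fun _ => 1 := fun σ =>
  ⟨_, .assign _ _ _ _, by simp [Expr.eval_subst, Expr.apply, Expr.eval], .update _ _ le_rfl⟩

theorem seq (hp : Computes O p i f w) (hq : Computes O q i g w') :
    Computes O (.seq p q) i (g ∘ f) fun x => w x + w' (f x) + 1 := by
  intro σ
  obtain ⟨σ₁, hp, hf, frame₁⟩ := hp σ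
  obtain ⟨σ₂, hq, hg, frame₂⟩ := hq σ₁
  rw [hf] at hq hg
  exact ⟨σ₂, hp.seq hq, hg, frame₁.trans frame₂⟩

theorem call (hp : Computes O p j f w) (i : ℕ) (σ : Store) :
    ∃ σ', Transforms O (Term.call i j p) σ σ' (w (σ (2 * i)) + 2) ∧
      σ' (2 * j) = f (σ (2 * i)) ∧ Frame j σ σ' := by
  obtain ⟨σ', hp, hf, frame⟩ := hp (Function.update σ (2 * j) (σ (2 * i)))
  rw [Function.update_self] at hp hf
  exact ⟨σ', ((Transforms.assign _ _ _ _).seq hp).mono (by omega), hf,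
    .trans (.update _ _ le_rfl) frame⟩

theorem letIn (hp : Computes O p (i + 1) f w) (hq : Computes O q i g w') :
    Computes O (.seq (Term.call i (i + 1) p) <|
        .seq (.assign (2 * i) (.cons (.var (2 * (i + 1))) (.var (2 * i)))) q) i
      (fun x => g (.cons (f x) x)) fun x => w x + w' (.cons (f x) x) + 5 := by
  intro σ
  obtain ⟨σ₁, hp, hf, frame₁⟩ := hp.call i σ
  obtain ⟨σ₂, hq, hg, frame₂⟩ := hq (Function.update σ₁ (2 * i) (.cons (f (σ (2 * i))) (σ (2 * i))))
  rw [Function.update_self] at hq hg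
  have hpair := Transforms.assign O (2 * i) (.cons (.var (2 * (i + 1))) (.var (2 * i))) σ₁
  simp only [Expr.eval, hf, frame₁.eq i.lt_succ_self] at hpair
  exact ⟨σ₂, (hp.seq (hpair.seq hq)).mono (by dsimp only; omega), hg,
    (frame₁.mono i.le_succ).trans (.trans (.update _ _ le_rfl) frame₂)⟩

theorem ite (hp : Computes O p (i + 1) f w) (hq : Computes O q i g w') (hr : Computes O r i h w'') :
    Computes O (.seq (Term.call i (i + 1) p) (.ite (.var (2 * (i + 1))) q r)) i
      (fun x => match f x with | .nil => h x | .cons _ _ => g x)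
      fun x => w x + 4 + match f x with | .nil => w'' x | .cons _ _ => w' x := by
  intro σ
  obtain ⟨σ₁, hp, hf, frame₁⟩ := hp.call i σ
  have henv : σ₁ (2 * i) = σ (2 * i) := frame₁.eq i.lt_succ_self
  cases hcase : f (σ (2 * i)) with
  | nil =>
    obtain ⟨σ₂, hr, hh, frame₂⟩ := hr σ₁
    rw [henv] at hr hh
    refine ⟨σ₂, (hp.seq (.ite_of_eq_nil ?_ hr)).mono ?_, ?_, (frame₁.mono i.le_succ).trans frame₂⟩
    · rw [Expr.eval, hf, hcase]
    · simp only [hcase]; omega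
    · simp only [hcase, hh]
  | cons a b =>
    obtain ⟨σ₂, hq, hg, frame₂⟩ := hq σ₁
    rw [henv] at hq hg
    refine ⟨σ₂, (hp.seq (.ite_of_ne_nil ?_ hq)).mono ?_, ?_, (frame₁.mono i.le_succ).trans frame₂⟩
    · simp [Expr.eval, hf, hcase]
    · simp only [hcase]; omega
    · simp only [hcase, hg]

theorem foldBody (hp : Computes O p (i + 3) f w) {σ : Store} {y ys acc x : Data}
    (hlist : σ (2 * (i + 1)) = .cons y ys) (hacc : σ (2 * (i + 2)) = acc) (henv : σ (2 * i) = x) :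
    ∃ σ', Transforms O (Term.foldBody i p) σ σ' (w (.cons y (.cons acc x)) + 6) ∧
      σ' (2 * (i + 1)) = ys ∧ σ' (2 * (i + 2)) = f (.cons y (.cons acc x)) ∧
      Frame (i + 1) σ σ' := by
  obtain ⟨σ₁, hp, hf, frame⟩ := hp (Function.update σ (2 * (i + 3)) (.cons y (.cons acc x)))
  rw [Function.update_self] at hp hf
  have frame₁ : Frame (i + 3) σ σ₁ := .trans (.update _ _ le_rfl) frame
  have hlist₁ : σ₁ (2 * (i + 1)) = .cons y ys := by rw [frame₁.eq (by omega), hlist]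
  have hargs := Transforms.assign O (2 * (i + 3))
    (.cons (.hd (.var (2 * (i + 1)))) (.cons (.var (2 * (i + 2))) (.var (2 * i)))) σ
  simp only [Expr.eval, hlist, hacc, henv, Data.hd] at hargs
  refine ⟨_, ((hargs.seq hp).seq ((Transforms.assign _ _ _ _).seq (Transforms.assign _ _ _ _))).mono
    (by omega), ?_, ?_, ((frame₁.mono (by omega)).trans (.update _ _ (by omega))).trans
      (.update _ _ le_rfl)⟩
  · rw [Function.update_self, Expr.eval, Expr.eval, Expr.eval, Function.update_of_ne (by omega),
      hlist₁, Data.tl]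
  · rw [Function.update_of_ne (by omega), Function.update_self, Expr.eval, hf]

theorem foldLoop (hp : Computes O p (i + 3) f w) {l acc x : Data} {σ : Store}
    (hlist : σ (2 * (i + 1)) = l) (hacc : σ (2 * (i + 2)) = acc) (henv : σ (2 * i) = x) :
    ∃ σ', Transforms O (.loop (.var (2 * (i + 1))) (Term.foldBody i p)) σ σ'
        (Data.foldCost (fun y acc => f (.cons y (.cons acc x)))
          (fun y acc => w (.cons y (.cons acc x))) l acc) ∧
      σ' (2 * (i + 2)) = Data.fold (fun y acc => f (.cons y (.cons acc x))) l acc ∧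
      Frame (i + 1) σ σ' := by
  induction l generalizing σ acc with
  | nil => exact ⟨σ, .loop_of_eq_nil hlist, hacc, .refl _ _⟩
  | cons y ys _ ih =>
    obtain ⟨σ₁, hbody, hlist₁, hacc₁, frame₁⟩ := hp.foldBody hlist hacc henv
    obtain ⟨σ₂, hloop, hfold, frame₂⟩ := ih hlist₁ hacc₁ ((frame₁.eq i.lt_succ_self).trans henv)
    refine ⟨σ₂, (Transforms.loop_of_ne_nil ?_ hbody hloop).mono ?_, hfold, frame₁.trans frame₂⟩
    · simp [Expr.eval, hlist]
    · simp only [Data.foldCost]; omega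

theorem fold (hp : Computes O p (i + 1) f w) (hq : Computes O q (i + 2) g w')
    (hr : Computes O r (i + 3) h w'') :
    Computes O (.seq (Term.call i (i + 1) p) <| .seq (Term.call i (i + 2) q) <|
        .seq (.loop (.var (2 * (i + 1))) (Term.foldBody i r)) <|
        .assign (2 * i) (.var (2 * (i + 2)))) i
      (fun x => Data.fold (fun y acc => h (.cons y (.cons acc x))) (f x) (g x))
      fun x => w x + w' x + 8 + Data.foldCost (fun y acc => h (.cons y (.cons acc x)))
        (fun y acc => w'' (.cons y (.cons acc x))) (f x) (g x) := by
  intro σ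
  obtain ⟨σ₁, hp, hf, frame₁⟩ := hp.call i σ
  obtain ⟨σ₂, hq, hg, frame₂⟩ := hq.call i σ₁
  have henv : σ₁ (2 * i) = σ (2 * i) := frame₁.eq i.lt_succ_self
  rw [henv] at hq hg
  obtain ⟨σ₃, hloop, hfold, frame₃⟩ := hr.foldLoop (by rw [frame₂.eq (by omega), hf]) hg
    (by rw [frame₂.eq (by omega), henv])
  refine ⟨_, (hp.seq (hq.seq (hloop.seq (.assign _ _ _ _)))).mono (by dsimp only; omega), ?_,
    (((frame₁.mono (by omega)).trans (frame₂.mono (by omega))).trans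
      (frame₃.mono (by omega))).trans (.update _ _ le_rfl)⟩
  rw [Function.update_self, Expr.eval, hfold]

end Computes

theorem computes_compile (O : Oracle) (F : Term) (i : ℕ) :
    Computes O (F.compile i) i F.eval F.cost := by
  induction F generalizing i with
  | expr e => exact .expr O e i
  | comp f g ihf ihg => exact (ihf i).seq (ihg i)
  | letIn f g ihf ihg => exact (ihf _).letIn (ihg i)
  | ite c f g ihc ihf ihg => exact (ihc _).ite (ihf i) (ihg i)
  | fold l a g ihl iha ihg => exact (ihl _).fold (iha _) (ihg _)

end Term

/-! ### Simulation of an oracle algorithm with a time limit -/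

/-- Outcome of at most `t` steps from a configuration when the queries are answered by `ans`: the
content of variable `0` at the end, or `none` if a query is made to which `ans` has no answer. -/
noncomputable def guardedRun (ans : Data → Option Data) : ℕ → Config → PMF (Option Data)
  | 0, c => PMF.pure (some (c.store 0))
  | t + 1, ⟨.query x e :: k, σ⟩ => match ans (e.eval σ) with
    | none => PMF.pure none
    | some y => guardedRun ans t ⟨k, Function.update σ x y⟩
  | t + 1, c => (step noOracle c).bind (guardedRun ans t)

section GuardedRun

variable {ans : Data → Option Data} {Z : Set (Option Data)}

theorem guardedRun_halted (ans : Data → Option Data) (t : ℕ) (σ : Store) :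
    guardedRun ans t ⟨[], σ⟩ = PMF.pure (some (σ 0)) := by
  induction t with
  | zero => rfl
  | succ t ih => simp [guardedRun, step, ih]

theorem guardedRun_succ_query_of_some {e : Expr} {σ : Store} {y : Data}
    (h : ans (e.eval σ) = some y) (t x : ℕ) (k : List Program) :
    guardedRun ans (t + 1) ⟨.query x e :: k, σ⟩ =
      guardedRun ans t ⟨k, Function.update σ x y⟩ := by
  rw [guardedRun, h]

theorem guardedRun_succ_query_of_none {e : Expr} {σ : Store} (h : ans (e.eval σ) = none) (t x : ℕ)
    (k : List Program) : guardedRun ans (t + 1) ⟨.query x e :: k, σ⟩ = PMF.pure none := by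
  rw [guardedRun, h]

theorem guardedRun_succ_of_not_query {c : Config} (hc : ∀ x e k, c.code ≠ .query x e :: k) (t : ℕ) :
    guardedRun ans (t + 1) c = (step noOracle c).bind (guardedRun ans t) := by
  rw [guardedRun]
  rintro x e k σ rfl
  exact hc x e k rfl

theorem step_eq_of_not_query {c : Config} (hc : ∀ x e k, c.code ≠ .query x e :: k) (O O' : Oracle) :
    step O c = step O' c := by
  obtain ⟨_ | ⟨p, k⟩, σ⟩ := c
  · simp only [step]
  · cases p with
    | query x e => exact absurd rfl (hc x e k)
    | _ => simp only [step]

open Classical in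
theorem toOuterMeasure_pure (a : Option Data) (Z : Set (Option Data)) :
    (PMF.pure a).toOuterMeasure Z = if a ∈ Z then 1 else 0 := by
  simp

theorem tsum_mul_tsub_le {α : Type*} (μ : PMF α) (f : α → ℝ≥0∞) (s : ℝ≥0∞) :
    ∑' a, μ a * f a - s ≤ ∑' a, μ a * (f a - s) := by
  rw [tsub_le_iff_right]
  calc ∑' a, μ a * f a ≤ ∑' a, (μ a * (f a - s) + μ a * s) :=
        ENNReal.tsum_le_tsum fun a => by rw [← mul_add]; gcongr; exact le_tsub_add
    _ = ∑' a, μ a * (f a - s) + s := by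
        rw [ENNReal.tsum_add, ENNReal.tsum_mul_right, μ.tsum_coe, one_mul]

/-- Each of the `s` steps contributes at most `p` to the difference between the run with oracle `O`
and the run with the answers `ans`. -/
theorem haltProb_tsub_le_guardedRun {O : Oracle} {p : ℝ≥0∞} {G : Set Data}
    (hG : ∀ y ∈ G, some y ∈ Z) (hnone : none ∈ Z)
    (hans : ∀ q y, ans q = some y → ∀ h : Data → ℝ≥0∞, (∀ z, h z ≤ 1) →
      ∑' z, O q z * h z ≤ h y + p) {s t : ℕ} (hst : s ≤ t) (c : Config) :
    haltProb O s c G - s * p ≤ (guardedRun ans t c).toOuterMeasure Z := by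
  classical
  induction s generalizing t c with
  | zero =>
    rw [haltProb_zero]
    split_ifs with hc
    · obtain ⟨_, σ⟩ := c
      obtain ⟨rfl, hσ⟩ := hc
      rw [guardedRun_halted, toOuterMeasure_pure, if_pos (hG _ hσ)]
      exact tsub_le_self
    · simp
  | succ s ih =>
    obtain ⟨t, rfl⟩ : ∃ t', t = t' + 1 := ⟨t - 1, by omega⟩
    replace ih := @ih t (by omega)
    by_cases hc : ∃ x e k, c.code = .query x e :: k
    · obtain ⟨_, σ⟩ := c
      obtain ⟨x, e, k, rfl⟩ := hc
      rcases hy : ans (e.eval σ) with _ | y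
      · rw [guardedRun_succ_query_of_none hy, toOuterMeasure_pure, if_pos hnone]
        exact tsub_le_self.trans (haltProb_le_one _ _ _ _)
      · have hquery := hans _ _ hy (fun z => haltProb O s ⟨k, Function.update σ x z⟩ G)
          fun _ => haltProb_le_one _ _ _ _
        rw [guardedRun_succ_query_of_some hy, haltProb_succ_of_step_map (μ := O (e.eval σ))
          (g := fun z => ⟨k, Function.update σ x z⟩) (by simp [step])]
        calc _ ≤ haltProb O s ⟨k, Function.update σ x y⟩ G + p - (s + 1 : ℕ) * p := by gcongr
          _ ≤ haltProb O s ⟨k, Function.update σ x y⟩ G - s * p := by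
            rw [Nat.cast_succ, add_mul, one_mul, add_comm _ p, add_comm _ p]
            exact add_tsub_add_le_tsub_left
          _ ≤ _ := ih _
    · push Not at hc
      rw [guardedRun_succ_of_not_query hc, haltProb_succ, step_eq_of_not_query hc O noOracle,
        PMF.toOuterMeasure_bind_apply]
      calc _ ≤ ∑' c', step noOracle c c' * haltProb O s c' G - s * p := by
            gcongr; exact Nat.le_succ _
        _ ≤ ∑' c', step noOracle c c' * (haltProb O s c' G - s * p) := tsum_mul_tsub_le _ _ _
        _ ≤ _ := ENNReal.tsum_le_tsum fun c' => by gcongr; exact ih c'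

theorem toOuterMeasure_guardedRun_eq_one (hans : ∀ q, ans q ≠ none) (hZ : ∀ y, some y ∈ Z) (t : ℕ)
    (c : Config) : (guardedRun ans t c).toOuterMeasure Z = 1 := by
  induction t generalizing c with
  | zero => classical rw [guardedRun, toOuterMeasure_pure, if_pos (hZ _)]
  | succ t ih =>
    by_cases hc : ∃ x e k, c.code = .query x e :: k
    · obtain ⟨code, σ⟩ := c
      obtain ⟨x, e, k, rfl : code = _⟩ := hc
      obtain ⟨y, hy⟩ := Option.ne_none_iff_exists'.1 (hans (e.eval σ))
      rw [guardedRun_succ_query_of_some hy, ih]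
    · push Not at hc
      rw [guardedRun_succ_of_not_query hc, PMF.toOuterMeasure_bind_apply]
      simp only [ih, mul_one, PMF.tsum_coe]

end GuardedRun

namespace Simulation

/-- Renaming of the variables of the simulated algorithm: its variable `x` is kept in variable
`2 * x + 1`. Variable `0` holds the parameters of the simulated oracle, variable `2` the remaining
time in unary, variable `4` the flag that stops the simulation, variable `6` the value of a test;
the variables `8, 10, …` are the workspace of the subroutine that answers the queries. -/
def rename (e : Expr) : Expr := e.subst fun n => .var (2 * n + 1)

/-- Program that counts one step. -/
def tick : Program := .assign 2 (.tl (.var 2))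

/-- Program that evaluates a test, as false if there is no time left. -/
def test (e : Expr) : Program := .ite (.var 2) (.assign 6 (rename e)) (.assign 6 .nil)

/-- Program that raises the flag and uses up the time. -/
def abort : Program := .seq (.assign 2 .nil) (.assign 4 (.cons .nil .nil))

/-- Simulation of a query. The term `Q` computes from a query and the parameters the pair of `nil`
and the answer, or a pair whose first component is not `nil`, which stops the simulation. -/
def query (Q : Term) (x : ℕ) (e : Expr) : Program :=
  .seq (.assign 8 (.cons (rename e) (.var 0))) <| .seq (Q.compile 4) <|
    .ite (.hd (.var 8)) abort (.assign (2 * x + 1) (.tl (.var 8)))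

/-- One step of the simulation, skipped if there is no time left. -/
def timed (p : Program) : Program := .ite (.var 2) (.seq tick p) .skip

/-- Body of the simulation of a loop, where `p` simulates the body of the loop. -/
def loopBody (e : Expr) (p : Program) : Program := .seq (.seq tick p) (test e)

/-- The simulation of a program, queries being answered by the term `Q`. -/
def sim (Q : Term) : Program → Program
  | .skip => timed .skip
  | .assign x e => timed (.assign (2 * x + 1) (rename e))
  | .flip x => timed (.flip (2 * x + 1))
  | .query x e => timed (query Q x e)
  | .seq p q => timed (.seq (sim Q p) (sim Q q))
  | .ite e p q => timed (.ite (rename e) (sim Q p) (sim Q q))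
  | .loop e p => .seq (.seq (test e) (.loop (.var 6) (loopBody e (sim Q p)))) tick

/-- Program to be executed after the simulation: if the flag is raised, the output is `(nil . nil)`,
otherwise `W` computes it from the output of the simulated algorithm and the parameters. -/
def post (W : Term) : Program := .ite (.var 4) (.assign 0 (.cons .nil .nil))
  (.seq (.assign 0 (.cons (.var 1) (.var 0))) (W.compile 0))

/-- The stack of the simulation that corresponds to a stack of the simulated algorithm. -/
inductive StackRel (Q W : Term) : List Program → List Program → Prop
  | done : StackRel Q W [] [post W]
  | cons {k K : List Program} (p : Program) : StackRel Q W k K →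
      StackRel Q W (p :: k) (sim Q p :: K)
  | loop {k K : List Program} (e : Expr) (p : Program) : StackRel Q W k K →
      StackRel Q W (.loop e p :: k) (test e :: .loop (.var 6) (loopBody e (sim Q p)) :: tick :: K)

/-- The store of the simulation, with parameters `P` and remaining time `t`, that corresponds to a
store of the simulated algorithm. -/
structure StoreRel (P : Data) (t : ℕ) (σ τ : Store) : Prop where
  odd : ∀ x, τ (2 * x + 1) = σ x
  params : τ 0 = P
  clock : τ 2 = Data.unary t
  flag : τ 4 = .nil

variable {Q W : Term} {P : Data} {t : ℕ} {σ τ τ' : Store}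

namespace StoreRel

theorem eval_rename (h : StoreRel P t σ τ) (e : Expr) : (rename e).eval τ = e.eval σ := by
  rw [rename, Expr.eval_subst]
  congr 1
  funext n
  exact h.odd n

theorem tick (h : StoreRel P (t + 1) σ τ) : StoreRel P t σ (Function.update τ 2 (τ 2).tl) where
  odd x := by rw [Function.update_of_ne (by omega), h.odd]
  params := by rw [Function.update_of_ne (by omega), h.params]
  clock := by rw [Function.update_self, h.clock]; rfl
  flag := by rw [Function.update_of_ne (by omega), h.flag]

theorem update (h : StoreRel P t σ τ) (x : ℕ) (y : Data) :
    StoreRel P t (Function.update σ x y) (Function.update τ (2 * x + 1) y) where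
  odd z := by
    rcases eq_or_ne z x with rfl | hz
    · simp
    · rw [Function.update_of_ne hz, Function.update_of_ne (by omega), h.odd]
  params := by rw [Function.update_of_ne (by omega), h.params]
  clock := by rw [Function.update_of_ne (by omega), h.clock]
  flag := by rw [Function.update_of_ne (by omega), h.flag]

theorem frame (h : StoreRel P t σ τ) (hf : Term.Frame 3 τ τ') : StoreRel P t σ τ' where
  odd x := by rw [hf _ (by omega), h.odd]
  params := by rw [hf _ (by omega), h.params]
  clock := by rw [hf _ (by omega), h.clock]
  flag := by rw [hf _ (by omega), h.flag]

theorem clock_ne_nil (h : StoreRel P (t + 1) σ τ) : (Expr.var 2).eval τ ≠ .nil := by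
  rw [Expr.eval, h.clock]
  nofun

end StoreRel

/-- The answer to the query `q` that is computed by the term `Q`, if it does not stop the
simulation. -/
def answer (Q : Term) (P q : Data) : Option Data :=
  match Q.eval (.cons q P) with
  | .cons .nil y => some y
  | .nil => some .nil
  | .cons (.cons _ _) _ => none

theorem answer_eq_some {q y : Data} (h : answer Q P q = some y) :
    (Q.eval (.cons q P)).hd = .nil ∧ (Q.eval (.cons q P)).tl = y := by
  rcases hQ : Q.eval (.cons q P) with _ | ⟨_ | _, z⟩ <;> rw [answer, hQ] at h <;> cases h
  exacts [⟨rfl, rfl⟩, ⟨rfl, rfl⟩]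

theorem answer_eq_none {q : Data} (h : answer Q P q = none) :
    (Q.eval (.cons q P)).hd ≠ .nil := by
  rcases hQ : Q.eval (.cons q P) with _ | ⟨_ | _, z⟩ <;> rw [answer, hQ] at h <;> cases h
  nofun

/-- Output of the simulation, depending on the outcome of the run of the simulated algorithm. -/
def output (W : Term) (P : Data) : Option Data → Data
  | some y => W.eval (.cons y P)
  | none => .cons .nil .nil

/-! #### Deterministic parts of the simulation -/

section Deterministic

variable (O : Oracle)

theorem transforms_test (h : StoreRel P (t + 1) σ τ) (e : Expr) :
    Transforms O (test e) τ (Function.update τ 6 (e.eval σ)) 2 := by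
  rw [← h.eval_rename]
  exact .ite_of_ne_nil h.clock_ne_nil (.assign _ _ _ _)

theorem transforms_tick : Transforms O tick τ (Function.update τ 2 (τ 2).tl) 1 := .assign _ _ _ _

theorem reaches_timed (h : StoreRel P (t + 1) σ τ) (p : Program) (K : List Program) :
    Reaches O ⟨timed p :: K, τ⟩ ⟨p :: K, Function.update τ 2 (τ 2).tl⟩ 3 :=
  (Reaches.of_step (c' := ⟨.seq tick p :: K, τ⟩) (by simp [timed, step, h.clock_ne_nil])).trans <|
    (Reaches.seq ..).trans (transforms_tick O (p :: K))

theorem transforms_timed (h : StoreRel P (t + 1) σ τ) {p : Program} {s : ℕ}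
    (hp : Transforms O p (Function.update τ 2 (τ 2).tl) τ' s) :
    Transforms O (timed p) τ τ' (s + 3) :=
  fun K => ((reaches_timed O h p K).trans (hp K)).mono (by omega)

theorem transforms_post_of_flag_eq_nil (hflag : τ 4 = .nil) :
    ∃ τ', Transforms O (post W) τ τ' (W.cost (.cons (τ 1) (τ 0)) + 3) ∧
      τ' 0 = W.eval (.cons (τ 1) (τ 0)) := by
  obtain ⟨τ', hW, heval, -⟩ := W.computes_compile O 0
    (Function.update τ 0 (.cons (τ 1) (τ 0)))
  simp only [mul_zero, Function.update_self] at hW heval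
  exact ⟨τ', (Transforms.ite_of_eq_nil (e := .var 4) hflag
    ((Transforms.assign O 0 _ τ).seq hW)).mono (by omega), heval⟩

theorem transforms_post_of_flag_ne_nil (hflag : τ 4 ≠ .nil) :
    Transforms O (post W) τ (Function.update τ 0 (.cons .nil .nil)) 2 :=
  .ite_of_ne_nil hflag (.assign _ _ _ _)

theorem transforms_query (h : StoreRel P t σ τ) (e : Expr) :
    ∃ τ', StoreRel P t σ τ' ∧ τ' 8 = Q.eval (.cons (e.eval σ) P) ∧
      ∀ {τ''} {x s : ℕ}, Transforms O (.ite (.hd (.var 8)) abort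
        (.assign (2 * x + 1) (.tl (.var 8)))) τ' τ'' s →
        Transforms O (query Q x e) τ τ'' (Q.cost (.cons (e.eval σ) P) + 3 + s) := by
  set τ₁ := Function.update τ 8 (.cons (e.eval σ) P) with hτ₁
  obtain ⟨τ', hQ, heval, hframe⟩ := Q.computes_compile O 4 τ₁
  have hassign := Transforms.assign O 8 (.cons (rename e) (.var 0)) τ
  rw [Expr.eval, h.eval_rename, Expr.eval, h.params, ← hτ₁] at hassign
  simp only [hτ₁, Nat.reduceMul, Function.update_self] at hQ heval
  refine ⟨τ', (h.frame (.update (j := 4) τ _ (by omega))).frame (hframe.mono (by omega)), heval,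
    fun hite => (hassign.seq (hQ.seq hite)).mono (by omega)⟩

theorem transforms_query_of_some (h : StoreRel P t σ τ) {e : Expr} {y : Data}
    (hy : answer Q P (e.eval σ) = some y) (x : ℕ) :
    ∃ τ', Transforms O (query Q x e) τ τ' (Q.cost (.cons (e.eval σ) P) + 5) ∧
      StoreRel P t (Function.update σ x y) τ' := by
  obtain ⟨τ', hτ', h8, hquery⟩ := transforms_query (Q := Q) O h e
  obtain ⟨hhd, rfl⟩ := answer_eq_some hy
  refine ⟨_, hquery (x := x) (s := 2) (.ite_of_eq_nil ?_ (.assign _ _ _ _)), ?_⟩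
  · rw [Expr.eval, Expr.eval, h8, hhd]
  · rw [Expr.eval, Expr.eval, h8]
    exact hτ'.update x _

theorem transforms_query_of_none (h : StoreRel P t σ τ) {e : Expr}
    (hnone : answer Q P (e.eval σ) = none) (x : ℕ) :
    ∃ τ', Transforms O (query Q x e) τ τ' (Q.cost (.cons (e.eval σ) P) + 7) ∧
      τ' 2 = .nil ∧ τ' 4 ≠ .nil := by
  obtain ⟨τ', -, h8, hquery⟩ := transforms_query (Q := Q) O h e
  refine ⟨_, hquery (x := x) (s := 4) (.ite_of_ne_nil ?_ ((Transforms.assign _ _ _ _).seq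
    (.assign _ _ _ _))), ?_, ?_⟩
  · rw [Expr.eval, Expr.eval, h8]
    exact answer_eq_none hnone
  · simp [Expr.eval]
  · simp [Expr.eval]

theorem reaches_loop_of_clock_eq_nil (h : τ 2 = .nil) (e : Expr) (p : Program) (K : List Program) :
    ∃ τ', Reaches O ⟨test e :: .loop (.var 6) p :: tick :: K, τ⟩ ⟨K, τ'⟩ 4 ∧
      ∀ j, j ≠ 6 → τ' j = τ j := by
  have htest : Transforms O (test e) τ (Function.update τ 6 .nil) 2 :=
    .ite_of_eq_nil h (.assign O 6 .nil τ)
  have hloop : Transforms O (.loop (.var 6) p) (Function.update τ 6 .nil) _ 1 :=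
    .loop_of_eq_nil (by simp [Expr.eval])
  refine ⟨_, (htest _).trans ((hloop _).trans (transforms_tick O K)), fun j hj => ?_⟩
  rcases eq_or_ne j 2 with rfl | hj2
  · simp [h, Data.tl]
  · simp [hj2, hj]

theorem reaches_sim_of_clock_eq_nil (h : τ 2 = .nil) (p : Program) (K : List Program) :
    ∃ τ', Reaches O ⟨sim Q p :: K, τ⟩ ⟨K, τ'⟩ 6 ∧ ∀ j, j ≠ 6 → τ' j = τ j := by
  have htimed (q : Program) : Reaches O ⟨timed q :: K, τ⟩ ⟨K, τ⟩ 6 :=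
    (Transforms.ite_of_eq_nil (e := .var 2) h (.skip O τ) K).mono (by omega)
  cases p with
  | loop e q =>
    obtain ⟨τ', hloop, hτ'⟩ := reaches_loop_of_clock_eq_nil O h e (loopBody e (sim Q q)) K
    exact ⟨τ', (Reaches.seq ..).trans ((Reaches.seq ..).trans hloop), hτ'⟩
  | _ => exact ⟨τ, htimed _, fun _ _ => rfl⟩

theorem reaches_post_of_clock_eq_nil {k K : List Program} (hk : StackRel Q W k K)
    (h : τ 2 = .nil) :
    ∃ τ', Reaches O ⟨K, τ⟩ ⟨[post W], τ'⟩ (k.length * 8) ∧ ∀ j, j ≠ 6 → τ' j = τ j := by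
  induction hk generalizing τ with
  | done => exact ⟨τ, (Reaches.refl O _).mono (by omega), fun _ _ => rfl⟩
  | @cons k K p _ ih =>
    obtain ⟨τ₁, hsim, hτ₁⟩ := reaches_sim_of_clock_eq_nil O h p K (Q := Q)
    obtain ⟨τ', hrest, hτ'⟩ := ih (τ := τ₁) (by rw [hτ₁ 2 (by omega), h])
    exact ⟨τ', (hsim.trans hrest).mono (by rw [List.length_cons]; omega),
      fun j hj => by rw [hτ' j hj, hτ₁ j hj]⟩
  | @loop k K e p _ ih =>
    obtain ⟨τ₁, hloop, hτ₁⟩ := reaches_loop_of_clock_eq_nil O h e (loopBody e (sim Q p)) K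
    obtain ⟨τ', hrest, hτ'⟩ := ih (τ := τ₁) (by rw [hτ₁ 2 (by omega), h])
    exact ⟨τ', (hloop.trans hrest).mono (by rw [List.length_cons]; omega),
      fun j hj => by rw [hτ' j hj, hτ₁ j hj]⟩

end Deterministic

/-! ### Correctness of the simulation -/

section Correctness

/-- With `t` steps remaining, the simulation has an output in `Y` with at least the probability of
the run that it simulates. Its time bound consists of `S` for each remaining step, `8` for each item
on the stack, and `Sp` for the final program `post W`. -/
def Simulates (O : Oracle) (Q W : Term) (P : Data) (S Sp t : ℕ) : Prop :=
  ∀ ⦃k K : List Program⦄ ⦃σ τ : Store⦄, StackRel Q W k K → StoreRel P t σ τ → ∀ Y : Set Data,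
    (guardedRun (answer Q P) t ⟨k, σ⟩).toOuterMeasure (output W P ⁻¹' Y) ≤
      haltProb O (t * S + (k.length + t) * 8 + Sp) ⟨K, τ⟩ Y

variable {O : Oracle} {S Sp : ℕ} {k K : List Program} {Y : Set Data}

open Classical in
theorem toOuterMeasure_pure_preimage_output (o : Option Data) :
    (PMF.pure o).toOuterMeasure (output W P ⁻¹' Y) = if output W P o ∈ Y then 1 else 0 := by
  rw [toOuterMeasure_pure, Set.mem_preimage]

theorem le_haltProb_post {N : ℕ} (hτ : StoreRel P t σ τ)
    (hN : W.cost (.cons (σ 0) P) + 3 ≤ N) :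
    (PMF.pure (some (σ 0))).toOuterMeasure (output W P ⁻¹' Y) ≤ haltProb O N ⟨[post W], τ⟩ Y := by
  classical
  obtain ⟨τ', hpost, heval⟩ := transforms_post_of_flag_eq_nil (W := W) O hτ.flag
  rw [hτ.params, show τ 1 = σ 0 from hτ.odd 0] at hpost heval
  refine le_trans (le_of_eq ?_) ((hpost []).haltProb_le (m := 0) hN Y)
  rw [haltProb_halted, toOuterMeasure_pure_preimage_output, output, heval]

theorem le_haltProb_post_of_flag {N : ℕ} (hflag : τ 4 ≠ .nil) (hN : 2 ≤ N) :
    (PMF.pure none).toOuterMeasure (output W P ⁻¹' Y) ≤ haltProb O N ⟨[post W], τ⟩ Y := by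
  classical
  refine le_trans (le_of_eq ?_)
    ((transforms_post_of_flag_ne_nil O hflag []).haltProb_le (m := 0) hN Y)
  rw [haltProb_halted, toOuterMeasure_pure_preimage_output, output, Function.update_self]

theorem simulates_zero (hSp : ∀ y, W.cost (.cons y P) + 3 ≤ Sp) :
    Simulates O Q W P S Sp 0 := by
  intro k K σ τ hk hτ Y
  obtain ⟨τ', hdead, heq⟩ := reaches_post_of_clock_eq_nil O hk hτ.clock
  have hτ' : StoreRel P 0 σ τ' :=
    hτ.frame fun j hj => heq j (hj 3 le_rfl)
  exact (le_haltProb_post hτ' (hSp _)).trans (hdead.haltProb_le (by omega) Y)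

namespace Simulates

variable (ih : Simulates O Q W P S Sp t)

include ih

theorem advance {k' K' : List Program} {σ' τ' : Store} {T : ℕ}
    (hrun : guardedRun (answer Q P) (t + 1) ⟨k, σ⟩ = guardedRun (answer Q P) t ⟨k', σ'⟩)
    (hk' : StackRel Q W k' K') (hτ' : StoreRel P t σ' τ') (hlen : k'.length ≤ k.length + 1)
    (hT : T ≤ S) (hreach : Reaches O ⟨K, τ⟩ ⟨K', τ'⟩ T) :
    (guardedRun (answer Q P) (t + 1) ⟨k, σ⟩).toOuterMeasure (output W P ⁻¹' Y) ≤
      haltProb O ((t + 1) * S + (k.length + (t + 1)) * 8 + Sp) ⟨K, τ⟩ Y := by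
  rw [hrun]
  refine (ih hk' hτ' Y).trans (hreach.haltProb_le ?_ Y)
  rw [Nat.succ_mul]
  omega

theorem succ_loop (hS : 10 ≤ S) (hk : StackRel Q W k K) (hτ : StoreRel P (t + 1) σ τ) (e : Expr)
    (p : Program) {K' : List Program} {T : ℕ} (hT : T ≤ 2)
    (hreach : Reaches O ⟨K', τ⟩
      ⟨test e :: .loop (.var 6) (loopBody e (sim Q p)) :: tick :: K, τ⟩ T) :
    (guardedRun (answer Q P) (t + 1) ⟨.loop e p :: k, σ⟩).toOuterMeasure (output W P ⁻¹' Y) ≤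
      haltProb O ((t + 1) * S + ((Program.loop e p :: k).length + (t + 1)) * 8 + Sp)
        ⟨K', τ⟩ Y := by
  have htest := hreach.trans (transforms_test O hτ e _)
  have hτ₁ : StoreRel P (t + 1) σ (Function.update τ 6 (e.eval σ)) :=
    hτ.frame (.update (j := 3) τ _ le_rfl)
  set τ₁ := Function.update τ 6 (e.eval σ) with hτ₁_def
  have h6 : (Expr.var 6).eval τ₁ = e.eval σ := by simp [hτ₁_def, Expr.eval]
  by_cases he : e.eval σ = .nil
  · exact ih.advance (by simp [guardedRun, step, he]) hk hτ₁.tick (by rw [List.length_cons]; omega)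
      (by omega) (htest.trans ((Transforms.loop_of_eq_nil (h6.trans he) _).trans
        (transforms_tick O K)))
  · have hloop : Reaches O ⟨.loop (.var 6) (loopBody e (sim Q p)) :: tick :: K, τ₁⟩
        ⟨loopBody e (sim Q p) :: .loop (.var 6) (loopBody e (sim Q p)) :: tick :: K, τ₁⟩ 1 :=
      .of_step (by simp [step, h6, he])
    exact ih.advance (by simp [guardedRun, step, he]) (.cons p (.loop e p hk)) hτ₁.tick (by simp)
      (by omega) (htest.trans (hloop.trans ((Reaches.seq ..).trans ((Reaches.seq ..).trans
        (transforms_tick O _)))))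

theorem succ_flip (hS : 10 ≤ S) (hk : StackRel Q W k K) (hτ : StoreRel P (t + 1) σ τ) (x : ℕ) :
    (guardedRun (answer Q P) (t + 1) ⟨.flip x :: k, σ⟩).toOuterMeasure (output W P ⁻¹' Y) ≤
      haltProb O ((t + 1) * S + ((Program.flip x :: k).length + (t + 1)) * 8 + Sp)
        ⟨sim Q (.flip x) :: K, τ⟩ Y := by
  set τ₁ := Function.update τ 2 (τ 2).tl
  have hrun : guardedRun (answer Q P) (t + 1) ⟨.flip x :: k, σ⟩ =
      (PMF.uniformOfFintype Bool).bind fun b =>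
        guardedRun (answer Q P) t ⟨k, Function.update σ x (.ofBool b)⟩ := by
    simp only [guardedRun, step, PMF.bind_map, Function.comp_def]
  rw [hrun, PMF.toOuterMeasure_bind_apply]
  calc _ ≤ ∑' b, PMF.uniformOfFintype Bool b * haltProb O (t * S + (k.length + t) * 8 + Sp)
          ⟨K, Function.update τ₁ (2 * x + 1) (.ofBool b)⟩ Y :=
        ENNReal.tsum_le_tsum fun b => by gcongr; exact ih hk (hτ.tick.update x _) Y
    _ = haltProb O (t * S + (k.length + t) * 8 + Sp + 1) ⟨.flip (2 * x + 1) :: K, τ₁⟩ Y :=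
        (haltProb_succ_of_step_map (by simp only [step]) _ _).symm
    _ ≤ _ := (reaches_timed O hτ _ K).haltProb_le
        (by rw [Nat.succ_mul, List.length_cons]; omega) Y

theorem succ_query (hS : ∀ q, Q.cost (.cons q P) + 10 ≤ S) (hk : StackRel Q W k K)
    (hτ : StoreRel P (t + 1) σ τ) (x : ℕ) (e : Expr) :
    (guardedRun (answer Q P) (t + 1) ⟨.query x e :: k, σ⟩).toOuterMeasure (output W P ⁻¹' Y) ≤
      haltProb O ((t + 1) * S + ((Program.query x e :: k).length + (t + 1)) * 8 + Sp)
        ⟨sim Q (.query x e) :: K, τ⟩ Y := by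
  have hcost := hS (e.eval σ)
  rcases hy : answer Q P (e.eval σ) with _ | y
  · obtain ⟨τ', hquery, hclock, hflag⟩ := transforms_query_of_none O hτ.tick hy x
    obtain ⟨τ'', hdead, heq⟩ := reaches_post_of_clock_eq_nil O hk hclock
    rw [guardedRun_succ_query_of_none hy]
    refine (le_haltProb_post_of_flag (N := 2) (by rwa [heq 4 (by omega)]) le_rfl).trans
      (((transforms_timed O hτ hquery K).trans hdead).haltProb_le ?_ Y)
    rw [Nat.succ_mul, List.length_cons]
    omega
  · obtain ⟨τ', hquery, hτ'⟩ := transforms_query_of_some O hτ.tick hy x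
    exact ih.advance (guardedRun_succ_query_of_some hy t x k) hk hτ'
      (by rw [List.length_cons]; omega) (by omega) (transforms_timed O hτ hquery K)

theorem succ (hS : ∀ q, Q.cost (.cons q P) + 10 ≤ S) (hSp : ∀ y, W.cost (.cons y P) + 3 ≤ Sp) :
    Simulates O Q W P S Sp (t + 1) := by
  intro k K σ τ hk hτ Y
  have hS' := hS .nil
  have hlen (p : Program) (k : List Program) : k.length ≤ (p :: k).length + 1 := by
    rw [List.length_cons]; omega
  have heval (e : Expr) := hτ.tick.eval_rename e
  cases hk with
  | done =>
    have := hSp (σ 0)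
    exact guardedRun_halted (answer Q P) _ σ ▸ le_haltProb_post hτ (by omega)
  | loop e p hk => exact ih.succ_loop (by omega) hk hτ e p (Nat.zero_le _) (.refl O _)
  | @cons k K p hk =>
    cases p with
    | skip =>
      exact ih.advance (k' := k) (σ' := σ) (by simp [guardedRun, step]) hk hτ.tick (hlen _ _)
        (by omega) (transforms_timed O hτ (.skip O _) _)
    | assign x e =>
      refine ih.advance (k' := k) (by simp [guardedRun, step]) hk (hτ.tick.update x (e.eval σ))
        (hlen _ _) (by omega) (transforms_timed O hτ (s := 1) ?_ _)
      exact heval e ▸ .assign O _ _ _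
    | flip x => exact ih.succ_flip (by omega) hk hτ x
    | query x e => exact ih.succ_query hS hk hτ x e
    | seq p q =>
      exact ih.advance (k' := p :: q :: k) (σ' := σ) (by simp [guardedRun, step])
        (.cons p (.cons q hk)) hτ.tick (by simp) (by omega)
        ((reaches_timed O hτ _ _).trans (.seq ..))
    | ite e p q =>
      by_cases he : e.eval σ = .nil
      · exact ih.advance (k' := q :: k) (σ' := σ) (by simp [guardedRun, step, he]) (.cons q hk)
          hτ.tick (by simp) (by omega)
          ((reaches_timed O hτ _ _).trans (.of_step (by simp [step, heval, he])))
      · exact ih.advance (k' := p :: k) (σ' := σ) (by simp [guardedRun, step, he]) (.cons p hk)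
          hτ.tick (by simp) (by omega)
          ((reaches_timed O hτ _ _).trans (.of_step (by simp [step, heval, he])))
    | loop e p => exact ih.succ_loop (by omega) hk hτ e p le_rfl ((Reaches.seq ..).trans (.seq ..))

end Simulates

theorem simulates (O : Oracle) (hS : ∀ q, Q.cost (.cons q P) + 10 ≤ S)
    (hSp : ∀ y, W.cost (.cons y P) + 3 ≤ Sp) (t : ℕ) : Simulates O Q W P S Sp t := by
  induction t with
  | zero => exact simulates_zero hSp
  | succ t ih => exact ih.succ hS hSp

end Correctness

/-- Program that distributes the value of `F` in `driver` over the variables of the simulation. -/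
def load : Program :=
  .seq (.assign 2 (.hd (.var 0))) <| .seq (.assign 1 (.hd (.tl (.var 0)))) <|
    .seq (.assign 0 (.tl (.tl (.var 0)))) (.assign 4 .nil)

/-- Compute the parameters, then simulate. The value of `F` consists of the time limit (in unary),
the input of the simulated algorithm, and the parameters of the oracle. -/
def driver (F Q W : Term) (A : Program) : Program :=
  .seq (F.compile 0) (.seq load (.seq (sim Q A) (post W)))

theorem transforms_load {O : Oracle} {x P : Data} (A : Program)
    (h0 : τ 0 = .cons (.unary t) (.cons x P)) (hodd : ∀ y, y ≠ 0 → τ (2 * y + 1) = .nil) :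
    ∃ τ', Transforms O load τ τ' 7 ∧ StoreRel P t (start A x).store τ' := by
  refine ⟨_, (Transforms.assign O _ _ τ).seq ((Transforms.assign O _ _ _).seq
    ((Transforms.assign O _ _ _).seq (.assign O _ _ _))), fun y => ?_, ?_, ?_, ?_⟩
  · rcases eq_or_ne y 0 with rfl | hy
    · simp [start, Expr.eval, h0, Data.hd, Data.tl]
    · iterate 4 rw [Function.update_of_ne (by omega)]
      simp [start, hy, hodd y hy]
  · simp [Expr.eval, h0, Data.tl]
  · simp [Expr.eval, h0, Data.hd]
  · simp [Expr.eval]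

theorem le_haltProb_driver {F Q W : Term} {A : Program} {x x' P : Data} {t : ℕ} {Y : Set Data}
    (O : Oracle) (hF : F.eval x = .cons (.unary t) (.cons x' P)) {S Sp N : ℕ}
    (hS : ∀ q, Q.cost (.cons q P) + 10 ≤ S) (hSp : ∀ y, W.cost (.cons y P) + 3 ≤ Sp)
    (hN : F.cost x + 10 + (t * S + (1 + t) * 8 + Sp) ≤ N) :
    (guardedRun (answer Q P) t (start A x')).toOuterMeasure (output W P ⁻¹' Y) ≤
      haltProb O N (start (driver F Q W A) x) Y := by
  obtain ⟨τ, hcompute, heval, hframe⟩ := F.computes_compile O 0 (start A x).store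
  obtain ⟨τ', hload, hτ'⟩ := transforms_load (O := O) A (heval.trans hF) fun y _ => by
    rw [hframe _ (by omega)]; simp [start]
  have hreach : Reaches O (start (driver F Q W A) x) ⟨[sim Q A, post W], τ'⟩ (F.cost x + 10) :=
    ((Reaches.seq ..).trans ((hcompute _).trans ((Reaches.seq ..).trans
      ((hload _).trans (.seq ..))))).mono (by change 1 + (F.cost x + _) ≤ _; omega)
  exact (simulates O hS hSp t (.cons A .done) hτ' Y).trans
    (hreach.haltProb_le (by simpa [add_comm] using hN) Y)

end Simulation

/-! ### Tensor powers of lists -/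

section Tensor

/-- Scalar product of a list with a list of bits, the latter standing for a vector of zeros and
ones; the shorter list is padded with zeros. -/
def dot {K : Type*} [Semiring K] : List K → List Bool → K
  | a :: as, b :: bs => (if b then a else 0) + dot as bs
  | _, _ => 0

section Dot

variable {K : Type*} [Semiring K]

theorem dot_append {as : List K} {bs : List Bool} (h : as.length = bs.length) (as' : List K)
    (bs' : List Bool) : dot (as ++ as') (bs ++ bs') = dot as bs + dot as' bs' := by
  induction as generalizing bs with
  | nil => cases bs <;> simp_all [dot]
  | cons a as ih => cases bs <;> simp_all [dot, add_assoc]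

theorem dot_ofFn {n : ℕ} (f : Fin n → K) (g : Fin n → Bool) :
    dot (List.ofFn f) (List.ofFn g) = ∑ i, if g i then f i else 0 := by
  induction n with
  | zero => simp [dot]
  | succ n ih => simp [List.ofFn_succ, dot, ih, Fin.sum_univ_succ]

theorem sum_getD_mul_eq_dot {d : ℕ} {as : List K} (h : as.length ≤ d) (bs : List Bool) :
    ∑ i : Fin d, as.getD i 0 * (if bs.getD i false then 1 else 0) = dot as bs := by
  induction as generalizing bs d with
  | nil => simp [dot]
  | cons a as ih =>
    obtain ⟨d, rfl⟩ : ∃ d', d = d' + 1 := ⟨d - 1, by rw [List.length_cons] at h; omega⟩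
    rcases bs with _ | ⟨b, bs⟩
    · simp [dot]
    · simp only [Fin.sum_univ_succ, Fin.val_zero, List.getD_cons_zero, mul_ite, mul_one, mul_zero,
        Fin.val_succ, List.getD_cons_succ, dot]
      congr 1
      simpa using ih (by simpa using h) bs

end Dot

/-- Tensor product of two lists. The entries are in the reverse of the lexicographic order, as they
are produced by two nested loops that push them on a stack. -/
def tensor {α : Type*} (mul : α → α → α) (u w : List α) : List α :=
  u.foldl (fun acc x => w.foldl (fun acc y => mul x y :: acc) acc) []

/-- Tensor power of a list. -/
def tensorPow {α : Type*} (mul : α → α → α) (one : α) (u : List α) (r : ℕ) : List α :=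
  (tensor mul u)^[r] [one]

section Length

variable {α : Type*} (mul : α → α → α)

theorem tensor_eq_reverse_flatMap (u w : List α) :
    tensor mul u w = (u.flatMap fun x => w.map (mul x)).reverse := by
  have hfoldl (acc : List α) :
      u.foldl (fun acc x => w.foldl (fun acc y => mul x y :: acc) acc) acc =
        (u.flatMap fun x => w.map (mul x)).reverse ++ acc := by
    induction u generalizing acc with
    | nil => rfl
    | cons x u ih =>
      rw [List.foldl_cons, ih, List.foldl_flip_cons_eq_append]
      simp
  exact (hfoldl []).trans (List.append_nil _)

theorem length_tensor (u w : List α) : (tensor mul u w).length = u.length * w.length := by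
  simp [tensor_eq_reverse_flatMap, List.length_flatMap]

theorem tensorPow_succ (one : α) (u : List α) (r : ℕ) :
    tensorPow mul one u (r + 1) = tensor mul u (tensorPow mul one u r) :=
  Function.iterate_succ_apply' ..

theorem length_tensorPow (one : α) (u : List α) (r : ℕ) :
    (tensorPow mul one u r).length = u.length ^ r := by
  induction r with
  | zero => simp [tensorPow]
  | succ r ih => rw [tensorPow_succ, length_tensor, ih, pow_succ']

end Length

section DotTensor

variable {K : Type*} [CommSemiring K]

theorem dot_reverse {as : List K} {bs : List Bool} (h : as.length = bs.length) :
    dot as.reverse bs.reverse = dot as bs := by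
  induction as generalizing bs with
  | nil => simp [dot]
  | cons a as ih =>
    rcases bs with _ | ⟨b, bs⟩
    · simp at h
    · rw [List.reverse_cons, List.reverse_cons, dot_append (by simpa using h),
        ih (by simpa using h)]
      simp [dot, add_comm]

theorem dot_map_mul (a : K) (b : Bool) (cs : List K) (ds : List Bool) :
    dot (cs.map (a * ·)) (ds.map (b && ·)) = (if b then a else 0) * dot cs ds := by
  induction cs generalizing ds with
  | nil => simp [dot]
  | cons c cs ih =>
    rcases ds with _ | ⟨d, ds⟩
    · simp [dot]
    · rw [List.map_cons, List.map_cons, dot, dot, ih]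
      cases b <;> cases d <;> simp [mul_add]

theorem dot_tensor {as cs : List K} {bs ds : List Bool} (h : as.length = bs.length)
    (h' : cs.length = ds.length) :
    dot (tensor (· * ·) as cs) (tensor (· && ·) bs ds) = dot as bs * dot cs ds := by
  rw [tensor_eq_reverse_flatMap, tensor_eq_reverse_flatMap,
    dot_reverse (by simp [List.length_flatMap, h, h'])]
  induction as generalizing bs with
  | nil => simp [dot]
  | cons a as ih =>
    rcases bs with _ | ⟨b, bs⟩
    · simp at h
    · rw [List.flatMap_cons, List.flatMap_cons, dot_append (by simpa using h'), dot_map_mul,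
        ih (by simpa using h), dot, add_mul]

theorem dot_tensorPow {as : List K} {bs : List Bool} (h : as.length = bs.length) (r : ℕ) :
    dot (tensorPow (· * ·) 1 as r) (tensorPow (· && ·) true bs r) = dot as bs ^ r := by
  induction r with
  | zero => simp [tensorPow, dot]
  | succ r ih =>
    rw [tensorPow_succ, tensorPow_succ, dot_tensor h (by simp only [length_tensorPow, h]), ih,
      pow_succ']

end DotTensor

end Tensor

/-! ### Binary counters -/

/-- The `m` lowest bits of a number, least significant bit first. -/
def bitList : ℕ → ℕ → List Bool
  | 0, _ => []
  | m + 1, l => decide (l % 2 = 1) :: bitList m (l / 2)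

/-- The list `a, 2a, 4a, …` of length `m`, whose scalar product with the bits of a number `l` is
`a * l`. -/
def weights {K : Type*} [Semiring K] : ℕ → K → List K
  | 0, _ => []
  | m + 1, a => a :: weights m (2 * a)

theorem length_bitList (m l : ℕ) : (bitList m l).length = m := by
  induction m generalizing l <;> simp_all [bitList]

theorem length_weights {K : Type*} [Semiring K] (m : ℕ) (a : K) : (weights m a).length = m := by
  induction m generalizing a <;> simp_all [weights]

theorem dot_weights {K : Type*} [CommSemiring K] {m l : ℕ} (a : K) (hl : l < 2 ^ m) :
    dot (weights m a) (bitList m l) = a * l := by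
  induction m generalizing a l with
  | zero => simp_all [dot, weights, bitList]
  | succ m ih =>
    have hl2 : (l : K) = (l % 2 : ℕ) + 2 * (l / 2 : ℕ) := by
      exact_mod_cast congrArg Nat.cast (Nat.mod_add_div l 2).symm
    rw [weights, bitList, dot, ih _ (by omega), hl2]
    rcases Nat.mod_two_eq_zero_or_one l with h | h
    · simp [h]; ring
    · simp [h]; ring

theorem bitList_injOn (m : ℕ) : Set.InjOn (bitList m) (Set.Iio (2 ^ m)) := fun l hl l' hl' h => by
  simpa [h, dot_weights 1 hl'] using (dot_weights (1 : ℕ) hl).symm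

theorem exists_bitList_eq (l : List Bool) : ∃ k < 2 ^ l.length, bitList l.length k = l := by
  induction l with
  | nil => exact ⟨0, by simp, rfl⟩
  | cons b l ih =>
    obtain ⟨k, hk, hl⟩ := ih
    refine ⟨2 * k + b.toNat, ?_, ?_⟩
    · have := b.toNat_lt
      rw [List.length_cons, pow_succ]
      omega
    · have hhalf : (2 * k + b.toNat) / 2 = k := by have := b.toNat_lt; omega
      rw [List.length_cons, bitList, hhalf, hl]
      cases b <;> simp [Nat.add_mod]

/-! ### Decision processes with rewards at the end -/

theorem tsum_pure_mul {α : Type*} (a : α) (h : α → ℝ≥0∞) : ∑' z, PMF.pure a z * h z = h a := by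
  rw [tsum_eq_single a fun z hz => by simp [PMF.pure_apply, hz]]
  simp

theorem tsum_map_mul {α β : Type*} (μ : PMF α) (f : α → β) (h : β → ℝ≥0∞) :
    ∑' z, μ.map f z * h z = ∑' x, μ x * h (f x) := by
  simp_rw [PMF.map_apply, ← ENNReal.tsum_mul_right]
  rw [ENNReal.tsum_comm]
  refine tsum_congr fun x => ?_
  rw [tsum_eq_single (f x) fun z hz => by simp [hz]]
  simp

/-- The distribution on `{0, 1}` with probability `min x 1` of `1`. -/
noncomputable def bernoulliReward (x : ℝ≥0∞) : PMF ℚ :=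
  PMF.ofFinset (fun q => if q = 1 then min x 1 else if q = 0 then 1 - min x 1 else 0) {0, 1}
    (by simp [tsub_add_cancel_of_le (min_le_right x 1)])
    (fun q hq => by simp_all)

theorem bernoulliReward_apply (x : ℝ≥0∞) (q : ℚ) :
    bernoulliReward x q = if q = 1 then min x 1 else if q = 0 then 1 - min x 1 else 0 := rfl

theorem mem_support_bernoulliReward {x : ℝ≥0∞} {q : ℚ} (h : q ∈ (bernoulliReward x).support) :
    q = 0 ∨ q = 1 := by
  by_contra! hq
  exact (PMF.mem_support_iff _ _).1 h (by simp [bernoulliReward_apply, hq])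

theorem expect_bernoulliReward {x : ℝ} (h0 : 0 ≤ x) (h1 : x ≤ 1) :
    expect (bernoulliReward (ENNReal.ofReal x)) = x := by
  rw [expect, tsum_eq_single 1]
  · simp [bernoulliReward_apply, h0, h1]
  · intro q hq
    by_cases hq0 : q = 0 <;> simp [bernoulliReward_apply, hq, hq0]

theorem tsum_bernoulliReward_mul_le (x : ℝ≥0∞) (h : ℚ → ℝ≥0∞) (h1 : h 1 ≤ 1) :
    ∑' q, bernoulliReward x q * h q ≤ h 0 + x := by
  rw [tsum_eq_sum (s := {0, 1}) fun q hq => by simp_all [bernoulliReward_apply],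
    Finset.sum_pair zero_ne_one]
  calc _ ≤ 1 * h 0 + x * 1 := by
        gcongr
        · exact PMF.coe_le_one _ _
        · simp [bernoulliReward_apply]
    _ = h 0 + x := by rw [one_mul, mul_one]

namespace MDP

variable {k : ℕ} {M : MDP k} {π : M.Policy}

theorem returnDist_none (n : ℕ) : M.returnDist π n none = PMF.pure 0 := by cases n <;> rfl

theorem returnDist_succ_of_trans_eq_none {n : ℕ} {s : M.State} (h : M.trans s (π s) = none) :
    M.returnDist π (n + 1) (some s) = M.reward s (π s) := by
  simp [returnDist, h, returnDist_none, PMF.pure_map]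

theorem returnDist_succ_of_reward_eq_pure_zero {n : ℕ} {s : M.State}
    (h : M.reward s (π s) = PMF.pure 0) :
    M.returnDist π (n + 1) (some s) = M.returnDist π n (M.trans s (π s)) := by
  simp only [returnDist, h, PMF.pure_bind, zero_add]
  exact PMF.map_id _

theorem Q_of_trans_eq_none {s : M.State} {a : Fin k} (h : M.trans s a = none) :
    M.Q π s a = expect (M.reward s a) := by
  simp [Q, h, returnDist_none, PMF.pure_map]

theorem Q_of_trans_eq_some {s s' : M.State} {a : Fin k} (h : M.trans s a = some s')
    (h' : M.reward s a = PMF.pure 0) : M.Q π s a = M.V π s' := by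
  simp only [Q, V, h, h', PMF.pure_bind, zero_add]
  exact congrArg expect (PMF.map_id _)

end MDP

namespace MDP

variable {k : ℕ} {M : MDP k} {f : M.State → ℝ}

/-- Only the last action, taken in a state `s`, is rewarded, with expectation `f s`; no action
increases `f`, and in every state some action preserves it. Hence `f` is the optimal value. -/
structure IsFinalReward (M : MDP k) (f : M.State → ℝ) : Prop where
  expect_reward {s a} : M.trans s a = none → expect (M.reward s a) = f s
  reward_eq {s a s'} : M.trans s a = some s' → M.reward s a = PMF.pure 0
  le {s a s'} : M.trans s a = some s' → f s' ≤ f s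
  exists_eq (s) : ∃ a, ∀ s', M.trans s a = some s' → f s' = f s

theorem traj_succ (π : M.Policy) {s s' : M.State} (h : M.trans s (π s) = some s') (n : ℕ) :
    M.traj π s (n + 1) = M.traj π s' n := by
  rw [traj, traj, Function.iterate_succ_apply, Option.bind_some, h]

namespace IsFinalReward

variable (hf : M.IsFinalReward f)

include hf

theorem expect_returnDist_le (π : M.Policy) {n : ℕ} {s : M.State} (hn : M.traj π s n = none) :
    expect (M.returnDist π n (some s)) ≤ f s := by
  induction n generalizing s with
  | zero => simp [traj] at hn
  | succ n ih =>
    rcases h : M.trans s (π s) with _ | s'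
    · rw [returnDist_succ_of_trans_eq_none h, hf.expect_reward h]
    · rw [returnDist_succ_of_reward_eq_pure_zero (hf.reward_eq h), h]
      exact (ih ((traj_succ π h n).symm.trans hn)).trans (hf.le h)

theorem expect_returnDist_eq {π : M.Policy}
    (hπ : ∀ s s', M.trans s (π s) = some s' → f s' = f s) {n : ℕ} {s : M.State}
    (hn : M.traj π s n = none) : expect (M.returnDist π n (some s)) = f s := by
  induction n generalizing s with
  | zero => simp [traj] at hn
  | succ n ih =>
    rcases h : M.trans s (π s) with _ | s'
    · rw [returnDist_succ_of_trans_eq_none h, hf.expect_reward h]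
    · rw [returnDist_succ_of_reward_eq_pure_zero (hf.reward_eq h), h,
        ih ((traj_succ π h n).symm.trans hn), hπ s s' h]

theorem Vstar_eq (s : M.State) : M.Vstar s = f s := by
  choose π hπ using hf.exists_eq
  have : Nonempty M.Policy := ⟨π⟩
  have hle (π' : M.Policy) : M.V π' s ≤ f s := hf.expect_returnDist_le π' (M.ends π' s)
  have heq : M.V π s = f s := hf.expect_returnDist_eq hπ (M.ends π s)
  exact le_antisymm (ciSup_le hle) (heq.ge.trans (le_ciSup ⟨f s, Set.forall_mem_range.2 hle⟩ π))

theorem Qstar_eq (s : M.State) (a : Fin k) : M.Qstar s a = (M.trans s a).elim (f s) f := by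
  have : Nonempty M.Policy := ⟨fun _ => a⟩
  rcases h : M.trans s a with _ | s'
  · simp only [Qstar, Q_of_trans_eq_none h, hf.expect_reward h, ciSup_const, Option.elim]
  · simp only [Qstar, Q_of_trans_eq_some h (hf.reward_eq h), Option.elim]
    exact hf.Vstar_eq s'

end IsFinalReward

end MDP

/-! ### The decision process of a formula -/

namespace Game

section Next

variable {v m : ℕ} {φ : Formula v}

/-- States: a counter below `2 ^ m`, and an assignment. -/
abbrev State (m v : ℕ) : Type := Fin (2 ^ m) × (Fin v → Bool)

/-- The first clause that is false under `w`. -/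
def firstUnsat (φ : Formula v) (w : Fin v → Bool) : Option (Clause v) :=
  φ.find? fun c => decide (∀ i, w (c i).1 ≠ (c i).2)

/-- Change of the value of the variable `i`. -/
def flipAt (w : Fin v → Bool) (i : Fin v) : Fin v → Bool := Function.update w i (!w i)

/-- In the state `(l, w)`, the action `a` flips the variable of the `a`-th literal of the first
clause violated by `w`. The game ends if there is no such clause, or no time left. -/
def next (φ : Formula v) (m : ℕ) (s : State m v) (a : Fin 3) : Option (State m v) :=
  match firstUnsat φ s.2 with
  | none => none
  | some c => if h : (s.1 : ℕ) + 1 < 2 ^ m then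
      some (⟨(s.1 : ℕ) + 1, h⟩, flipAt s.2 (c a).1) else none

theorem firstUnsat_eq_none {w : Fin v → Bool} : firstUnsat φ w = none ↔ Satisfies w φ := by
  simp [firstUnsat, List.find?_eq_none, Satisfies]

theorem firstUnsat_eq_some {w : Fin v → Bool} {c : Clause v} (h : firstUnsat φ w = some c) :
    c ∈ φ ∧ ∀ i, w (c i).1 ≠ (c i).2 :=
  ⟨List.mem_of_find?_eq_some h, by simpa using List.find?_some h⟩

theorem next_eq_some {s s' : State m v} {a : Fin 3} (h : next φ m s a = some s') :
    ∃ c, firstUnsat φ s.2 = some c ∧ (s'.1 : ℕ) = s.1 + 1 ∧ s'.2 = flipAt s.2 (c a).1 := by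
  rw [next] at h
  split at h
  · cases h
  · next c hc =>
    split_ifs at h
    cases h
    exact ⟨c, hc, rfl, rfl⟩

theorem next_eq_none {s : State m v} {a : Fin 3} :
    next φ m s a = none ↔ Satisfies s.2 φ ∨ (s.1 : ℕ) + 1 = 2 ^ m := by
  have hs := s.1.2
  rw [next, ← firstUnsat_eq_none]
  split
  · simp [*]
  · split_ifs <;> simp [*] <;> omega

theorem next_of_firstUnsat {s : State m v} {c : Clause v} (hc : firstUnsat φ s.2 = some c)
    (a : Fin 3) (h : (s.1 : ℕ) + 1 < 2 ^ m) :
    next φ m s a = some (⟨(s.1 : ℕ) + 1, h⟩, flipAt s.2 (c a).1) := by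
  simp [next, hc, h]

theorem iterate_next {π : State m v → Fin 3} {t : ℕ} {s s' : State m v}
    (h : (fun o : Option (State m v) => o.bind fun s => next φ m s (π s))^[t] (some s) = some s') :
    (s'.1 : ℕ) = s.1 + t := by
  induction t generalizing s' with
  | zero => cases h; rfl
  | succ t ih =>
    rw [Function.iterate_succ_apply'] at h
    obtain ⟨s₁, hs₁, hnext⟩ := Option.bind_eq_some_iff.1 h
    obtain ⟨c, -, hcounter, -⟩ := next_eq_some hnext
    rw [hcounter, ih hs₁, add_assoc]

theorem hammingDist_le_flipAt_add_one (w w₀ : Fin v → Bool) (i : Fin v) :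
    hammingDist w w₀ ≤ hammingDist (flipAt w i) w₀ + 1 := by
  have hflip : hammingDist w (flipAt w i) ≤ 1 := by
    refine (Finset.card_le_card (t := {i}) fun j hj => ?_).trans (Finset.card_singleton i).le
    by_contra hji
    rw [Finset.mem_singleton] at hji
    exact (Finset.mem_filter.1 hj).2 (Function.update_of_ne hji ..).symm
  have htriangle := hammingDist_triangle w (flipAt w i) w₀
  omega

theorem hammingDist_eq_flipAt_add_one {w w₀ : Fin v → Bool} {i : Fin v} (hi : w i ≠ w₀ i) :
    hammingDist w w₀ = hammingDist (flipAt w i) w₀ + 1 := by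
  have hback := hammingDist_le_flipAt_add_one w w₀ i
  have hflip : hammingDist (flipAt w i) w₀ < hammingDist w w₀ := by
    refine Finset.card_lt_card ((Finset.ssubset_iff_of_subset fun j hj => ?_).2 ⟨i, ?_, ?_⟩)
    · rcases eq_or_ne j i with rfl | hj'
      · simpa using hi
      · rw [Finset.mem_filter, flipAt, Function.update_of_ne hj'] at hj
        exact Finset.mem_filter.2 hj
    · simpa using hi
    · rw [Finset.mem_filter, flipAt, Function.update_self, not_and_not_right]
      exact fun _ => (Bool.eq_not.2 hi.symm).symm
  omega

end Next

section Value

variable {v m : ℕ} {φ : Formula v} (r : ℕ) (w₀ : Fin v → Bool)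

/-- The base of the power `value`. -/
noncomputable def base (w₀ : Fin v → Bool) (s : State m v) : ℝ :=
  (2 ^ m + v - (s.1 : ℕ) - hammingDist s.2 w₀) / (2 ^ m + v)

/-- The optimal value of a state, if `w₀` satisfies the formula. -/
noncomputable def value (r : ℕ) (w₀ : Fin v → Bool) (s : State m v) : ℝ := base w₀ s ^ r

theorem base_nonneg (s : State m v) : 0 ≤ base w₀ s := by
  have hcounter : ((s.1 : ℕ) : ℝ) ≤ 2 ^ m := by exact_mod_cast s.1.2.le
  have hdist : (hammingDist s.2 w₀ : ℝ) ≤ v := by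
    exact_mod_cast hammingDist_le_card_fintype.trans_eq (Fintype.card_fin v)
  exact div_nonneg (by linarith) (by positivity)

theorem base_le_one (s : State m v) : base w₀ s ≤ 1 := by
  exact div_le_one_of_le₀ (by linarith) (by positivity)

theorem value_nonneg (s : State m v) : 0 ≤ value r w₀ s := pow_nonneg (base_nonneg w₀ s) _

theorem value_le_one (s : State m v) : value r w₀ s ≤ 1 :=
  pow_le_one₀ (base_nonneg w₀ s) (base_le_one w₀ s)

theorem value_next_le {s s' : State m v} {a : Fin 3} (h : next φ m s a = some s') :
    value r w₀ s' ≤ value r w₀ s := by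
  obtain ⟨c, -, hcounter, hflip⟩ := next_eq_some h
  have hdist : (hammingDist s.2 w₀ : ℝ) ≤ hammingDist s'.2 w₀ + 1 := by
    exact_mod_cast hflip ▸ hammingDist_le_flipAt_add_one s.2 w₀ (c a).1
  refine pow_le_pow_left₀ (base_nonneg w₀ s') (div_le_div_of_nonneg_right ?_ (by positivity)) _
  push_cast [hcounter]
  linarith

theorem exists_value_next_eq (hw₀ : Satisfies w₀ φ) (s : State m v) :
    ∃ a, ∀ s', next φ m s a = some s' → value r w₀ s' = value r w₀ s := by
  rcases hc : firstUnsat φ s.2 with _ | c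
  · exact ⟨0, fun s' h => by simp [next, hc] at h⟩
  · obtain ⟨hcφ, hunsat⟩ := firstUnsat_eq_some hc
    obtain ⟨a, ha⟩ := hw₀ c hcφ
    refine ⟨a, fun s' h => ?_⟩
    obtain ⟨c', hc', hcounter, hflip⟩ := next_eq_some h
    obtain rfl : c = c' := Option.some.inj (hc.symm.trans hc')
    have hdist := hammingDist_eq_flipAt_add_one (w₀ := w₀) (ha ▸ hunsat a)
    rw [value, value, base, base, hcounter, hflip, hdist]
    push_cast
    ring

theorem value_le_of_counter_eq {s : State m v} (h : (s.1 : ℕ) + 1 = 2 ^ m) :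
    value r w₀ s ≤ ((1 + v) / 2 ^ m) ^ r := by
  have hcounter : ((s.1 : ℕ) : ℝ) + 1 = 2 ^ m := by exact_mod_cast h
  refine pow_le_pow_left₀ (base_nonneg w₀ s) ?_ _
  rw [base]
  gcongr <;> linarith

theorem le_value_of_counter_eq_zero {s : State m v} (h : (s.1 : ℕ) = 0) :
    1 - r * v / 2 ^ m ≤ value r w₀ s := by
  have hdist : (hammingDist s.2 w₀ : ℝ) ≤ v := by
    exact_mod_cast hammingDist_le_card_fintype.trans_eq (Fintype.card_fin v)
  have hbase : 1 - base w₀ s ≤ v / 2 ^ m := by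
    rw [base, h, one_sub_div (by positivity)]
    gcongr
    · push_cast
      linarith
    · simp
  calc (1 : ℝ) - r * v / 2 ^ m = 1 - r * (v / 2 ^ m) := by rw [mul_div_assoc]
    _ ≤ 1 - r * (1 - base w₀ s) := by gcongr
    _ = 1 + r * (base w₀ s - 1) := by ring
    _ ≤ (1 + (base w₀ s - 1)) ^ r := one_add_mul_le_pow (by linarith [base_nonneg w₀ s]) r
    _ = value r w₀ s := by rw [add_sub_cancel, value]

end Value

section Features

variable {v m : ℕ} (r d : ℕ) (w₀ : Fin v → Bool)

/-- The name of a state. -/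
def name (s : State m v) : List Bool := bitList m s.1 ++ List.ofFn s.2

/-- The features of a state: the `r`-th tensor power of its name, extended by a constant. -/
def feat (s : State m v) (i : Fin d) : ℚ :=
  if (tensorPow (· && ·) true (true :: name s) r).getD i false then 1 else 0

theorem name_injective : Function.Injective (name (m := m) (v := v)) := by
  rintro ⟨l, w⟩ ⟨l', w'⟩ h
  obtain ⟨hl, hw⟩ := List.append_inj h (by simp [length_bitList])
  exact Prod.ext (Fin.ext (bitList_injOn m l.2 l'.2 hl)) (List.ofFn_injective hw)

theorem drop_name (s : State m v) : (name s).drop m = List.ofFn s.2 :=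
  List.drop_left' (length_bitList m s.1)

theorem exists_name_eq {l : List Bool} (h : l.length = m + v) : ∃ s : State m v, name s = l := by
  have hlen : (l.take m).length = m := List.length_take_of_le (by omega)
  obtain ⟨k, hk, htake⟩ := exists_bitList_eq (l.take m)
  rw [hlen] at hk htake
  refine ⟨(⟨k, hk⟩, fun i => (l.drop m)[(i : ℕ)]'(by rw [List.length_drop]; omega)), ?_⟩
  rw [name, htake]
  conv_rhs => rw [← List.take_append_drop m l]
  congr 1
  exact List.ext_getElem (by simp; omega) fun i _ _ => by simp

theorem length_name (s : State m v) : (name s).length = m + v := by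
  simp [name, length_bitList]

/-- The coefficients of the affine form on the names of states whose value is `base`. -/
noncomputable def coeff (m : ℕ) (w₀ : Fin v → Bool) : List ℝ :=
  ((2 ^ m + v - ∑ i, if w₀ i then 1 else 0) / (2 ^ m + v)) ::
    (weights m (-1 / (2 ^ m + v) : ℝ) ++
      List.ofFn fun i => (if w₀ i then 1 else -1) / (2 ^ m + v : ℝ))

theorem length_coeff : (coeff m w₀).length = 1 + m + v := by
  simp only [coeff, List.length_cons, List.length_append, length_weights, List.length_ofFn]
  ring

theorem hammingDist_eq_sum (w : Fin v → Bool) : (hammingDist w w₀ : ℝ) =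
    (∑ i, if w₀ i then 1 else 0) - ∑ i, if w i then (if w₀ i then 1 else -1) else 0 := by
  rw [hammingDist, Finset.card_filter, ← Finset.sum_sub_distrib]
  push_cast
  refine Finset.sum_congr rfl fun i _ => ?_
  cases w i <;> cases w₀ i <;> simp

theorem dot_coeff (s : State m v) : dot (coeff m w₀) (true :: name s) = base w₀ s := by
  have hsum : (∑ i, if s.2 i then (if w₀ i then (1 : ℝ) else -1) / (2 ^ m + v) else 0) =
      (∑ i, if s.2 i then (if w₀ i then (1 : ℝ) else -1) else 0) / (2 ^ m + v) := by
    simp only [Finset.sum_div, ite_div, zero_div]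
  rw [coeff, dot, name, dot_append (by simp [length_weights, length_bitList]),
    dot_weights _ s.1.2, dot_ofFn, hsum, base, hammingDist_eq_sum, if_pos rfl]
  ring

theorem sum_coeff_mul_feat {r d : ℕ} (hd : (1 + m + v) ^ r ≤ d) (s : State m v) :
    ∑ i : Fin d, (tensorPow (· * ·) 1 (coeff m w₀) r).getD i 0 * (feat r d s i : ℝ) =
      value r w₀ s := by
  have hlen : (coeff m w₀).length = (true :: name s).length := by
    rw [length_coeff, List.length_cons, length_name]
    ring
  rw [value, ← dot_coeff, ← dot_tensorPow hlen,
    ← sum_getD_mul_eq_dot (d := d) (by rwa [length_tensorPow, length_coeff])]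
  simp only [feat, apply_ite (Rat.cast (K := ℝ)), Rat.cast_one, Rat.cast_zero]

end Features

section Mdp

variable {v : ℕ} (φ : Formula v) (m r d : ℕ) (w₀ : Fin v → Bool)

/-- The decision process of a formula `φ`, with the optimal value `value` if `w₀` satisfies `φ`. -/
noncomputable def mdp : FeaturedMDP 3 d where
  State := State m v
  start := (⟨0, by positivity⟩, fun _ => false)
  trans := next φ m
  reward s a :=
    if next φ m s a = none then bernoulliReward (ENNReal.ofReal (value r w₀ s)) else PMF.pure 0
  reward_mem s a x hx := by
    split_ifs at hx
    · rcases mem_support_bernoulliReward hx with rfl | rfl <;> simp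
    · simp_all
  horizon := 2 ^ m
  ends π s := by
    by_contra h
    obtain ⟨s', hs'⟩ := Option.ne_none_iff_exists'.1 h
    have := iterate_next hs'
    have := s'.1.2
    omega
  featS := feat r d
  featSA s a := (next φ m s a).elim (feat r d s) (feat r d)
  code := name
  code_injective := name_injective

variable {φ m r d w₀}

theorem reward_of_next_eq_none {s : State m v} {a : Fin 3} (h : next φ m s a = none) :
    (mdp φ m r d w₀).reward s a = bernoulliReward (ENNReal.ofReal (value r w₀ s)) := if_pos h

theorem reward_of_next_ne_none {s : State m v} {a : Fin 3} (h : next φ m s a ≠ none) :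
    (mdp φ m r d w₀).reward s a = PMF.pure 0 := if_neg h

theorem isFinalReward (hw₀ : Satisfies w₀ φ) :
    (mdp φ m r d w₀).IsFinalReward (value r w₀) where
  expect_reward {s a} h := by
    rw [reward_of_next_eq_none h]
    exact expect_bernoulliReward (value_nonneg ..) (value_le_one ..)
  reward_eq h := reward_of_next_ne_none (Option.ne_none_iff_exists'.2 ⟨_, h⟩)
  le h := value_next_le r w₀ h
  exists_eq := exists_value_next_eq r w₀ hw₀

theorem isLinear (hd : (1 + m + v) ^ r ≤ d) (hw₀ : Satisfies w₀ φ) :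
    (mdp φ m r d w₀).IsLinear := by
  have hfeat := sum_coeff_mul_feat w₀ hd
  refine ⟨fun i => (tensorPow (· * ·) 1 (coeff m w₀) r).getD i 0, fun s => ?_, fun s a => ?_⟩
  · exact ((isFinalReward hw₀).Vstar_eq s).trans (hfeat s).symm
  · refine ((isFinalReward hw₀).Qstar_eq s a).trans ?_
    change (next φ m s a).elim _ _ =
      ∑ i, _ * (((next φ m s a).elim (feat r d s) (feat r d) i : ℚ) : ℝ)
    cases next φ m s a with
    | none => exact (hfeat s).symm
    | some s' => exact (hfeat s').symm

theorem sizeBound {B : ℕ} (hB : 2 ≤ B) (hmv : m + v ≤ B) : (mdp φ m r d w₀).SizeBound B := by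
  have h0 : bitSize 0 ≤ B := le_trans (by simp [bitSize]) hB
  have h1 : bitSize 1 ≤ B := le_trans (by simp [bitSize]) hB
  have hfeat (s : State m v) (i : Fin d) : bitSize (feat r d s i) ≤ B := by
    rw [feat]
    split_ifs <;> assumption
  refine ⟨fun s => (length_name s).trans_le hmv, fun s a x hx => ?_, hfeat, fun s a i => ?_⟩
  · by_cases h : next φ m s a = none
    · rw [reward_of_next_eq_none h] at hx
      rcases mem_support_bernoulliReward hx with rfl | rfl <;> assumption
    · rw [reward_of_next_ne_none h, PMF.mem_support_pure_iff] at hx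
      rwa [hx]
  · change bitSize ((next φ m s a).elim (feat r d s) (feat r d) i) ≤ B
    cases next φ m s a <;> exact hfeat _ _

end Mdp

end Game

/-! ### Terms on bit strings -/

namespace Data

theorem fold_ofList (g : Data → Data → Data) (l : List Data) (acc : Data) :
    fold g (ofList l) acc = l.foldl (fun a x => g x a) acc := by
  induction l generalizing acc <;> simp_all [ofList, fold]

theorem fold_ofBits (g : Data → Data → Data) (l : List Bool) (acc : Data) :
    fold g (ofBits l) acc = l.foldl (fun a x => g (ofBool x) a) acc := by
  rw [ofBits, fold_ofList, List.foldl_map]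

theorem fold_unary (g : Data → Data → Data) (n : ℕ) (acc : Data) :
    fold g (unary n) acc = (g nil)^[n] acc := by
  induction n generalizing acc with
  | zero => rfl
  | succ _ ih => exact ih _

theorem fold_add_length {g : Data → Data → Data} (μ : Data → ℕ)
    (h : ∀ x acc, μ (g x acc) = μ acc + 1) (l acc : Data) :
    μ (fold g l acc) = μ acc + l.length := by
  induction l generalizing acc with
  | nil => rfl
  | cons x xs _ ih =>
    simp only [fold, length, ih, h]
    omega

theorem length_ofList (l : List Data) : (ofList l).length = l.length := by
  induction l <;> simp_all [ofList, length]

theorem length_ofBits (l : List Bool) : (ofBits l).length = l.length := by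
  simp [ofBits, length_ofList]

theorem length_unary (n : ℕ) : (unary n).length = n := by simp [unary, length_ofList]

theorem FoldAll.of_forall {g : Data → Data → Data} {P : Data → Data → Prop}
    (h : ∀ x acc, P x acc) (l acc : Data) : FoldAll g P l acc := by
  induction l generalizing acc with
  | nil => trivial
  | cons x xs _ ih => exact ⟨h _ _, ih _⟩

theorem FoldAll.ofList {g : Data → Data → Data} {P : Data → Data → Prop} {l : List Data}
    (h : ∀ x ∈ l, ∀ acc, P x acc) (acc : Data) : FoldAll g P (ofList l) acc := by
  induction l generalizing acc with
  | nil => trivial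
  | cons x xs ih => exact ⟨h x (by simp) _, ih (fun y hy => h y (by simp [hy])) _⟩

theorem FoldAll.unary {g : Data → Data → Data} {P : Data → Data → Prop} {n : ℕ} {acc : Data}
    (h : ∀ i < n, P nil ((g nil)^[i] acc)) : FoldAll g P (unary n) acc := by
  induction n generalizing acc with
  | zero => trivial
  | succ n ih => exact ⟨h 0 (by omega), ih fun i hi => h (i + 1) (by omega)⟩

theorem hd_cons (a b : Data) : (cons a b).hd = a := rfl

theorem tl_cons (a b : Data) : (cons a b).tl = b := rfl

theorem ofBits_cons (b : Bool) (l : List Bool) : ofBits (b :: l) = cons (ofBool b) (ofBits l) := rfl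

theorem ofBits_nil : ofBits [] = nil := rfl

theorem ofBool_eq_nil (b : Bool) : ofBool b = nil ↔ b = false := by cases b <;> simp [ofBool]

theorem unary_eq_ofBits (n : ℕ) : unary n = ofBits (List.replicate n false) := by
  simp [unary, ofBits, ofBool]

theorem iterate_tl_ofBits (n : ℕ) (l : List Bool) : tl^[n] (ofBits l) = ofBits (l.drop n) := by
  induction n generalizing l with
  | zero => rfl
  | succ n ih =>
    have htail : tl (ofBits l) = ofBits l.tail := by cases l <;> rfl
    rw [Function.iterate_succ_apply, htail, ih, List.drop_tail]

theorem hd_ofBits (l : List Bool) : (ofBits l).hd = ofBool (l.headD false) := by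
  cases l <;> rfl

end Data

namespace Term

open Data

/-- The environment without its first `n` variables. -/
def envTail : ℕ → Expr
  | 0 => .var 0
  | n + 1 => .tl (envTail n)

/-- The variable of the environment with index `n`, the innermost one having index `0`. -/
def V (n : ℕ) : Expr := .hd (envTail n)

/-- The bit `true`. -/
def trueExpr : Expr := .cons .nil .nil

section Apply

variable (a b : Expr) (n : ℕ) (x y : Data)

theorem apply_V_zero : (V 0).apply (.cons x y) = x := rfl

theorem apply_V_succ : (V (n + 1)).apply (.cons x y) = (V n).apply y := by
  have htail : ∀ n, (envTail (n + 1)).apply (.cons x y) = (envTail n).apply y := fun n => by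
    induction n with
    | zero => rfl
    | succ n ih => exact congrArg Data.tl ih
  exact congrArg Data.hd (htail n)

theorem apply_var : (Expr.var n).apply x = x := rfl

theorem apply_nil : Expr.nil.apply x = .nil := rfl

theorem apply_cons : (Expr.cons a b).apply x = .cons (a.apply x) (b.apply x) := rfl

theorem apply_hd : (Expr.hd a).apply x = (a.apply x).hd := rfl

theorem apply_tl : (Expr.tl a).apply x = (a.apply x).tl := rfl

theorem apply_trueExpr : trueExpr.apply x = ofBool true := rfl

end Apply

theorem eval_ite (c f g : Term) (x : Data) [Decidable (c.eval x = .nil)] :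
    (ite c f g).eval x = if c.eval x = .nil then g.eval x else f.eval x := by
  by_cases h : c.eval x = .nil
  · simp [eval, h]
  · rw [if_neg h, eval]
    cases hc : c.eval x with
    | nil => exact absurd hc h
    | cons _ _ => rfl

section Bounded

variable (L : ℕ) (c f g : Term) (e : Expr) (x : Data)

theorem bounded_expr : (expr e).Bounded L x ↔ True := Iff.rfl

theorem bounded_comp : (comp f g).Bounded L x ↔ f.Bounded L x ∧ g.Bounded L (f.eval x) := Iff.rfl

theorem bounded_letIn :
    (letIn f g).Bounded L x ↔ f.Bounded L x ∧ g.Bounded L (.cons (f.eval x) x) := Iff.rfl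

theorem bounded_ite : (ite c f g).Bounded L x ↔
    c.Bounded L x ∧ (c.eval x = .nil → g.Bounded L x) ∧ (c.eval x ≠ .nil → f.Bounded L x) := by
  cases h : c.eval x <;> simp [Bounded, h]

end Bounded

variable {L : ℕ}

/-- Rest of a list after its first elements; the number of these is given in unary. -/
def dropTerm : Term := fold (expr (V 0)) (expr (V 1)) (expr (.tl (V 1)))

theorem eval_dropTerm (n : ℕ) (l z : Data) :
    dropTerm.eval (.cons (unary n) (.cons l z)) = Data.tl^[n] l := by
  simp only [dropTerm, eval, fold_unary, apply_V_zero, apply_V_succ, apply_tl]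

theorem bounded_dropTerm {a l z : Data} (h : a.length ≤ L) :
    dropTerm.Bounded L (.cons a (.cons l z)) :=
  ⟨trivial, trivial, h, .of_forall (fun _ _ => trivial) _ _⟩

/-- Concatenation of the reversal of a list with another list. -/
def revAppTerm : Term := fold (expr (V 0)) (expr (V 1)) (expr (.cons (V 0) (V 1)))

theorem eval_revAppTerm (l l' : List Data) (z : Data) :
    revAppTerm.eval (.cons (ofList l) (.cons (ofList l') z)) = ofList (l.reverse ++ l') := by
  simp only [revAppTerm, eval, fold_ofList, apply_V_zero, apply_V_succ, apply_cons]
  induction l generalizing l' with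
  | nil => rfl
  | cons x l ih => simpa [ofList] using ih (x :: l')

theorem eval_revAppTerm_ofBits (l l' : List Bool) (z : Data) :
    revAppTerm.eval (.cons (ofBits l) (.cons (ofBits l') z)) = ofBits (l.reverse ++ l') := by
  simp [ofBits, eval_revAppTerm]

theorem eval_revAppTerm_unary (m n : ℕ) (z : Data) :
    revAppTerm.eval (.cons (unary m) (.cons (unary n) z)) = unary (m + n) := by
  simp [unary_eq_ofBits, eval_revAppTerm_ofBits]

theorem bounded_revAppTerm {a l z : Data} (h : a.length ≤ L) :
    revAppTerm.Bounded L (.cons a (.cons l z)) :=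
  ⟨trivial, trivial, h, .of_forall (fun _ _ => trivial) _ _⟩

/-! ### Terms on counters and tensors -/

/-- Loop body of `lastTerm`: the accumulator consists of the rest of the list and the conjunction
of the bits before. -/
def lastStep : Term :=
  ite (expr (.hd (.hd (V 1)))) (expr (.cons (.tl (.hd (V 1))) (.tl (V 1))))
    (expr (.cons (.tl (.hd (V 1))) .nil))

/-- Test whether the first bits of a list, whose number is given in unary, are all `true`. -/
def lastTerm : Term :=
  comp (fold (expr (V 0)) (expr (.cons (V 1) trueExpr)) lastStep) (expr (.tl (.var 0)))

theorem eval_lastStep (x z : Data) (l : List Bool) (b c : Bool) :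
    lastStep.eval (.cons x (.cons (.cons (ofBits (b :: l)) (ofBool c)) z)) =
      .cons (ofBits l) (ofBool (b && c)) := by
  cases b <;> rfl

theorem eval_lastTerm {m k : ℕ} (hk : k < 2 ^ m) (rest : List Bool) (z : Data) :
    lastTerm.eval (.cons (unary m) (.cons (ofBits (bitList m k ++ rest)) z)) =
      ofBool (decide (k + 1 = 2 ^ m)) := by
  simp only [lastTerm, eval, fold_unary, apply_V_zero, apply_V_succ, apply_cons, apply_tl,
    apply_var, apply_trueExpr]
  set env := Data.cons (unary m) (.cons (ofBits (bitList m k ++ rest)) z)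
  suffices ∀ (m k : ℕ) (b : Bool), k < 2 ^ m →
      (fun acc => lastStep.eval (.cons .nil (.cons acc env)))^[m]
          (.cons (ofBits (bitList m k ++ rest)) (ofBool b)) =
        .cons (ofBits rest) (ofBool (b && decide (k + 1 = 2 ^ m))) by
    rw [this m k true hk, Bool.true_and, Data.tl]
  intro m
  induction m with
  | zero => rintro k b hk; simp_all [bitList]
  | succ m ih =>
    intro k b hk
    rw [Function.iterate_succ_apply, bitList, List.cons_append, eval_lastStep, ih _ _ (by omega)]
    have hlast : k + 1 = 2 ^ (m + 1) ↔ k % 2 = 1 ∧ k / 2 + 1 = 2 ^ m := by omega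
    rw [decide_eq_decide.2 hlast, Bool.decide_and, Bool.and_left_comm, Bool.and_assoc]

theorem bounded_lastTerm {a l z : Data} (h : a.length ≤ L) :
    lastTerm.Bounded L (.cons a (.cons l z)) :=
  ⟨⟨trivial, trivial, h, .of_forall (fun _ _ => by simp [lastStep, bounded_ite, bounded_expr]) _ _⟩,
    trivial⟩

/-- Loop body of `flipTerm`: move an element from the rest of the list to the reversed beginning. -/
def shiftStep : Term := expr (.cons (.cons (.hd (.tl (V 1))) (.hd (V 1))) (.tl (.tl (V 1))))

/-- Negate the bit of a list at the position given in unary. -/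
def flipTerm : Term :=
  letIn (fold (expr (V 0)) (expr (.cons .nil (V 1))) shiftStep) <|
    comp (ite (expr (.hd (.tl (V 0))))
      (expr (.cons (.hd (V 0)) (.cons (.cons .nil (.tl (.tl (V 0)))) .nil)))
      (expr (.cons (.hd (V 0)) (.cons (.cons trueExpr (.tl (.tl (V 0)))) .nil)))) revAppTerm

theorem iterate_shiftStep (l pre rest : List Bool) (env : Data) :
    (fun acc => shiftStep.eval (.cons .nil (.cons acc env)))^[l.length]
      (.cons (ofBits pre) (ofBits (l ++ rest))) =
        .cons (ofBits (l.reverse ++ pre)) (ofBits rest) := by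
  induction l generalizing pre with
  | nil => rfl
  | cons b l ih => exact (ih (b :: pre)).trans (by simp)

theorem eval_flipTerm {i : ℕ} {l : List Bool} (hi : i < l.length) (z : Data) :
    flipTerm.eval (.cons (unary i) (.cons (ofBits l) z)) = ofBits (l.modify i not) := by
  have hlen : (l.take i).length = i := List.length_take_of_le hi.le
  have hsplit : l = l.take i ++ l[i] :: l.drop (i + 1) := by
    rw [← List.drop_eq_getElem_cons hi, List.take_append_drop]
  have hloop := iterate_shiftStep (l.take i) [] (l[i] :: l.drop (i + 1))
    (.cons (unary i) (.cons (ofBits l) z))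
  rw [hlen, ← hsplit, ofBits_nil] at hloop
  simp only [flipTerm, eval, fold_unary, apply_V_zero, apply_V_succ, apply_cons, apply_nil, hloop]
  rw [List.modify_eq_take_cons_drop hi, List.append_nil]
  have hrev := eval_revAppTerm_ofBits (l.take i).reverse ((!l[i]) :: l.drop (i + 1)) .nil
  rw [List.reverse_reverse] at hrev
  rw [← hrev]
  cases l[i] <;> rfl

theorem bounded_flipTerm {a l z : Data} (h : a.length ≤ L) :
    flipTerm.Bounded L (.cons a (.cons l z)) := by
  refine ⟨⟨trivial, trivial, h, .of_forall (fun _ _ => trivial) _ _⟩,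
    by simp [bounded_ite, bounded_expr], ?_⟩
  set acc := (fold (expr (V 0)) (expr (.cons .nil (V 1))) shiftStep).eval (.cons a (.cons l z))
  have hacc : acc.hd.length = a.length :=
    (fold_add_length (fun acc => acc.hd.length) (fun _ _ => rfl) _ _).trans (Nat.zero_add _)
  classical
  rw [eval_ite]
  split_ifs <;> exact bounded_revAppTerm (hacc.trans_le h)

/-- Loop body of `incTerm`: the accumulator consists of the carry and the reversal of the sum. -/
def incStep : Term :=
  ite (expr (.hd (V 1)))
    (ite (expr (V 0)) (expr (.cons trueExpr (.cons .nil (.tl (V 1)))))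
      (expr (.cons .nil (.cons trueExpr (.tl (V 1))))))
    (expr (.cons .nil (.cons (V 0) (.tl (V 1)))))

/-- Add one to a binary number. -/
def incTerm : Term :=
  comp (comp (fold (expr (V 0)) (expr (.cons trueExpr .nil)) incStep)
    (expr (.cons (.tl (.var 0)) (.cons .nil .nil)))) revAppTerm

theorem eval_incStep (b c : Bool) (out : List Bool) (env : Data) :
    incStep.eval (.cons (ofBool b) (.cons (.cons (ofBool c) (ofBits out)) env)) =
      .cons (ofBool (b && c)) (ofBits ((b ^^ c) :: out)) := by
  cases b <;> cases c <;> rfl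

theorem foldl_incStep_false (l out : List Bool) (env : Data) :
    l.foldl (fun acc b => incStep.eval (.cons (ofBool b) (.cons acc env)))
        (.cons (ofBool false) (ofBits out)) =
      .cons (ofBool false) (ofBits (l.reverse ++ out)) := by
  induction l generalizing out with
  | nil => rfl
  | cons b l ih => simp [eval_incStep, ih]

theorem foldl_incStep_true {m k : ℕ} (hk : k + 1 < 2 ^ m) (out : List Bool) (env : Data) :
    (bitList m k).foldl (fun acc b => incStep.eval (.cons (ofBool b) (.cons acc env)))
        (.cons (ofBool true) (ofBits out)) =
      .cons (ofBool false) (ofBits ((bitList m (k + 1)).reverse ++ out)) := by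
  induction m generalizing k out with
  | zero => simp at hk
  | succ m ih =>
    rw [bitList, bitList, List.foldl_cons, eval_incStep]
    rcases Nat.mod_two_eq_zero_or_one k with hparity | hparity
    · have hlow : (k + 1) % 2 = 1 := by omega
      have hhigh : (k + 1) / 2 = k / 2 := by omega
      simp [hparity, hlow, hhigh, foldl_incStep_false]
    · have hlow : (k + 1) % 2 = 0 := by omega
      have hhigh : (k + 1) / 2 = k / 2 + 1 := by omega
      simp [hparity, hlow, hhigh, ih (show k / 2 + 1 < 2 ^ m by omega)]

theorem eval_incTerm {m k : ℕ} (hk : k + 1 < 2 ^ m) (rest : List Bool) (z : Data) :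
    incTerm.eval (.cons (ofBits (bitList m k ++ rest)) z) =
      ofBits (bitList m (k + 1) ++ rest) := by
  have hloop := foldl_incStep_true hk [] (.cons (ofBits (bitList m k ++ rest)) z)
  rw [ofBits_nil] at hloop
  simp only [incTerm, eval, fold_ofBits, apply_V_zero, apply_cons, apply_nil, apply_tl, apply_var,
    apply_trueExpr, List.foldl_append, hloop, foldl_incStep_false, tl_cons]
  rw [← ofBits_nil, eval_revAppTerm_ofBits]
  simp

theorem bounded_incTerm {a z : Data} (h : a.length ≤ L) : incTerm.Bounded L (.cons a z) := by
  refine ⟨⟨⟨trivial, trivial, h, .of_forall (fun _ _ => by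
    simp [incStep, bounded_ite, bounded_expr]) _ _⟩, trivial⟩, ?_⟩
  refine bounded_revAppTerm (le_of_eq_of_le ?_ h)
  refine (fold_add_length (fun acc => acc.tl.length) (fun x acc => ?_) a _).trans (Nat.zero_add _)
  classical
  simp only [incStep, eval_ite]
  split_ifs <;> rfl

/-- Loop body of `tensorPowTerm`: the outer list is a vector, the accumulator another one. -/
def tensorTerm : Term :=
  fold (expr (V 2)) (expr .nil) <| fold (expr (V 3)) (expr (V 1)) <|
    ite (expr (V 2)) (expr (.cons (V 0) (V 1))) (expr (.cons .nil (V 1)))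

/-- Tensor power of a vector of bits, from the vector and the exponent in unary. -/
def tensorPowTerm : Term := fold (expr (V 1)) (expr (.cons trueExpr .nil)) tensorTerm

theorem foldl_cons_ofBool {α : Type*} (l : List α) (f : α → Bool) (acc : List Bool) :
    l.foldl (fun a x => Data.cons (ofBool (f x)) a) (ofBits acc) =
      ofBits (l.foldl (fun a x => f x :: a) acc) := by
  induction l generalizing acc with
  | nil => rfl
  | cons x _ ih => exact ih (f x :: acc)

theorem eval_tensorTerm (u w : List Bool) (x z : Data) :
    tensorTerm.eval (.cons x (.cons (ofBits w) (.cons (ofBits u) z))) =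
      ofBits (tensor (· && ·) u w) := by
  simp only [tensorTerm, eval, fold_ofBits, apply_V_zero, apply_V_succ, apply_cons, apply_nil]
  suffices ∀ acc : List Bool, u.foldl (fun acc b => w.foldl (fun acc c =>
      match ofBool b with
      | .nil => Data.cons .nil acc
      | .cons _ _ => .cons (ofBool c) acc) acc) (ofBits acc) =
        ofBits (u.foldl (fun acc b => w.foldl (fun acc c => (b && c) :: acc) acc) acc) from this []
  induction u with
  | nil => exact fun acc => rfl
  | cons b u ih =>
    intro acc
    rw [List.foldl_cons, List.foldl_cons, ← ih, ← foldl_cons_ofBool]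
    cases b <;> rfl

theorem eval_tensorPowTerm (u : List Bool) (r : ℕ) (z : Data) :
    tensorPowTerm.eval (.cons (ofBits u) (.cons (unary r) z)) =
      ofBits (tensorPow (· && ·) true u r) := by
  simp only [tensorPowTerm, eval, fold_unary, apply_V_zero, apply_V_succ, apply_cons, apply_nil,
    apply_trueExpr]
  induction r with
  | zero => rfl
  | succ r ih =>
    rw [Function.iterate_succ_apply', tensorPow_succ, ← eval_tensorTerm]
    exact congrArg _ (congrArg _ (congrArg₂ _ ih rfl))

end Term

namespace Term

open Data

variable {L : ℕ}

theorem bounded_tensorPowTerm {u : List Bool} {r : ℕ} {z : Data} (hu : u ≠ []) (hr : r ≤ L)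
    (hlen : u.length ≤ L) (hpow : u.length ^ r ≤ L) :
    tensorPowTerm.Bounded L (.cons (ofBits u) (.cons (unary r) z)) := by
  refine ⟨trivial, trivial, (length_unary r).trans_le hr, FoldAll.unary fun i hi => ?_⟩
  have hvec := eval_tensorPowTerm u i z
  simp only [tensorPowTerm, eval, fold_unary, apply_V_zero, apply_V_succ] at hvec
  refine ⟨trivial, trivial, (length_ofBits u).trans_le hlen, .of_forall (fun x acc =>
    ⟨trivial, trivial, ?_, .of_forall (fun _ _ => by simp [bounded_ite, bounded_expr]) _ _⟩) _ _⟩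
  refine (congrArg Data.length hvec).trans_le ?_
  rw [length_ofBits, length_tensorPow]
  exact (Nat.pow_le_pow_right (List.length_pos_iff.2 hu) hi.le).trans hpow

/-! ### Terms on formulas -/

/-- Test whether a literal is true under an assignment. -/
def litTerm : Term :=
  letIn (comp (expr (.cons (.tl (V 1)) (.cons (V 0) .nil))) dropTerm)
    (ite (expr (.hd (V 0))) (ite (expr (.hd (V 2))) (expr trueExpr) (expr .nil))
      (ite (expr (.hd (V 2))) (expr .nil) (expr trueExpr)))

theorem hd_iterate_tl_ofBits_ofFn {v : ℕ} (w : Fin v → Bool) (i : Fin v) :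
    (Data.tl^[(i : ℕ)] (ofBits (List.ofFn w))).hd = ofBool (w i) := by
  rw [iterate_tl_ofBits, hd_ofBits, List.headD_eq_head?_getD, List.head?_drop]
  simp

theorem eval_litTerm {v : ℕ} (w : Fin v → Bool) (l : Literal v) (z : Data) :
    litTerm.eval (.cons (ofBits (List.ofFn w)) (.cons (literalData l) z)) =
      ofBool (decide (w l.1 = l.2)) := by
  simp only [litTerm, eval, literalData, apply_V_zero, apply_V_succ, apply_cons, apply_tl,
    apply_hd, apply_nil, apply_trueExpr, hd_cons, tl_cons, eval_dropTerm,
    hd_iterate_tl_ofBits_ofFn]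
  cases w l.1 <;> cases l.2 <;> rfl

theorem bounded_litTerm {v : ℕ} (l : Literal v) (hv : v ≤ L) (w z : Data) :
    litTerm.Bounded L (.cons w (.cons (literalData l) z)) := by
  simp only [litTerm, bounded_ite, bounded_expr, bounded_comp, bounded_letIn, implies_true,
    and_true, true_and]
  exact bounded_dropTerm ((length_unary l.1).trans_le (l.1.2.le.trans hv))

/-- Encoding of a clause as the list of its literals. -/
def clauseData {v : ℕ} (c : Clause v) : Data := ofList (List.ofFn fun i => literalData (c i))

theorem clauseData_eq {v : ℕ} (c : Clause v) : clauseData c = .cons (literalData (c 0))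
    (.cons (literalData (c 1)) (.cons (literalData (c 2)) .nil)) := by
  simp [clauseData, List.ofFn_succ, ofList]

/-- Test whether a clause is true under an assignment. -/
def clauseTerm : Term :=
  fold (expr (V 1)) (expr .nil) <|
    ite (expr (V 1)) (expr trueExpr) (comp (expr (.cons (V 2) (.cons (V 0) .nil))) litTerm)

theorem eval_clauseTerm {v : ℕ} (w : Fin v → Bool) (c : Clause v) (z : Data) :
    clauseTerm.eval (.cons (ofBits (List.ofFn w)) (.cons (clauseData c) z)) =
      ofBool (!decide (∀ i, w (c i).1 ≠ (c i).2)) := by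
  simp only [clauseTerm, eval, clauseData_eq, Data.fold, apply_V_zero, apply_V_succ, apply_cons,
    apply_nil, eval_litTerm, apply_trueExpr]
  by_cases h0 : w (c 0).1 = (c 0).2 <;> by_cases h1 : w (c 1).1 = (c 1).2 <;>
    by_cases h2 : w (c 2).1 = (c 2).2 <;> simp [h0, h1, h2, ofBool, Fin.forall_fin_succ]

theorem bounded_clauseTerm {v : ℕ} (c : Clause v) (h3 : 3 ≤ L) (hv : v ≤ L) (w z : Data) :
    clauseTerm.Bounded L (.cons w (.cons (clauseData c) z)) := by
  refine ⟨trivial, trivial, ?_, FoldAll.ofList (fun x hx acc => ?_) _⟩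
  · exact (length_ofList _).trans_le (by rwa [List.length_ofFn])
  · obtain ⟨i, rfl⟩ := (List.mem_ofFn' _ _).1 hx
    simp only [bounded_ite, bounded_expr, bounded_comp, implies_true, and_true, true_and]
    exact fun _ => bounded_litTerm (c i) hv _ _

/-- Encoding of a formula as the list of its clauses. -/
def clausesData {v : ℕ} (φ : Formula v) : Data := ofList (φ.map clauseData)

/-- Loop body of `unsatTerm`: the accumulator is the first violated clause found so far. -/
def unsatStep : Term :=
  ite (expr (V 1)) (expr (V 1))
    (ite (comp (expr (.cons (V 2) (.cons (V 0) .nil))) clauseTerm) (expr .nil) (expr (V 0)))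

/-- The first clause of a formula that is violated by an assignment, or `nil`. -/
def unsatTerm : Term := fold (expr (V 1)) (expr .nil) unsatStep

theorem eval_unsatStep_nil {v : ℕ} (w : Fin v → Bool) (c : Clause v) (z : Data) :
    unsatStep.eval (.cons (clauseData c) (.cons .nil (.cons (ofBits (List.ofFn w)) z))) =
      if ∀ i, w (c i).1 ≠ (c i).2 then clauseData c else .nil := by
  simp only [unsatStep, eval, apply_V_zero, apply_V_succ, apply_cons, apply_nil, eval_clauseTerm]
  by_cases h : ∀ i, w (c i).1 ≠ (c i).2
  · simp only [if_pos h, decide_eq_true h]; rfl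
  · simp only [if_neg h, decide_eq_false h]; rfl

theorem eval_unsatTerm {v : ℕ} (w : Fin v → Bool) (φ : Formula v) (z : Data) :
    unsatTerm.eval (.cons (ofBits (List.ofFn w)) (.cons (clausesData φ) z)) =
      (Game.firstUnsat φ w).elim .nil clauseData := by
  simp only [unsatTerm, eval, clausesData, fold_ofList, apply_V_zero, apply_V_succ, apply_nil,
    List.foldl_map]
  generalize hz : Data.cons (ofList (φ.map clauseData)) z = z'
  clear hz
  have stays : ∀ (φ : Formula v) (a b : Data), List.foldl (fun acc (c : Clause v) =>
      unsatStep.eval (.cons (clauseData c) (.cons acc (.cons (ofBits (List.ofFn w)) z'))))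
        (.cons a b) φ = .cons a b := fun φ a b => by
    induction φ with
    | nil => rfl
    | cons _ _ ih => exact ih
  induction φ with
  | nil => rfl
  | cons c φ ih =>
    rw [List.foldl_cons, eval_unsatStep_nil, Game.firstUnsat, List.find?_cons]
    by_cases h : ∀ i, w (c i).1 ≠ (c i).2
    · rw [if_pos h, decide_eq_true h, clauseData_eq, stays, Option.elim, clauseData_eq]
    · rw [if_neg h, decide_eq_false h]
      exact ih

theorem bounded_unsatTerm {v : ℕ} (φ : Formula v) (h3 : 3 ≤ L) (hv : v ≤ L) (hφ : φ.length ≤ L)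
    (w z : Data) : unsatTerm.Bounded L (.cons w (.cons (clausesData φ) z)) := by
  refine ⟨trivial, trivial, ?_, FoldAll.ofList (fun x hx acc => ?_) _⟩
  · exact (length_ofList _).trans_le (by rwa [List.length_map])
  · obtain ⟨c, -, rfl⟩ := List.mem_map.1 hx
    simp only [unsatStep, bounded_ite, bounded_expr, bounded_comp, implies_true, and_true,
      true_and]
    exact fun _ => bounded_clauseTerm c h3 hv _ _

/-! ### Terms on the states of the game -/

/-- The state after flipping the variable of a literal, from the literal, the state and, as the
fifth variable, the length of the counter in unary. -/
def moveTerm : Term :=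
  letIn (comp (expr (.cons (.tl (V 0)) (.cons (V 4) .nil))) revAppTerm) <|
  letIn (comp (expr (.cons (V 0) (.cons (V 2) .nil))) flipTerm) <|
  comp (expr (.cons (V 0) .nil)) incTerm

/-- The next state of the game, from the state, the violated clause, the action in unary, and the
length of the counter in unary. -/
def nextTerm : Term :=
  letIn (ite (expr (V 2))
    (ite (expr (.tl (V 2))) (expr (.hd (.tl (.tl (V 1))))) (expr (.hd (.tl (V 1)))))
    (expr (.hd (V 1)))) moveTerm

/-- The action that a tree stands for in `nextTerm`. -/
def action : Data → Fin 3
  | .nil => 0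
  | .cons _ .nil => 1
  | .cons _ (.cons _ _) => 2

theorem action_unary (a : Fin 3) : action (unary a) = a := by
  fin_cases a <;> rfl

theorem ofFn_flipAt {v : ℕ} (w : Fin v → Bool) (i : Fin v) :
    List.ofFn (Game.flipAt w i) = (List.ofFn w).modify i not := by
  refine List.ext_getElem (by simp) fun j hj _ => ?_
  rw [List.length_ofFn] at hj
  rw [List.getElem_modify, List.getElem_ofFn, List.getElem_ofFn]
  unfold Game.flipAt
  obtain rfl | hij := eq_or_ne i ⟨j, hj⟩
  · simp
  · rw [Function.update_of_ne hij.symm, if_neg fun h => hij (Fin.ext h)]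

theorem modify_name {m v : ℕ} (s : Game.State m v) (i : Fin v) :
    (Game.name s).modify (i + m) not = bitList m s.1 ++ List.ofFn (Game.flipAt s.2 i) := by
  rw [Game.name, ofFn_flipAt]
  refine List.ext_getElem (by simp) fun j _ _ => ?_
  simp only [List.getElem_modify, List.getElem_append, length_bitList]
  split_ifs <;> first | rfl | omega

variable {m v : ℕ} {s : Game.State m v}

theorem eval_moveTerm (hs : (s.1 : ℕ) + 1 < 2 ^ m) (l : Literal v) (x y z : Data) :
    moveTerm.eval (.cons (literalData l) (.cons (ofBits (Game.name s))
        (.cons x (.cons y (.cons (unary m) z))))) =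
      ofBits (Game.name (⟨(s.1 : ℕ) + 1, hs⟩, Game.flipAt s.2 l.1)) := by
  have hindex : (l.1 : ℕ) + m < (Game.name s).length := by rw [Game.length_name]; omega
  simp only [moveTerm, eval, literalData, apply_V_zero, apply_V_succ, apply_cons, apply_nil,
    apply_tl, tl_cons, eval_revAppTerm_unary, eval_flipTerm hindex, modify_name]
  rw [eval_incTerm hs]
  rfl

theorem bounded_moveTerm (l : Literal v) (hL : m + v ≤ L) (x y z : Data) :
    moveTerm.Bounded L (.cons (literalData l) (.cons (ofBits (Game.name s))
      (.cons x (.cons y (.cons (unary m) z))))) := by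
  have hindex : (l.1 : ℕ) + m < (Game.name s).length := by rw [Game.length_name]; omega
  simp only [moveTerm, bounded_expr, bounded_comp, bounded_letIn, eval, literalData, apply_V_zero,
    apply_V_succ, apply_cons, apply_nil, apply_tl, tl_cons, true_and, eval_revAppTerm_unary,
    eval_flipTerm hindex]
  exact ⟨bounded_revAppTerm (by rw [length_unary]; omega),
    bounded_flipTerm (by rw [length_unary]; omega),
    bounded_incTerm (by rwa [length_ofBits, List.length_modify, Game.length_name])⟩

theorem eval_nextTerm (hs : (s.1 : ℕ) + 1 < 2 ^ m) (c : Clause v) (a z : Data) :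
    nextTerm.eval (.cons (ofBits (Game.name s))
        (.cons (clauseData c) (.cons a (.cons (unary m) z)))) =
      ofBits (Game.name (⟨(s.1 : ℕ) + 1, hs⟩, Game.flipAt s.2 (c (action a)).1)) := by
  rw [clauseData_eq]
  rcases a with _ | ⟨_, _ | ⟨_, _⟩⟩ <;> exact eval_moveTerm hs _ _ _ _

theorem bounded_nextTerm (c : Clause v) (hL : m + v ≤ L) (a z : Data) :
    nextTerm.Bounded L (.cons (ofBits (Game.name s))
      (.cons (clauseData c) (.cons a (.cons (unary m) z)))) := by
  rw [clauseData_eq]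
  refine ⟨by simp [bounded_ite, bounded_expr], ?_⟩
  rcases a with _ | ⟨_, _ | ⟨_, _⟩⟩ <;> exact bounded_moveTerm _ hL _ _ _

/-- The encoding of the rational number `0`. -/
def zeroExpr : Expr := .cons .nil (.cons .nil (.cons trueExpr .nil))

/-- The encoding of the rational number `1`. -/
def oneExpr : Expr := .cons .nil (.cons (.cons trueExpr .nil) (.cons trueExpr .nil))

theorem apply_zeroExpr (x : Data) : zeroExpr.apply x = ofRat 0 := by
  simp [zeroExpr, ofRat, apply_cons, apply_nil, apply_trueExpr, ofNat, ofBits, ofList, ofBool]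

theorem apply_oneExpr (x : Data) : oneExpr.apply x = ofRat 1 := by
  simp [oneExpr, ofRat, apply_cons, apply_nil, apply_trueExpr, ofNat, ofBits, ofList, ofBool,
    (zero_le_one' ℚ).not_gt]

/-- Loop body of `vecTerm`: the accumulator consists of the rest of the bits and the reversal of
the coordinates found so far. -/
def vecStep : Term :=
  ite (expr (.hd (.hd (V 1)))) (expr (.cons (.tl (.hd (V 1))) (.cons oneExpr (.tl (V 1)))))
    (expr (.cons (.tl (.hd (V 1))) (.cons zeroExpr (.tl (V 1)))))

/-- The rational vector with the given bits as coordinates, truncated or extended by zeros to a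
dimension given in unary. -/
def vecTerm : Term :=
  letIn (fold (expr (V 1)) (expr (.cons (V 0) .nil)) vecStep)
    (comp (expr (.cons (.tl (V 0)) (.cons .nil .nil))) revAppTerm)

theorem eval_vecStep (x env : Data) (l : List Bool) (out : List Data) :
    vecStep.eval (.cons x (.cons (.cons (ofBits l) (ofList out)) env)) =
      .cons (ofBits l.tail) (ofList (ofRat (if l.headD false then 1 else 0) :: out)) := by
  simp only [vecStep, eval, apply_V_zero, apply_V_succ, apply_cons, apply_tl, apply_hd,
    apply_zeroExpr, apply_oneExpr]
  rcases l with _ | ⟨_ | _, l⟩ <;> rfl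

theorem iterate_vecStep (d : ℕ) (u : List Bool) (out : List Data) (env : Data) :
    (fun acc => vecStep.eval (.cons .nil (.cons acc env)))^[d] (.cons (ofBits u) (ofList out)) =
      .cons (ofBits (u.drop d)) (ofList ((List.ofFn fun i : Fin d =>
        ofRat (if u.getD i false then 1 else 0)).reverse ++ out)) := by
  induction d generalizing u out with
  | zero => simp
  | succ d ih =>
    rw [Function.iterate_succ_apply, eval_vecStep, ih]
    cases u <;> simp [List.ofFn_succ]

theorem eval_vecTerm (u : List Bool) (d : ℕ) (z : Data) :
    vecTerm.eval (.cons (ofBits u) (.cons (unary d) z)) =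
      ofVec fun i : Fin d => if u.getD i false then 1 else 0 := by
  have hloop := iterate_vecStep d u [] (.cons (ofBits u) (.cons (unary d) z))
  rw [ofList, List.append_nil] at hloop
  simp only [vecTerm, eval, fold_unary, apply_V_zero, apply_V_succ, apply_cons, apply_nil,
    apply_tl, hloop, tl_cons]
  refine (eval_revAppTerm _ [] .nil).trans ?_
  rw [List.reverse_reverse, List.append_nil, ofVec]

theorem bounded_vecTerm {a : Data} (h : a.length ≤ L) (u z : Data) :
    vecTerm.Bounded L (.cons u (.cons a z)) := by
  refine ⟨⟨trivial, trivial, h, .of_forall (fun _ _ => by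
    simp [vecStep, bounded_ite, bounded_expr]) _ _⟩, trivial, ?_⟩
  refine bounded_revAppTerm (le_of_eq_of_le ?_ h)
  refine (fold_add_length (fun acc => acc.tl.length) (fun x acc => ?_) a _).trans (Nat.zero_add _)
  classical
  simp only [vecStep, eval_ite]
  split_ifs <;> rfl

/-- The features of a state, from the state, the exponent, and the dimension. -/
def featTerm : Term :=
  letIn (comp (expr (.cons (.cons trueExpr (V 0)) (.cons (V 1) .nil))) tensorPowTerm)
    (comp (expr (.cons (V 0) (.cons (V 3) .nil))) vecTerm)

theorem eval_featTerm (s : Game.State m v) (r d : ℕ) (z : Data) :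
    featTerm.eval (.cons (ofBits (Game.name s)) (.cons (unary r) (.cons (unary d) z))) =
      ofVec (Game.feat r d s) := by
  simp only [featTerm, eval, apply_V_zero, apply_V_succ, apply_cons, apply_nil, apply_trueExpr,
    ← ofBits_cons, eval_tensorPowTerm, eval_vecTerm]
  rfl

theorem bounded_featTerm (s : Game.State m v) {r d : ℕ} (hr : r ≤ L) (hd : d ≤ L)
    (hlen : 1 + m + v ≤ L) (hpow : (1 + m + v) ^ r ≤ L) (z : Data) :
    featTerm.Bounded L (.cons (ofBits (Game.name s)) (.cons (unary r) (.cons (unary d) z))) := by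
  have hname : (true :: Game.name s).length = 1 + m + v := by
    rw [List.length_cons, Game.length_name]; omega
  exact ⟨⟨trivial, bounded_tensorPowTerm (u := true :: Game.name s) (List.cons_ne_nil _ _) hr
    (hname ▸ hlen) (hname ▸ hpow)⟩, trivial, bounded_vecTerm ((length_unary d).trans_le hd) _ _⟩

/-- Loop body of `validTerm`: the accumulator consists of the rest of the list and a flag which
records that the elements before were bits. -/
def validStep : Term :=
  ite (expr (.hd (V 1)))
    (ite (expr (.hd (.hd (V 1))))
      (ite (expr (.hd (.hd (.hd (V 1))))) (expr (.cons .nil .nil))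
        (ite (expr (.tl (.hd (.hd (V 1))))) (expr (.cons .nil .nil))
          (expr (.cons (.tl (.hd (V 1))) (.tl (V 1))))))
      (expr (.cons (.tl (.hd (V 1))) (.tl (V 1)))))
    (expr (.cons .nil .nil))

/-- Test whether a tree is a list of bits of a length given in unary. -/
def validTerm : Term :=
  letIn (fold (expr (V 1)) (expr (.cons (V 0) trueExpr)) validStep)
    (ite (expr (.tl (V 0))) (ite (expr (.hd (V 0))) (expr .nil) (expr trueExpr)) (expr .nil))

theorem iterate_validStep_reject (n : ℕ) (env : Data) :
    (fun acc => validStep.eval (.cons .nil (.cons acc env)))^[n] (.cons .nil .nil) =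
      .cons .nil .nil :=
  Function.iterate_fixed (by rfl) n

theorem iterate_validStep_iff (n : ℕ) (x env : Data) :
    (((fun acc => validStep.eval (.cons .nil (.cons acc env)))^[n] (.cons x (ofBool true))).tl ≠
        .nil ∧
      ((fun acc => validStep.eval (.cons .nil (.cons acc env)))^[n] (.cons x (ofBool true))).hd =
        .nil) ↔ ∃ l : List Bool, l.length = n ∧ x = ofBits l := by
  induction n generalizing x with
  | zero => simp [ofBits_nil, hd_cons, tl_cons, ofBool]
  | succ n ih =>
    set step := fun acc => validStep.eval (.cons .nil (.cons acc env)) with hstep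
    have reject : ¬ ((step^[n] (.cons .nil .nil)).tl ≠ .nil ∧
        (step^[n] (.cons .nil .nil)).hd = .nil) := by
      rw [hstep, iterate_validStep_reject]
      exact fun h => h.1 rfl
    have accept : ∀ (b : Bool) (y : Data), (∃ l : List Bool, l.length = n ∧ y = ofBits l) ↔
        ∃ l : List Bool, l.length = n + 1 ∧ .cons (ofBool b) y = ofBits l := fun b y => by
      constructor
      · rintro ⟨l, rfl, rfl⟩
        exact ⟨b :: l, rfl, rfl⟩
      · rintro ⟨_ | ⟨b', l⟩, hlen, h⟩
        · simp at hlen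
        · exact ⟨l, by simpa using hlen, (Data.cons.inj h).2⟩
    rw [Function.iterate_succ_apply]
    rcases x with _ | ⟨_ | ⟨_ | ⟨_, _⟩, _ | ⟨_, _⟩⟩, y⟩
    · exact iff_of_false reject (by rintro ⟨_ | ⟨_, _⟩, hlen, h⟩ <;> simp_all [ofBits_cons])
    · exact (ih y).trans (accept false y)
    · exact (ih y).trans (accept true y)
    all_goals
      refine iff_of_false reject ?_
      rintro ⟨_ | ⟨_ | _, _⟩, hlen, h⟩ <;> simp_all [ofBits_cons, ofBool]

open Classical in
theorem eval_validTerm (x : Data) (n : ℕ) (z : Data) :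
    validTerm.eval (.cons x (.cons (unary n) z)) =
      ofBool (decide (∃ l : List Bool, l.length = n ∧ x = ofBits l)) := by
  have hvalid := iterate_validStep_iff n x (.cons x (.cons (unary n) z))
  simp only [validTerm, eval, fold_unary, apply_V_zero, apply_V_succ, apply_cons, apply_nil,
    apply_tl, apply_hd, apply_trueExpr]
  by_cases hx : ∃ l : List Bool, l.length = n ∧ x = ofBits l <;>
    simp only [hx, iff_true, iff_false, decide_true, decide_false] at hvalid ⊢ <;>
    cases htl : Data.tl _ <;> cases hhd : Data.hd _ <;> simp_all [ofBool]

theorem bounded_validTerm {a : Data} (h : a.length ≤ L) (x z : Data) :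
    validTerm.Bounded L (.cons x (.cons a z)) :=
  ⟨⟨trivial, trivial, h, .of_forall (fun _ _ => by
    simp [validStep, bounded_ite, bounded_expr]) _ _⟩, by simp [bounded_ite, bounded_expr]⟩

/-- Case distinction on a number in unary: the term `fs[n]` if the value of `e` is `n`, and `bad` if
it is not a number below the length of `fs`. -/
def caseUnary (bad : Term) : Expr → List Term → Term
  | _, [] => bad
  | e, f :: fs => ite (expr e) (ite (expr (.hd e)) bad (caseUnary bad (.tl e) fs)) f

section CaseUnary

variable {bad : Term} {e : Expr} {fs : List Term} {x : Data}

theorem eval_caseUnary (bad : Term) {n : ℕ} (he : e.apply x = unary n) (hn : n < fs.length) :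
    (caseUnary bad e fs).eval x = fs[n].eval x := by
  induction fs generalizing e n with
  | nil => simp at hn
  | cons f fs ih =>
    cases n with
    | zero => simp only [caseUnary, eval, he]; rfl
    | succ n =>
      simp only [caseUnary, eval, he, apply_hd]
      exact ih (by rw [apply_tl, he]; rfl) (by simpa using hn)

theorem eval_caseUnary_bad (he : ∀ n < fs.length, e.apply x ≠ unary n) :
    (caseUnary bad e fs).eval x = bad.eval x := by
  induction fs generalizing e with
  | nil => rfl
  | cons f fs ih =>
    simp only [caseUnary, eval, apply_hd]
    rcases h : e.apply x with _ | ⟨_ | ⟨_, _⟩, b⟩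
    · exact absurd h (he 0 (by simp))
    · refine ih fun n hn htail => he (n + 1) (by simpa using hn) ?_
      rw [apply_tl, h] at htail
      rw [h, show b = unary n from htail]
      rfl
    · rfl

theorem bounded_caseUnary (hbad : bad.Bounded L x) (hfs : ∀ f ∈ fs, f.Bounded L x) :
    (caseUnary bad e fs).Bounded L x := by
  induction fs generalizing e with
  | nil => exact hbad
  | cons f fs ih =>
    simp only [caseUnary, bounded_ite, bounded_expr, true_and]
    exact ⟨fun _ => hfs f (by simp), fun _ => ⟨fun _ => ih fun g hg => hfs g (by simp [hg]),
      fun _ => hbad⟩⟩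

end CaseUnary

end Term

namespace Term

open Data

section Moves

variable {v m L : ℕ} {φ : Formula v}

/-- Continue with `f` if the state whose name is the value of `s` violates a clause, and with `g`
otherwise. The first violated clause (`nil` if there is none) and the assignment of the state are
put in front of the environment. `M` and `Φ` are the length of the counter and the formula; `Φ` is
evaluated behind one more variable. -/
def withFirstUnsat (M s Φ : Expr) (f g : Term) : Term :=
  letIn (comp (expr (.cons M (.cons s .nil))) dropTerm) <|
    letIn (comp (expr (.cons (V 0) (.cons Φ .nil))) unsatTerm) <| ite (expr (V 0)) f g

/-- Continue with `f` on the environment extended by the name of the next state, and with `g` if the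
time is over. The values of `M`, `s`, `c`, `a` are the length of the counter, the name of the state,
the first clause violated by it, and the action. -/
def withNext (M s c a : Expr) (f g : Term) : Term :=
  ite (comp (expr (.cons M (.cons s .nil))) lastTerm) g
    (letIn (comp (expr (.cons s (.cons c (.cons a (.cons M .nil))))) nextTerm) f)

variable {M e Φ C A : Expr} {f g : Term} {s : Game.State m v} {c : Clause v} {x : Data}

theorem eval_withFirstUnsat (hM : M.apply x = unary m) (hs : e.apply x = ofBits (Game.name s))
    (hΦ : ∀ y, Φ.apply (.cons y x) = clausesData φ) :
    (withFirstUnsat M e Φ f g).eval x = (Game.firstUnsat φ s.2).elim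
      (g.eval (.cons .nil (.cons (ofBits (List.ofFn s.2)) x)))
      fun c => f.eval (.cons (clauseData c) (.cons (ofBits (List.ofFn s.2)) x)) := by
  simp only [withFirstUnsat, eval, apply_cons, apply_nil, hM, hs, hΦ, eval_dropTerm,
    iterate_tl_ofBits, Game.drop_name, apply_V_zero, eval_unsatTerm]
  cases Game.firstUnsat φ s.2 with
  | none => rfl
  | some c => simp only [Option.elim, clauseData_eq]

theorem bounded_withFirstUnsat (hM : M.apply x = unary m) (hs : e.apply x = ofBits (Game.name s))
    (hΦ : ∀ y, Φ.apply (.cons y x) = clausesData φ) (h3 : 3 ≤ L) (hmv : m + v ≤ L)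
    (hφ : φ.length ≤ L)
    (hf : ∀ c, Game.firstUnsat φ s.2 = some c →
      f.Bounded L (.cons (clauseData c) (.cons (ofBits (List.ofFn s.2)) x)))
    (hg : g.Bounded L (.cons .nil (.cons (ofBits (List.ofFn s.2)) x))) :
    (withFirstUnsat M e Φ f g).Bounded L x := by
  simp only [withFirstUnsat, bounded_letIn, bounded_comp, bounded_expr, bounded_ite, eval,
    apply_cons, apply_nil, hM, hs, hΦ, eval_dropTerm, iterate_tl_ofBits, Game.drop_name,
    apply_V_zero, eval_unsatTerm, true_and]
  refine ⟨bounded_dropTerm (by rw [length_unary]; omega),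
    bounded_unsatTerm φ h3 (by omega) hφ _ _, ?_⟩
  rcases hc : Game.firstUnsat φ s.2 with _ | c
  · exact ⟨fun _ => hg, fun h => absurd rfl h⟩
  · refine ⟨fun h => ?_, fun _ => hf c hc⟩
    rw [Option.elim, clauseData_eq] at h
    cases h

theorem eval_lastTerm_name (s : Game.State m v) (z : Data) :
    lastTerm.eval (.cons (unary m) (.cons (ofBits (Game.name s)) z)) =
      ofBool (decide ((s.1 : ℕ) + 1 = 2 ^ m)) :=
  eval_lastTerm s.1.2 _ z

theorem eval_withNext (hM : M.apply x = unary m) (hs : e.apply x = ofBits (Game.name s))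
    (hC : C.apply x = clauseData c) (hc : Game.firstUnsat φ s.2 = some c) :
    (withNext M e C A f g).eval x = (Game.next φ m s (action (A.apply x))).elim (g.eval x)
      fun s' => f.eval (.cons (ofBits (Game.name s')) x) := by
  simp only [withNext, eval, apply_cons, apply_nil, hM, hs, hC, eval_lastTerm_name]
  by_cases hlast : (s.1 : ℕ) + 1 = 2 ^ m
  · rw [Game.next_eq_none.2 (.inr hlast), decide_eq_true hlast]
    rfl
  · have hlt : (s.1 : ℕ) + 1 < 2 ^ m := by have := s.1.2; omega
    rw [Game.next_of_firstUnsat hc _ hlt, decide_eq_false hlast, eval_nextTerm hlt]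
    rfl

theorem bounded_withNext (hM : M.apply x = unary m) (hs : e.apply x = ofBits (Game.name s))
    (hC : C.apply x = clauseData c) (hmv : m + v ≤ L) (hg : g.Bounded L x)
    (hf : ∀ s' : Game.State m v, f.Bounded L (.cons (ofBits (Game.name s')) x)) :
    (withNext M e C A f g).Bounded L x := by
  simp only [withNext, bounded_ite, bounded_letIn, bounded_comp, bounded_expr, eval, apply_cons,
    apply_nil, hM, hs, hC, eval_lastTerm_name, true_and]
  refine ⟨bounded_lastTerm (by rw [length_unary]; omega), fun h => ?_, fun _ => hg⟩
  have hlt : (s.1 : ℕ) + 1 < 2 ^ m := by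
    have hlast := of_decide_eq_false ((ofBool_eq_nil _).1 h)
    have := s.1.2
    omega
  rw [eval_nextTerm hlt]
  exact ⟨bounded_nextTerm c hmv _ _, hf _⟩

end Moves

/-! ### The simulated oracle -/

section Query

variable {v : ℕ} (φ : Formula v) (m r d : ℕ)

/-- The parameters of the simulated oracle. -/
def paramsData : Data :=
  .cons (unary m) (.cons (unary r) (.cons (unary d) (.cons (unary (m + v))
    (.cons (unary (2 ^ m)) (.cons (clausesData φ) .nil)))))

/-- Parameters for which all lists that occur have length at most `L`. -/
structure Fits (L : ℕ) : Prop where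
  three_le : 3 ≤ L
  clauses : φ.length ≤ L
  name : 1 + m + v ≤ L
  exponent : r ≤ L
  dim : d ≤ L
  steps : 2 ^ m ≤ L
  tensor : (1 + m + v) ^ r ≤ L

/-- The answer `nil`, given to everything that is not a call. -/
def badTerm : Term := expr (.cons .nil .nil)

/-- If the value of `e` is the name of a state, continue with `f` if the state violates a clause,
and abort the simulation if there is none. -/
def guardTerm (e : Expr) (f : Term) : Term :=
  ite (comp (expr (.cons e (.cons (V 4) .nil))) validTerm)
    (withFirstUnsat (V 1) e (V 7) f (expr (.cons trueExpr .nil))) badTerm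

/-- The answer `0` to a query of a reward. -/
def rewardTerm : Term := expr (.cons .nil zeroExpr)

/-- Answer to a query of a transition. -/
def transTerm : Term :=
  withNext (V 3) (.hd (.tl (V 2))) (V 0) (.tl (.tl (V 2))) (expr (.cons .nil (.cons .nil (V 0))))
    badTerm

/-- Answer with the features of the state named by `s`, for the degree `r` and the dimension `d`. -/
def featAnswerTerm (s r d : Expr) : Term :=
  letIn (comp (expr (.cons s (.cons r (.cons d .nil)))) featTerm) (expr (.cons .nil (V 0)))

/-- Answer to a query of the features of a state and an action. -/
def featSATerm : Term :=
  withNext (V 3) (.hd (.tl (V 2))) (V 0) (.tl (.tl (V 2))) (featAnswerTerm (V 0) (V 5) (V 6))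
    (featAnswerTerm (.hd (.tl (V 2))) (V 4) (V 5))

/-- Answer, by means of `f`, to a query with a state and an action. -/
def withActionTerm (f : Term) : Term :=
  caseUnary badTerm (.tl (.tl (V 0))) (List.replicate 3 (guardTerm (.hd (.tl (V 0))) f))

/-- The answer to a query. -/
def queryTerm : Term :=
  caseUnary badTerm (.hd (V 0)) [withActionTerm rewardTerm, withActionTerm transTerm,
    guardTerm (.tl (V 0)) (featAnswerTerm (.tl (V 2)) (V 4) (V 5)), withActionTerm featSATerm]

variable {φ m r d} {e : Expr} {f : Term} {q : Data} {s : Game.State m v} {c : Clause v}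

section Guard

theorem eval_guardTerm (he : e.apply (.cons q (paramsData φ m r d)) = ofBits (Game.name s)) :
    (guardTerm e f).eval (.cons q (paramsData φ m r d)) = (Game.firstUnsat φ s.2).elim
      (.cons (ofBool true) .nil)
      fun c => f.eval (.cons (clauseData c) (.cons (ofBits (List.ofFn s.2))
        (.cons q (paramsData φ m r d)))) := by
  have hmv : (V 4).apply (.cons q (paramsData φ m r d)) = unary (m + v) := rfl
  have hvalid : ∃ l : List Bool, l.length = m + v ∧ ofBits (Game.name s) = ofBits l :=
    ⟨_, Game.length_name s, rfl⟩
  simp only [guardTerm, eval, apply_cons, apply_nil, he, hmv, eval_validTerm, hvalid, decide_true]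
  exact eval_withFirstUnsat rfl he fun _ => rfl

theorem eval_guardTerm_eq_bad
    (he : ∀ s : Game.State m v, e.apply (.cons q (paramsData φ m r d)) ≠ ofBits (Game.name s)) :
    (guardTerm e f).eval (.cons q (paramsData φ m r d)) = .cons .nil .nil := by
  have hmv : (V 4).apply (.cons q (paramsData φ m r d)) = unary (m + v) := rfl
  have hinvalid : ¬ ∃ l : List Bool, l.length = m + v ∧
      e.apply (.cons q (paramsData φ m r d)) = ofBits l := by
    rintro ⟨l, hl, h⟩
    obtain ⟨s, rfl⟩ := Game.exists_name_eq hl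
    exact he s h
  simp only [guardTerm, eval, apply_cons, apply_nil, hmv, eval_validTerm, hinvalid, decide_false]
  rfl

variable {L : ℕ} (hL : Fits φ m r d L)

include hL

theorem bounded_guardTerm
    (hf : ∀ (s : Game.State m v) (c : Clause v),
      e.apply (.cons q (paramsData φ m r d)) = ofBits (Game.name s) →
      f.Bounded L (.cons (clauseData c) (.cons (ofBits (List.ofFn s.2))
        (.cons q (paramsData φ m r d))))) :
    (guardTerm e f).Bounded L (.cons q (paramsData φ m r d)) := by
  have hmv : (V 4).apply (.cons q (paramsData φ m r d)) = unary (m + v) := rfl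
  have hmvL : m + v ≤ L := by have := hL.name; omega
  simp only [guardTerm, bounded_ite, bounded_comp, bounded_expr, eval, apply_cons, apply_nil, hmv,
    eval_validTerm, true_and]
  refine ⟨bounded_validTerm (by rwa [length_unary]) _ _, fun _ => trivial, fun h => ?_⟩
  obtain ⟨l, hl, hel⟩ : ∃ l : List Bool, l.length = m + v ∧
      e.apply (.cons q (paramsData φ m r d)) = ofBits l := by
    by_contra hinvalid
    exact h (by simp only [hinvalid, decide_false]; rfl)
  obtain ⟨s, rfl⟩ := Game.exists_name_eq hl
  exact bounded_withFirstUnsat rfl hel (fun _ => rfl) hL.three_le hmvL hL.clauses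
    (fun c _ => hf s c hel) trivial

theorem bounded_featAnswerTerm {S R D : Expr} {x : Data} (hS : S.apply x = ofBits (Game.name s))
    (hR : R.apply x = unary r) (hD : D.apply x = unary d) :
    (featAnswerTerm S R D).Bounded L x := by
  simp only [featAnswerTerm, bounded_letIn, bounded_comp, bounded_expr, eval, apply_cons, apply_nil,
    hS, hR, hD, true_and, and_true]
  exact bounded_featTerm s hL.exponent hL.dim hL.name hL.tensor _

theorem bounded_transTerm {z : Data} (hs : q.tl.hd = ofBits (Game.name s)) :
    transTerm.Bounded L (.cons (clauseData c) (.cons z (.cons q (paramsData φ m r d)))) :=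
  bounded_withNext rfl hs rfl (by have := hL.name; omega) trivial fun _ => trivial

theorem bounded_featSATerm {z : Data} (hs : q.tl.hd = ofBits (Game.name s)) :
    featSATerm.Bounded L (.cons (clauseData c) (.cons z (.cons q (paramsData φ m r d)))) :=
  bounded_withNext rfl hs rfl (by have := hL.name; omega) (bounded_featAnswerTerm hL hs rfl rfl)
    fun _ => bounded_featAnswerTerm hL rfl rfl rfl

theorem bounded_withActionTerm
    (hf : ∀ (s : Game.State m v) (c : Clause v) z, q.tl.hd = ofBits (Game.name s) →
      f.Bounded L (.cons (clauseData c) (.cons z (.cons q (paramsData φ m r d))))) :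
    (withActionTerm f).Bounded L (.cons q (paramsData φ m r d)) := by
  refine bounded_caseUnary trivial fun g hg => ?_
  rw [List.eq_of_mem_replicate hg]
  exact bounded_guardTerm hL fun s c => hf s c _

theorem bounded_queryTerm (q : Data) : queryTerm.Bounded L (.cons q (paramsData φ m r d)) := by
  refine bounded_caseUnary trivial fun g hg => ?_
  simp only [List.mem_cons, List.not_mem_nil, or_false] at hg
  rcases hg with rfl | rfl | rfl | rfl
  · exact bounded_withActionTerm hL fun _ _ _ _ => trivial
  · exact bounded_withActionTerm hL fun _ _ _ => bounded_transTerm hL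
  · exact bounded_guardTerm hL fun _ _ hs => bounded_featAnswerTerm hL hs rfl rfl
  · exact bounded_withActionTerm hL fun _ _ _ => bounded_featSATerm hL

end Guard

section Call

variable (w₀ : Fin v → Bool)

/-- The state of a call. -/
def callState : (Game.mdp φ m r d w₀).Call → Game.State m v
  | .reward s _ => s
  | .trans s _ => s
  | .featS s => s
  | .featSA s _ => s

/-- The answer to a call if all rewards are zero. -/
noncomputable def callAnswer : (Game.mdp φ m r d w₀).Call → Data
  | .reward _ _ => ofRat 0
  | .trans s a => (Game.next φ m s a).elim .nil fun s' => .cons .nil (ofBits (Game.name s'))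
  | .featS s => ofVec (Game.feat r d s)
  | .featSA s a => ofVec ((Game.mdp φ m r d w₀).featSA s a)

theorem eval_featAnswerTerm {S R D : Expr} {x : Data} (hS : S.apply x = ofBits (Game.name s))
    (hR : R.apply x = unary r) (hD : D.apply x = unary d) :
    (featAnswerTerm S R D).eval x = .cons .nil (ofVec (Game.feat r d s)) := by
  simp only [featAnswerTerm, eval, apply_cons, apply_nil, hS, hR, hD, apply_V_zero, eval_featTerm]

theorem eval_transTerm {z : Data} {a : Fin 3} (hc : Game.firstUnsat φ s.2 = some c)
    (hs : q.tl.hd = ofBits (Game.name s)) (ha : q.tl.tl = unary a) :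
    transTerm.eval (.cons (clauseData c) (.cons z (.cons q (paramsData φ m r d)))) =
      .cons .nil ((Game.next φ m s a).elim .nil fun s' => .cons .nil (ofBits (Game.name s'))) := by
  have ha' : action ((Expr.tl (.tl (V 2))).apply
      (.cons (clauseData c) (.cons z (.cons q (paramsData φ m r d))))) = a :=
    (congrArg action ha).trans (action_unary a)
  have hs' : (Expr.hd (.tl (V 2))).apply
      (.cons (clauseData c) (.cons z (.cons q (paramsData φ m r d)))) = ofBits (Game.name s) := hs
  rw [transTerm, eval_withNext rfl hs' rfl hc, ha']
  cases Game.next φ m s a <;> rfl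

theorem eval_featSATerm {z : Data} {a : Fin 3} (hc : Game.firstUnsat φ s.2 = some c)
    (hs : q.tl.hd = ofBits (Game.name s)) (ha : q.tl.tl = unary a) :
    featSATerm.eval (.cons (clauseData c) (.cons z (.cons q (paramsData φ m r d)))) =
      .cons .nil (ofVec ((Game.mdp φ m r d w₀).featSA s a)) := by
  have ha' : action ((Expr.tl (.tl (V 2))).apply
      (.cons (clauseData c) (.cons z (.cons q (paramsData φ m r d))))) = a :=
    (congrArg action ha).trans (action_unary a)
  have hs' : (Expr.hd (.tl (V 2))).apply
      (.cons (clauseData c) (.cons z (.cons q (paramsData φ m r d)))) = ofBits (Game.name s) := hs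
  rw [featSATerm, eval_withNext rfl hs' rfl hc, ha']
  change _ = Data.cons .nil (ofVec ((Game.next φ m s a).elim (Game.feat r d s) (Game.feat r d)))
  cases Game.next φ m s a with
  | none => exact eval_featAnswerTerm hs rfl rfl
  | some s' => exact eval_featAnswerTerm rfl rfl rfl

open Classical in
theorem eval_guardTerm_eq_ite {y : Data}
    (he : e.apply (.cons q (paramsData φ m r d)) = ofBits (Game.name s))
    (hf : ∀ c, Game.firstUnsat φ s.2 = some c → f.eval (.cons (clauseData c)
      (.cons (ofBits (List.ofFn s.2)) (.cons q (paramsData φ m r d)))) = .cons .nil y) :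
    (guardTerm e f).eval (.cons q (paramsData φ m r d)) =
      if Satisfies s.2 φ then .cons (ofBool true) .nil else .cons .nil y := by
  simp only [eval_guardTerm he, ← Game.firstUnsat_eq_none]
  rcases hc : Game.firstUnsat φ s.2 with _ | c
  · rfl
  · exact hf c hc

theorem eval_withActionTerm {n : ℕ} (hn : n < 3) (hq : q.tl.tl = unary n) :
    (withActionTerm f).eval (.cons q (paramsData φ m r d)) =
      (guardTerm (.hd (.tl (V 0))) f).eval (.cons q (paramsData φ m r d)) := by
  have hq' : (Expr.tl (.tl (V 0))).apply (.cons q (paramsData φ m r d)) = unary n := hq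
  rw [withActionTerm, eval_caseUnary badTerm hq' (by simpa using hn), List.getElem_replicate]

open Classical in
theorem eval_queryTerm_call (c : (Game.mdp φ m r d w₀).Call) :
    queryTerm.eval (.cons c.toData (paramsData φ m r d)) =
      if Satisfies (callState w₀ c).2 φ then .cons (ofBool true) .nil
      else .cons .nil (callAnswer w₀ c) := by
  cases c with
  | reward s a =>
    rw [queryTerm, eval_caseUnary _ (n := 0) rfl (by simp)]
    exact (eval_withActionTerm a.2 rfl).trans (eval_guardTerm_eq_ite rfl fun c _ => by
      simp only [rewardTerm, eval, apply_cons, apply_nil, apply_zeroExpr, callAnswer])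
  | trans s a =>
    rw [queryTerm, eval_caseUnary _ (n := 1) rfl (by simp)]
    exact (eval_withActionTerm a.2 rfl).trans
      (eval_guardTerm_eq_ite rfl fun c hc => eval_transTerm hc rfl rfl)
  | featS s =>
    rw [queryTerm, eval_caseUnary _ (n := 2) rfl (by simp)]
    exact eval_guardTerm_eq_ite rfl fun c _ => eval_featAnswerTerm rfl rfl rfl
  | featSA s a =>
    rw [queryTerm, eval_caseUnary _ (n := 3) rfl (by simp)]
    exact (eval_withActionTerm a.2 rfl).trans
      (eval_guardTerm_eq_ite rfl fun c hc => eval_featSATerm w₀ hc rfl rfl)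

theorem ofBits_name_ne_nil (hm : 0 < m) (s : Game.State m v) : ofBits (Game.name s) ≠ .nil := by
  intro h
  have hlen := congrArg Data.length h
  rw [length_ofBits, Game.length_name, Data.length] at hlen
  omega

theorem eval_withActionTerm_eq_bad (hm : 0 < m) {t : ℕ} (ht : q.hd = unary t)
    (hq : ∀ (s : Game.State m v) (a : Fin 3),
      .cons (unary t) (.cons (ofBits (Game.name s)) (unary a)) ≠ q) :
    (withActionTerm f).eval (.cons q (paramsData φ m r d)) = .cons .nil .nil := by
  by_cases ha : ∃ n < 3, q.tl.tl = unary n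
  · obtain ⟨n, hn, ha⟩ := ha
    rw [eval_withActionTerm hn ha]
    refine eval_guardTerm_eq_bad fun s hs => ?_
    change q.tl.hd = ofBits (Game.name s) at hs
    refine hq s ⟨n, hn⟩ ?_
    rcases q with _ | ⟨x, _ | ⟨y, z⟩⟩
    · exact absurd hs.symm (ofBits_name_ne_nil hm s)
    · exact absurd hs.symm (ofBits_name_ne_nil hm s)
    · simp only [hd_cons, tl_cons] at ht hs ha
      rw [ht, hs, ha]
  · exact eval_caseUnary_bad (e := .tl (.tl (V 0))) (x := .cons q (paramsData φ m r d))
      fun n hn h => ha ⟨n, by simpa using hn, h⟩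

theorem eval_queryTerm_of_not_call (hm : 0 < m)
    (hq : ∀ c : (Game.mdp φ m r d w₀).Call, c.toData ≠ q) :
    queryTerm.eval (.cons q (paramsData φ m r d)) = .cons .nil .nil := by
  by_cases ht : ∃ n < 4, q.hd = unary n
  · obtain ⟨n, hn, ht⟩ := ht
    have ht' : (Expr.hd (V 0)).apply (.cons q (paramsData φ m r d)) = unary n := ht
    rw [queryTerm, eval_caseUnary badTerm ht' (by simpa using hn)]
    interval_cases n
    · exact eval_withActionTerm_eq_bad hm ht fun s a => hq (.reward s a)
    · exact eval_withActionTerm_eq_bad hm ht fun s a => hq (.trans s a)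
    · refine eval_guardTerm_eq_bad fun s hs => ?_
      change q.tl = ofBits (Game.name s) at hs
      rcases q with _ | ⟨x, y⟩
      · exact ofBits_name_ne_nil hm s hs.symm
      · simp only [hd_cons, tl_cons] at ht hs
        exact hq (.featS s) (by rw [ht, hs]; rfl)
    · exact eval_withActionTerm_eq_bad hm ht fun s a => hq (.featSA s a)
  · exact eval_caseUnary_bad (e := .hd (V 0)) (x := .cons q (paramsData φ m r d))
      fun n hn h => ht ⟨n, by simpa using hn, h⟩

end Call

end Query

end Term

theorem MDP.mem_goodOutputs {k : ℕ} {M : MDP k} {y : Data} : y ∈ M.goodOutputs ↔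
    ∃ (as : List (Fin k)) (π : M.Policy), y = .ofList (as.map fun a : Fin k => .unary a) ∧
      M.Describes as π ∧ M.Vstar M.start - 1 / 4 < M.V π M.start := by
  -- The definition coerces the whole list to numbers, in the list monad, before mapping over it.
  have hcoe (as : List (Fin k)) : (as >>= fun a => pure a.val) = as.map Fin.val :=
    List.flatMap_pure_eq_map ..
  simp only [goodOutputs, Set.mem_ofPred_eq, hcoe, List.map_map]
  rfl

section Walk

variable {v : ℕ}

/-- One step of the walk along a list of actions; `none` means that a satisfying assignment has been
found. The walk stays at its last state when the time is over. -/
def walkStep (φ : Formula v) (m : ℕ) :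
    Option (Game.State m v × Data) → Option (Game.State m v × Data)
  | none => none
  | some (s, y) => (Game.firstUnsat φ s.2).map fun _ =>
      (Game.next φ m s (Term.action y.hd)).elim (s, y) fun s' => (s', y.tl)

variable {φ : Formula v} {m r d : ℕ} {w₀ : Fin v → Bool}

theorem iterate_walkStep_none (n : ℕ) : (walkStep φ m)^[n] none = none :=
  Function.iterate_fixed rfl n

theorem iterate_walkStep_ne_none (hφ : ¬ ∃ w, Satisfies w φ) (n : ℕ)
    (p : Game.State m v × Data) : (walkStep φ m)^[n] (some p) ≠ none := by
  induction n generalizing p with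
  | zero => exact Option.some_ne_none p
  | succ n ih =>
    obtain ⟨c, hc⟩ := Option.ne_none_iff_exists'.1 fun h : Game.firstUnsat φ p.1.2 = none =>
      hφ ⟨_, Game.firstUnsat_eq_none.1 h⟩
    rw [Function.iterate_succ_apply, walkStep, hc]
    exact ih _

theorem expect_returnDist_le_of_walk_ne_none (hw₀ : Satisfies w₀ φ)
    {π : (Game.mdp φ m r d w₀).Policy} {n : ℕ} {s : Game.State m v} {as : List (Fin 3)}
    (hn : (s.1 : ℕ) + n + 1 = 2 ^ m)
    (has : ∀ t s', (Game.mdp φ m r d w₀).traj π s t = some s' → as[t]? = some (π s'))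
    (hwalk : (walkStep φ m)^[n + 1]
      (some (s, .ofList (as.map fun a : Fin 3 => .unary a))) ≠ none) :
    expect ((Game.mdp φ m r d w₀).returnDist π (n + 1) (some s)) ≤ ((1 + v) / 2 ^ m) ^ r := by
  induction n generalizing s as with
  | zero =>
    have hend : (Game.mdp φ m r d w₀).trans s (π s) = none := Game.next_eq_none.2 (.inr hn)
    rw [MDP.returnDist_succ_of_trans_eq_none hend,
      (Game.isFinalReward hw₀).expect_reward hend]
    exact Game.value_le_of_counter_eq r w₀ hn
  | succ n ih =>
    rw [Function.iterate_succ_apply, walkStep] at hwalk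
    obtain ⟨c, hc⟩ : ∃ c, Game.firstUnsat φ s.2 = some c := by
      rw [← Option.ne_none_iff_exists']
      intro h
      rw [h] at hwalk
      exact hwalk (iterate_walkStep_none _)
    have hnext : (Game.mdp φ m r d w₀).trans s (π s) = some _ :=
      Game.next_of_firstUnsat hc (π s) (by omega)
    obtain ⟨as', rfl⟩ : ∃ as', as = π s :: as' := by
      obtain ⟨hlen, hget⟩ := List.getElem?_eq_some_iff.1 (has 0 s rfl)
      cases as with
      | nil => cases hlen
      | cons a as' => exact ⟨as', congrArg (· :: as') hget⟩
    rw [MDP.returnDist_succ_of_reward_eq_pure_zero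
      ((Game.isFinalReward hw₀).reward_eq hnext), hnext]
    refine ih (as := as') (by dsimp only; omega) (fun t s' h => has (t + 1) s' ?_) ?_
    · rwa [MDP.traj_succ π hnext]
    · rw [hc] at hwalk
      have hact : Term.action (Data.ofList ((π s :: as').map fun a : Fin 3 => .unary a)).hd = π s :=
        Term.action_unary (π s)
      have hnext' := Game.next_of_firstUnsat hc (π s) (by omega)
      rwa [Option.map_some, hact, hnext'] at hwalk

theorem iterate_walkStep_eq_none (hw₀ : Satisfies w₀ φ)
    (hval : (r : ℝ) * v / 2 ^ m + ((1 + v) / 2 ^ m) ^ r ≤ 3 / 4)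
    {y : Data} (hy : y ∈ (Game.mdp φ m r d w₀).goodOutputs) :
    (walkStep φ m)^[2 ^ m] (some ((Game.mdp φ m r d w₀).start, y)) = none := by
  obtain ⟨as, π, rfl, has, hV⟩ := MDP.mem_goodOutputs.1 hy
  by_contra hwalk
  obtain ⟨n, hn⟩ := Nat.exists_eq_succ_of_ne_zero (Nat.two_pow_pos m).ne'
  have hle : (Game.mdp φ m r d w₀).V π (Game.mdp φ m r d w₀).start ≤ ((1 + v) / 2 ^ m) ^ r := by
    have hhorizon : (Game.mdp φ m r d w₀).horizon = n + 1 := hn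
    rw [MDP.V, hhorizon]
    rw [hn] at hwalk
    exact expect_returnDist_le_of_walk_ne_none hw₀ (hn.trans (by simp [Game.mdp])).symm has hwalk
  rw [(Game.isFinalReward hw₀).Vstar_eq] at hV
  have hge : 1 - r * v / 2 ^ m ≤ Game.value r w₀ (Game.mdp φ m r d w₀).start :=
    Game.le_value_of_counter_eq_zero r w₀ rfl
  linarith

end Walk

namespace Term

open Data

variable {v : ℕ} {φ : Formula v} {m r d : ℕ}

/-- Term for a step of the walk. -/
def walkStepTerm : Term :=
  ite (expr (V 1))
    (withFirstUnsat (V 3) (.hd (V 1)) (V 9)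
      (withNext (V 5) (.hd (V 3)) (V 0) (.hd (.tl (V 3))) (expr (.cons (V 0) (.tl (.tl (V 4)))))
        (expr (V 3)))
      (expr .nil))
    (expr .nil)

/-- Test whether the walk along a list of actions finds a satisfying assignment. -/
def walkTerm : Term :=
  ite (fold (expr (V 5)) (expr (.cons (V 4) (V 0))) walkStepTerm) (expr .nil) (expr trueExpr)

/-- The state of the walk as a tree. -/
def walkData : Option (Game.State m v × Data) → Data
  | none => .nil
  | some (s, y) => .cons (ofBits (Game.name s)) y

theorem eval_walkStepTerm (o : Option (Game.State m v × Data)) (y z : Data) :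
    walkStepTerm.eval (.cons z (.cons (walkData o) (.cons y (paramsData φ m r d)))) =
      walkData (walkStep φ m o) := by
  rcases o with _ | ⟨s, y'⟩
  · rfl
  refine (eval_withFirstUnsat (M := V 3) (e := .hd (V 1)) (s := s) rfl rfl fun _ => rfl).trans ?_
  rw [walkStep]
  rcases hc : Game.firstUnsat φ s.2 with _ | c
  · rfl
  · refine (eval_withNext (M := V 5) (e := .hd (V 3)) (s := s) (C := V 0) rfl rfl rfl hc).trans ?_
    change Option.elim (Game.next φ m s (action y'.hd)) _ _ =
      walkData (some (Option.elim (Game.next φ m s (action y'.hd)) _ _))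
    cases Game.next φ m s (action y'.hd) <;> rfl

theorem bitList_zero (m : ℕ) : bitList m 0 = List.replicate m false := by
  induction m with
  | zero => rfl
  | succ m ih => simp [bitList, ih, List.replicate_succ]

theorem ofBits_name_start (w₀ : Fin v → Bool) :
    ofBits (Game.name (Game.mdp φ m r d w₀).start) = unary (m + v) := by
  rw [unary_eq_ofBits, List.replicate_add, ← bitList_zero, ← List.ofFn_const]
  rfl

theorem iterate_eval_walkStepTerm (w₀ : Fin v → Bool) (y : Data) (n : ℕ) :
    (fun acc => walkStepTerm.eval (.cons .nil (.cons acc (.cons y (paramsData φ m r d)))))^[n]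
      (.cons (unary (m + v)) y) =
      walkData ((walkStep φ m)^[n] (some ((Game.mdp φ m r d w₀).start, y))) := by
  rw [← ofBits_name_start (φ := φ) (r := r) (d := d) w₀]
  have hsemiconj : Function.Semiconj walkData (walkStep φ m)
      fun acc => walkStepTerm.eval (.cons .nil (.cons acc (.cons y (paramsData φ m r d)))) :=
    fun o => (eval_walkStepTerm o y .nil).symm
  exact (hsemiconj.iterate_right n (some ((Game.mdp φ m r d w₀).start, y))).symm

theorem eval_walkTerm (w₀ : Fin v → Bool) (y : Data) :
    walkTerm.eval (.cons y (paramsData φ m r d)) = ofBool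
      ((walkStep φ m)^[2 ^ m] (some ((Game.mdp φ m r d w₀).start, y))).isNone := by
  have hsteps : (V 5).apply (.cons y (paramsData φ m r d)) = unary (2 ^ m) := rfl
  have hname : (V 4).apply (.cons y (paramsData φ m r d)) = unary (m + v) := rfl
  simp only [walkTerm, eval, hsteps, hname, apply_cons, apply_V_zero, fold_unary,
    iterate_eval_walkStepTerm w₀ y]
  cases (walkStep φ m)^[2 ^ m] (some ((Game.mdp φ m r d w₀).start, y)) <;> rfl

theorem bounded_walkStepTerm {L : ℕ} (hL : Fits φ m r d L) (o : Option (Game.State m v × Data))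
    (y z : Data) :
    walkStepTerm.Bounded L (.cons z (.cons (walkData o) (.cons y (paramsData φ m r d)))) := by
  have hmvL : m + v ≤ L := by have := hL.name; omega
  refine (bounded_ite ..).2 ⟨trivial, fun _ => trivial, fun h => ?_⟩
  rcases o with _ | ⟨s, y'⟩
  · exact absurd rfl h
  · exact bounded_withFirstUnsat (s := s) rfl rfl (fun _ => rfl) hL.three_le hmvL hL.clauses
      (fun _ _ => bounded_withNext (s := s) rfl rfl rfl hmvL trivial fun _ => trivial) trivial

theorem bounded_walkTerm {L : ℕ} (hL : Fits φ m r d L) (y : Data) :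
    walkTerm.Bounded L (.cons y (paramsData φ m r d)) := by
  have hsteps : (V 5).apply (.cons y (paramsData φ m r d)) = unary (2 ^ m) := rfl
  have hname : (V 4).apply (.cons y (paramsData φ m r d)) = unary (m + v) := rfl
  refine (bounded_ite ..).2 ⟨⟨trivial, trivial, ?_, ?_⟩, fun _ => trivial, fun _ => trivial⟩
  · rw [eval, hsteps, length_unary]
    exact hL.steps
  · simp only [eval, hsteps, hname, apply_cons, apply_V_zero]
    refine FoldAll.unary fun i _ => ?_
    rw [iterate_eval_walkStepTerm fun _ => false]
    exact bounded_walkStepTerm hL _ _ _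

end Term

namespace Term

open Data

variable {L : ℕ}

section Arithmetic

/-- A constant in unary. -/
def constExpr : ℕ → Expr
  | 0 => .nil
  | n + 1 => .cons .nil (constExpr n)

theorem apply_constExpr (n : ℕ) (x : Data) : (constExpr n).apply x = unary n := by
  induction n with
  | zero => rfl
  | succ n ih => rw [constExpr, apply_cons, ih]; rfl

theorem iterate_tl_unary (n k : ℕ) : tl^[n] (unary k) = unary (k - n) := by
  rw [unary_eq_ofBits, iterate_tl_ofBits, List.drop_replicate, ← unary_eq_ofBits]

theorem iterate_cons_nil (n k : ℕ) : (Data.cons .nil)^[n] (unary k) = unary (k + n) := by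
  induction n with
  | zero => rfl
  | succ n ih => rw [Function.iterate_succ_apply', ih]; rfl

/-- Multiplication in unary. -/
def mulTerm : Term :=
  fold (expr (V 0)) (expr .nil) (fold (expr (V 3)) (expr (V 1)) (expr (.cons .nil (V 1))))

theorem eval_mulTerm (a b : ℕ) (z : Data) :
    mulTerm.eval (.cons (unary a) (.cons (unary b) z)) = unary (a * b) := by
  simp only [mulTerm, eval, fold_unary, apply_V_zero, apply_V_succ, apply_nil, apply_cons]
  induction a with
  | zero => rw [Nat.zero_mul]; rfl
  | succ a ih => rw [Function.iterate_succ_apply', ih, iterate_cons_nil, Nat.succ_mul]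

theorem bounded_mulTerm {a b : ℕ} {z : Data} (ha : a ≤ L) (hb : b ≤ L) :
    mulTerm.Bounded L (.cons (unary a) (.cons (unary b) z)) :=
  ⟨trivial, trivial, (length_unary a).trans_le ha, .of_forall (fun _ _ =>
    ⟨trivial, trivial, (length_unary b).trans_le hb, .of_forall (fun _ _ => trivial) _ _⟩) _ _⟩

/-- Duplication, in unary, of the second variable. -/
def doubleTerm : Term := fold (expr (V 1)) (expr (V 1)) (expr (.cons .nil (V 1)))

/-- Powers of two in unary. -/
def twoPowTerm : Term := fold (expr (V 0)) (expr trueExpr) doubleTerm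

theorem iterate_eval_doubleTerm (a : ℕ) (x : Data) :
    (fun acc => doubleTerm.eval (.cons .nil (.cons acc x)))^[a] (.cons .nil .nil) =
      unary (2 ^ a) := by
  induction a with
  | zero => rfl
  | succ a ih =>
    rw [Function.iterate_succ_apply', ih]
    simp only [doubleTerm, eval, fold_unary, apply_V_zero, apply_V_succ, apply_nil, apply_cons,
      iterate_cons_nil, pow_succ, mul_two]

theorem eval_twoPowTerm (a : ℕ) (z : Data) :
    twoPowTerm.eval (.cons (unary a) z) = unary (2 ^ a) := by
  simp only [twoPowTerm, eval, fold_unary, apply_V_zero, apply_trueExpr]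
  exact iterate_eval_doubleTerm a _

theorem bounded_twoPowTerm {a : ℕ} {z : Data} (ha : 2 ^ a ≤ L) :
    twoPowTerm.Bounded L (.cons (unary a) z) := by
  refine ⟨trivial, trivial, (length_unary a).trans_le (Nat.lt_two_pow_self.le.trans ha), ?_⟩
  refine FoldAll.unary fun i hi => ⟨trivial, trivial, ?_, .of_forall (fun _ _ => trivial) _ _⟩
  have hpow := iterate_eval_doubleTerm i (.cons (unary a) z)
  refine (congrArg Data.length hpow).trans_le ?_
  rw [length_unary]
  exact (Nat.pow_le_pow_right two_pos hi.le).trans ha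

theorem pow_clog_succ_le {b : ℕ} (hb : 1 < b) (n : ℕ) : b ^ Nat.clog b (n + 1) ≤ b * n + 1 := by
  rcases Nat.eq_zero_or_pos n with rfl | hn
  · simp
  · have hpos : 0 < Nat.clog b (n + 1) := Nat.clog_pos hb (by omega)
    have hpred : b ^ (Nat.clog b (n + 1) - 1) ≤ n :=
      Nat.lt_succ_iff.1 (Nat.pow_pred_clog_lt_self hb (by omega))
    rw [← Nat.succ_pred_eq_of_pos hpos, pow_succ', Nat.pred_eq_sub_one]
    exact (Nat.mul_le_mul_left b hpred).trans (Nat.le_succ _)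

/-- One step of the search for the least `k` such that `n < b ^ k`. The candidate `k` and its power
form a pair. -/
def clogStep (b : ℕ) : Term :=
  ite (comp (expr (.cons (V 2) (.cons (.tl (V 1)) .nil))) dropTerm) (expr (V 1)) <|
    letIn (comp (expr (.cons (constExpr b) (.cons (.tl (V 1)) .nil))) mulTerm)
      (expr (.cons (.cons .nil (.hd (V 2))) (V 0)))

/-- The least `k` such that `n < b ^ k`, in unary. -/
def clogTerm (b : ℕ) : Term :=
  letIn (fold (expr (V 0)) (expr (.cons .nil trueExpr)) (clogStep b)) (expr (.hd (V 0)))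

variable {b : ℕ}

theorem eval_clogStep (hb : 1 < b) (n k : ℕ) (y z : Data) :
    (clogStep b).eval (.cons y (.cons (.cons (unary (min k (Nat.clog b (n + 1))))
      (unary (b ^ min k (Nat.clog b (n + 1))))) (.cons (unary n) z))) =
      .cons (unary (min (k + 1) (Nat.clog b (n + 1))))
        (unary (b ^ min (k + 1) (Nat.clog b (n + 1)))) := by
  classical
  simp only [clogStep, eval_ite, eval, apply_cons, apply_nil, apply_hd, apply_tl, apply_V_zero,
    apply_V_succ, hd_cons, tl_cons, eval_dropTerm, iterate_tl_unary, apply_constExpr, eval_mulTerm]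
  have hnil (j : ℕ) : unary j = .nil ↔ j = 0 := by
    cases j <;> simp [unary, ofList, List.replicate_succ]
  simp only [hnil, Nat.sub_eq_zero_iff_le]
  rcases lt_or_ge k (Nat.clog b (n + 1)) with hk | hk
  · rw [min_eq_left hk.le, min_eq_left hk, if_pos (Nat.lt_succ_iff.1 (Nat.pow_lt_of_lt_clog hk)),
      pow_succ']
    rfl
  · rw [min_eq_right hk, min_eq_right (by omega), if_neg]
    exact not_le.2 (Nat.le_pow_clog hb (n + 1))

theorem iterate_eval_clogStep (hb : 1 < b) (n k : ℕ) (z : Data) :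
    (fun acc => (clogStep b).eval (.cons .nil (.cons acc (.cons (unary n) z))))^[k]
      (.cons .nil (ofBool true)) =
      .cons (unary (min k (Nat.clog b (n + 1)))) (unary (b ^ min k (Nat.clog b (n + 1)))) := by
  induction k with
  | zero => rw [Nat.zero_min]; rfl
  | succ k ih => rw [Function.iterate_succ_apply', ih, eval_clogStep hb]

theorem eval_clogTerm (hb : 1 < b) (n : ℕ) (z : Data) :
    (clogTerm b).eval (.cons (unary n) z) = unary (Nat.clog b (n + 1)) := by
  simp only [clogTerm, eval, fold_unary, apply_cons, apply_nil, apply_trueExpr, apply_V_zero,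
    apply_hd, iterate_eval_clogStep hb, hd_cons]
  rw [min_eq_right (Nat.clog_le_of_le_pow (Nat.lt_pow_self hb))]

theorem bounded_clogTerm (hb : 1 < b) {n : ℕ} {z : Data} (hL : b * n + b ≤ L) :
    (clogTerm b).Bounded L (.cons (unary n) z) := by
  have hpow := pow_clog_succ_le hb n
  have hnL : n ≤ L := by nlinarith
  refine ⟨⟨trivial, trivial, (length_unary n).trans_le hnL, FoldAll.unary fun i _ => ?_⟩, trivial⟩
  simp only [eval, apply_cons, apply_nil, apply_trueExpr, iterate_eval_clogStep hb]
  have hpowmin : b ^ min i (Nat.clog b (n + 1)) ≤ L :=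
    (Nat.pow_le_pow_right (by omega) (min_le_right _ _)).trans (by omega)
  simp only [clogStep, bounded_ite, bounded_letIn, bounded_comp, bounded_expr, eval, apply_cons,
    apply_nil, apply_tl, apply_V_zero, apply_V_succ, tl_cons, apply_constExpr, true_and,
    implies_true, and_true]
  exact ⟨bounded_dropTerm ((length_unary n).trans_le hnL),
    fun _ => bounded_mulTerm (by omega) hpowmin⟩

end Arithmetic

end Term

section Parameters

variable (N c₀ v : ℕ)

/-- The parameter `M`, about `log₈ v`, from which the other parameters are computed. The additive
constant `N` makes the asymptotic estimates hold from the start. -/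
def scale : ℕ := Nat.clog 8 (v + 1) + N

/-- The degree of the value function of the game, about `v ^ (1 / 3)`. -/
def degree : ℕ := 2 ^ scale N v

/-- The number of bits of the counter of the game, about `v ^ (1 / 3) * log v`. -/
def counter : ℕ := 4 * scale N v * degree N v

/-- The logarithm of the feature dimension. The constant `c₀` makes the dimension exceed the horizon
`2 ^ counter N v` by the factor that the bound on the horizon asks for. -/
def logDim : ℕ := counter N v + c₀

/-- The feature dimension. -/
def dim : ℕ := 2 ^ logDim N c₀ v

/-- The time limit of the simulation. -/
def limit : ℕ := 2 ^ (logDim N c₀ v * logDim N c₀ v)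

variable {N c₀}

theorem le_scale : N ≤ scale N v := Nat.le_add_left _ _

theorem degree_pow_three : degree N v ^ 3 = 8 ^ scale N v := by
  rw [degree, ← pow_mul, mul_comm, pow_mul]
  norm_num

theorem degree_pow_three_le : degree N v ^ 3 ≤ 8 ^ N * (8 * v + 1) := by
  rw [degree_pow_three, scale, pow_add, mul_comm]
  exact Nat.mul_le_mul_left _ (Term.pow_clog_succ_le (by norm_num) v)

theorem succ_le_two_pow : v + 1 ≤ 2 ^ (3 * scale N v) := by
  rw [pow_mul]
  exact (Nat.le_pow_clog (by norm_num) (v + 1)).trans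
    (Nat.pow_le_pow_right (by norm_num) (Nat.le_add_right _ _))

theorem four_le_degree (hN : 2 ≤ N) : 4 ≤ degree N v :=
  Nat.pow_le_pow_right two_pos (n := 2) (hN.trans (le_scale v))

theorem four_mul_scale_le_counter : 4 * scale N v ≤ counter N v :=
  Nat.le_mul_of_pos_right _ (Nat.two_pow_pos _)

theorem scale_le_counter : scale N v ≤ counter N v :=
  (Nat.le_mul_of_pos_left _ four_pos).trans (four_mul_scale_le_counter v)

theorem sixteen_mul_scale_le_counter (hN : 2 ≤ N) : 16 * scale N v ≤ counter N v := by
  rw [counter]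
  nlinarith [four_le_degree v hN]

theorem counter_pos (hN : 2 ≤ N) : 0 < counter N v :=
  (two_pos.trans_le (hN.trans (le_scale v))).trans_le (scale_le_counter v)

theorem four_mul_le_two_pow {M : ℕ} (hM : 2 ≤ M) : 4 * M ≤ 2 ^ (2 * M) := by
  induction M, hM using Nat.le_induction with
  | base => norm_num
  | succ n hn ih => rw [mul_add 2, pow_add]; omega

theorem one_add_counter_add_le (hN : 2 ≤ N) : 1 + counter N v + v ≤ 2 ^ (4 * scale N v) := by
  have hM : 2 ≤ scale N v := hN.trans (le_scale v)
  have hcounter : counter N v ≤ 2 ^ (3 * scale N v) :=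
    calc counter N v = 4 * scale N v * 2 ^ scale N v := rfl
      _ ≤ 2 ^ (2 * scale N v) * 2 ^ scale N v := by gcongr; exact four_mul_le_two_pow hM
      _ = 2 ^ (3 * scale N v) := by rw [← pow_add]; congr 1; omega
  calc 1 + counter N v + v ≤ 2 * 2 ^ (3 * scale N v) := by
        linarith [succ_le_two_pow (N := N) v]
    _ = 2 ^ (3 * scale N v + 1) := by rw [pow_succ, mul_comm]
    _ ≤ 2 ^ (4 * scale N v) := Nat.pow_le_pow_right two_pos (by omega)

theorem tensor_length_le (hN : 2 ≤ N) :
    (1 + counter N v + v) ^ degree N v ≤ 2 ^ counter N v :=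
  calc (1 + counter N v + v) ^ degree N v ≤ (2 ^ (4 * scale N v)) ^ degree N v := by
        gcongr; exact one_add_counter_add_le v hN
    _ = 2 ^ counter N v := (pow_mul _ _ _).symm

theorem counter_add_lt_two_pow (hN : 2 ≤ N) : counter N v + v < 2 ^ counter N v := by
  have := one_add_counter_add_le v hN
  have : 2 ^ (4 * scale N v) ≤ 2 ^ counter N v :=
    Nat.pow_le_pow_right two_pos (four_mul_scale_le_counter v)
  omega

theorem two_pow_counter_le_dim : 2 ^ counter N v ≤ dim N c₀ v :=
  Nat.pow_le_pow_right two_pos (Nat.le_add_right _ _)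

theorem degree_le_two_pow_counter : degree N v ≤ 2 ^ counter N v :=
  Nat.pow_le_pow_right two_pos (scale_le_counter v)

theorem dim_le_limit : dim N c₀ v ≤ limit N c₀ v :=
  Nat.pow_le_pow_right two_pos (Nat.le_mul_self _)

theorem succ_div_two_pow_counter_le :
    ((1 + v : ℝ) / 2 ^ counter N v) ≤ 2 ^ (3 * scale N v) / 2 ^ counter N v := by
  have : ((v + 1 : ℕ) : ℝ) ≤ ((2 ^ (3 * scale N v) : ℕ) : ℝ) := by
    exact_mod_cast succ_le_two_pow (N := N) v
  push_cast at this
  gcongr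
  linarith

theorem succ_div_two_pow_counter_le_quarter (hN : 2 ≤ N) :
    ((1 + v : ℝ) / 2 ^ counter N v) ≤ 1 / 4 := by
  refine (succ_div_two_pow_counter_le v).trans ?_
  rw [div_le_div_iff₀ (by positivity) (by norm_num), one_mul,
    show (4 : ℝ) = 2 ^ 2 by norm_num, ← pow_add]
  exact pow_le_pow_right₀ one_le_two
    (by have := sixteen_mul_scale_le_counter v hN; have := hN.trans (le_scale v); omega)

theorem degree_mul_div_two_pow_counter_le_half (hN : 2 ≤ N) :
    (degree N v : ℝ) * v / 2 ^ counter N v ≤ 1 / 2 := by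
  have hmul : degree N v * v ≤ 2 ^ (4 * scale N v) :=
    calc degree N v * v ≤ 2 ^ scale N v * 2 ^ (3 * scale N v) :=
          Nat.mul_le_mul_left _ ((Nat.le_succ v).trans (succ_le_two_pow v))
      _ = 2 ^ (4 * scale N v) := by rw [← pow_add]; congr 1; omega
  have hmul' : (degree N v : ℝ) * v ≤ 2 ^ (4 * scale N v) := by exact_mod_cast hmul
  rw [div_le_div_iff₀ (by positivity) two_pos, one_mul]
  calc (degree N v : ℝ) * v * 2 ≤ 2 ^ (4 * scale N v) * 2 := by gcongr
    _ = 2 ^ (4 * scale N v + 1) := by rw [pow_succ]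
    _ ≤ 2 ^ counter N v := pow_le_pow_right₀ one_le_two
      (by have := sixteen_mul_scale_le_counter v hN; have := hN.trans (le_scale v); omega)

theorem value_loss_le (hN : 2 ≤ N) : (degree N v : ℝ) * v / 2 ^ counter N v +
    ((1 + v) / 2 ^ counter N v) ^ degree N v ≤ 3 / 4 := by
  have hquarter := succ_div_two_pow_counter_le_quarter v hN
  have hpow : ((1 + v : ℝ) / 2 ^ counter N v) ^ degree N v ≤ (1 + v : ℝ) / 2 ^ counter N v :=
    pow_le_of_le_one (by positivity) (hquarter.trans (by norm_num)) (Nat.two_pow_pos _).ne'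
  linarith [degree_mul_div_two_pow_counter_le_half v hN]

theorem simulation_error_le_one (hN : 2 ≤ N) :
    (2 : ℝ) ^ (scale N v * degree N v ^ 2 + scale N v) *
      ((1 + v) / 2 ^ counter N v) ^ degree N v ≤ 1 := by
  have hexp : scale N v * degree N v ^ 2 + scale N v + 3 * scale N v * degree N v ≤
      counter N v * degree N v :=
    calc scale N v * degree N v ^ 2 + scale N v + 3 * scale N v * degree N v
        = scale N v * (degree N v ^ 2 + 1 + 3 * degree N v) := by ring
      _ ≤ scale N v * (4 * degree N v ^ 2) := by gcongr; nlinarith [four_le_degree v hN]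
      _ = counter N v * degree N v := by rw [counter]; ring
  calc (2 : ℝ) ^ (scale N v * degree N v ^ 2 + scale N v) *
        ((1 + v) / 2 ^ counter N v) ^ degree N v
      ≤ 2 ^ (scale N v * degree N v ^ 2 + scale N v) *
        (2 ^ (3 * scale N v) / 2 ^ counter N v) ^ degree N v := by
        gcongr ?_ * ?_ ^ _
        exact succ_div_two_pow_counter_le v
    _ = 2 ^ (scale N v * degree N v ^ 2 + scale N v + 3 * scale N v * degree N v) /
        2 ^ (counter N v * degree N v) := by
        rw [div_pow, ← pow_mul, ← pow_mul, mul_div_assoc', ← pow_add]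
    _ ≤ 1 := by
        rw [div_le_one (by positivity)]
        exact pow_le_pow_right₀ one_le_two hexp

theorem two_pow_scale_mul_degree_sq_le_limit (hN : 2 ≤ N) :
    2 ^ (scale N v * degree N v ^ 2 + scale N v) ≤ limit N c₀ v := by
  have hdegree : 1 ≤ degree N v ^ 2 := Nat.one_le_pow _ _ (Nat.two_pow_pos _)
  refine Nat.pow_le_pow_right two_pos ?_
  calc scale N v * degree N v ^ 2 + scale N v
      ≤ scale N v * (16 * scale N v * degree N v ^ 2) := by
        have hscale : 1 ≤ scale N v := one_le_two.trans (hN.trans (le_scale v))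
        have := Nat.mul_le_mul_left (scale N v) (Nat.mul_le_mul hscale hdegree)
        nlinarith
    _ = counter N v * counter N v := by rw [counter]; ring
    _ ≤ logDim N c₀ v * logDim N c₀ v :=
        Nat.mul_le_mul (Nat.le_add_right _ _) (Nat.le_add_right _ _)

theorem logDim_le (hc : c₀ ≤ N) : logDim N c₀ v ≤ 5 * scale N v * degree N v := by
  have hdegree : 0 < degree N v := Nat.two_pow_pos _
  rw [logDim, counter]
  nlinarith [le_scale (N := N) v]

theorem degree_le_logDim (hN : 2 ≤ N) : degree N v ≤ logDim N c₀ v := by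
  have := hN.trans (le_scale v)
  exact (Nat.le_mul_of_pos_left _ (by omega)).trans (Nat.le_add_right _ _)

theorem logb_dim : Real.logb 2 (dim N c₀ v) = logDim N c₀ v := by
  rw [dim, Nat.cast_pow, Nat.cast_ofNat, Real.logb_pow, Real.logb_self_eq_one one_lt_two, mul_one]

theorem rpow_dim_le (hN : 2 ≤ N) (hc : c₀ ≤ N) :
    (dim N c₀ v : ℝ) ^ (Real.logb 2 (dim N c₀ v) /
      (32 * Real.logb 2 (Real.logb 2 (dim N c₀ v)))) ≤ 2 ^ (scale N v * degree N v ^ 2) := by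
  have hdim : (dim N c₀ v : ℝ) = (2 : ℝ) ^ (logDim N c₀ v : ℝ) := by
    rw [dim, Real.rpow_natCast, Nat.cast_pow, Nat.cast_ofNat]
  have hdegree : ((2 ^ scale N v : ℕ) : ℝ) ≤ logDim N c₀ v := by
    exact_mod_cast degree_le_logDim (c₀ := c₀) v hN
  have hloglog : (scale N v : ℝ) ≤ Real.logb 2 (logDim N c₀ v) := by
    push_cast at hdegree
    rwa [Real.le_logb_iff_rpow_le one_lt_two (lt_of_lt_of_le (by positivity) hdegree),
      Real.rpow_natCast]
  have hscale : (2 : ℝ) ≤ scale N v := by exact_mod_cast hN.trans (le_scale v)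
  have hlogDim : (logDim N c₀ v : ℝ) ≤ 5 * scale N v * degree N v := by
    exact_mod_cast logDim_le (c₀ := c₀) v hc
  rw [logb_dim, hdim, ← Real.rpow_mul two_pos.le, ← Real.rpow_natCast 2 (_ * _)]
  refine Real.rpow_le_rpow_of_exponent_le one_le_two ?_
  rw [mul_div_assoc', div_le_iff₀ (by linarith)]
  push_cast
  calc (logDim N c₀ v : ℝ) * logDim N c₀ v
      ≤ (5 * scale N v * degree N v) * (5 * scale N v * degree N v) := by gcongr
    _ = scale N v * degree N v ^ 2 * (25 * scale N v) := by ring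
    _ ≤ scale N v * degree N v ^ 2 * (32 * Real.logb 2 (logDim N c₀ v)) := by
        gcongr
        norm_num

theorem pow_three_le (M : ℕ) : M ^ 3 ≤ 8 * 2 ^ M := by
  rcases le_or_gt M 4 with h | h
  · interval_cases M <;> norm_num
  · induction M, h using Nat.le_induction with
    | base => norm_num
    | succ n hn ih =>
      rw [pow_succ 2]
      have : (n + 1) ^ 3 ≤ 2 * n ^ 3 := by nlinarith [Nat.mul_le_mul hn hn]
      omega

theorem logb_le_three_mul_scale (hv : 0 < v) : Real.logb 2 v ≤ 3 * scale N v := by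
  have hpow : ((v : ℕ) : ℝ) ≤ ((2 ^ (3 * scale N v) : ℕ) : ℝ) := by
    exact_mod_cast (Nat.le_succ v).trans (succ_le_two_pow v)
  rw [Real.logb_le_iff_le_rpow one_lt_two (by exact_mod_cast hv)]
  exact hpow.trans_eq (by exact_mod_cast (Real.rpow_natCast 2 (3 * scale N v)).symm)

theorem logDim_sq_le (hc : c₀ ≤ N) (hv : 2 ≤ v) :
    (logDim N c₀ v * logDim N c₀ v : ℝ) ≤ 5400 * 8 ^ N * (v / Real.logb 2 v) := by
  have hlogDim : (logDim N c₀ v : ℝ) ≤ 5 * scale N v * degree N v := by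
    exact_mod_cast logDim_le (c₀ := c₀) v hc
  have hlog : 0 < Real.logb 2 v := Real.logb_pos one_lt_two (by exact_mod_cast hv)
  have hscale : (scale N v : ℝ) ^ 3 ≤ 8 * degree N v := by exact_mod_cast pow_three_le (scale N v)
  have hdegree : (degree N v : ℝ) ^ 3 ≤ 8 ^ N * (9 * v) := by
    have : degree N v ^ 3 ≤ 8 ^ N * (9 * v) :=
      (degree_pow_three_le v).trans (Nat.mul_le_mul_left _ (by omega))
    exact_mod_cast this
  rw [mul_div_assoc', le_div_iff₀ hlog]
  calc (logDim N c₀ v * logDim N c₀ v : ℝ) * Real.logb 2 v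
      ≤ (5 * scale N v * degree N v) * (5 * scale N v * degree N v) * (3 * scale N v) := by
        gcongr
        exact logb_le_three_mul_scale v (by omega)
    _ = 75 * scale N v ^ 3 * degree N v ^ 2 := by ring
    _ ≤ 75 * (8 * degree N v) * degree N v ^ 2 := by gcongr
    _ = 600 * degree N v ^ 3 := by ring
    _ ≤ 600 * (8 ^ N * (9 * v)) := by gcongr
    _ = 5400 * 8 ^ N * v := by ring

end Parameters

/-- The decision process to which a formula is reduced. -/
noncomputable abbrev gameOf {v : ℕ} (N c₀ : ℕ) (φ : Formula v) (w₀ : Fin v → Bool) :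
    FeaturedMDP 3 (dim N c₀ v) :=
  Game.mdp φ (counter N v) (degree N v) (dim N c₀ v) w₀

namespace Term

open Data Simulation

section Setup

variable (N c₀ : ℕ)

/-- The computation, from a formula, of the time limit, the input of the simulated algorithm and the
parameters of the simulated oracle. -/
def setupTerm : Term :=
  letIn (comp (expr (.cons (V 0) .nil)) (clogTerm 8)) <|
  letIn (comp (expr (.cons (V 0) (.cons (constExpr N) .nil))) revAppTerm) <|
  letIn (comp (expr (.cons (V 0) .nil)) twoPowTerm) <|
  letIn (comp (expr (.cons (constExpr 4) (.cons (V 1) .nil))) mulTerm) <|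
  letIn (comp (expr (.cons (V 0) (.cons (V 1) .nil))) mulTerm) <|
  letIn (comp (expr (.cons (V 0) (.cons (constExpr c₀) .nil))) revAppTerm) <|
  letIn (comp (expr (.cons (V 0) .nil)) twoPowTerm) <|
  letIn (comp (expr (.cons (V 2) .nil)) twoPowTerm) <|
  letIn (comp (expr (.cons (V 3) (.cons (V 8) .nil))) revAppTerm) <|
  letIn (comp (expr (.cons (V 3) (.cons (V 3) .nil))) mulTerm) <|
  letIn (comp (expr (.cons (V 0) .nil)) twoPowTerm) <|
  expr (.cons (V 0) (.cons (.cons (V 4) (.cons (V 3) (V 2))) (.cons (V 6) (.cons (V 8)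
    (.cons (V 4) (.cons (V 2) (.cons (V 3) (.cons (envTail 12) .nil))))))))

variable {N c₀} {v : ℕ}

/-- The parameters of the simulated oracle for `gameOf N c₀ φ w₀`. They do not involve `w₀`. -/
abbrev paramsOf (N c₀ : ℕ) (φ : Formula v) : Data :=
  paramsData φ (counter N v) (degree N v) (dim N c₀ v)

theorem formulaData_eq (φ : Formula v) : formulaData φ = .cons (unary v) (clausesData φ) := rfl

theorem input_mdp (φ : Formula v) (m r d : ℕ) (w₀ : Fin v → Bool) :
    (Game.mdp φ m r d w₀).input = .cons (unary d) (.cons (unary (2 ^ m)) (unary (m + v))) := by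
  rw [← ofBits_name_start (φ := φ) (r := r) (d := d) w₀]
  rfl

theorem eval_setupTerm (φ : Formula v) (w₀ : Fin v → Bool) :
    (setupTerm N c₀).eval (formulaData φ) =
      .cons (unary (limit N c₀ v)) (.cons (gameOf N c₀ φ w₀).input (paramsOf N c₀ φ)) := by
  rw [input_mdp, formulaData_eq]
  simp only [setupTerm, eval, apply_cons, apply_nil, apply_V_zero, apply_V_succ, apply_constExpr,
    eval_clogTerm (b := 8) (by norm_num), eval_revAppTerm_unary, eval_twoPowTerm, eval_mulTerm]
  rfl

theorem bounded_setupTerm {L : ℕ} (φ : Formula v) (hv : 8 * v + 8 ≤ L) (hlimit : limit N c₀ v ≤ L)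
    (hdim : dim N c₀ v ≤ L) (hlogDim : logDim N c₀ v ≤ L) :
    (setupTerm N c₀).Bounded L (formulaData φ) := by
  have hscale := four_mul_scale_le_counter (N := N) v
  have hclog : Nat.clog 8 (v + 1) ≤ scale N v := Nat.le_add_right _ _
  have hcounter : counter N v ≤ logDim N c₀ v := Nat.le_add_right _ _
  have hpow := two_pow_counter_le_dim (N := N) (c₀ := c₀) v
  have hdegree := degree_le_two_pow_counter (N := N) v
  rw [formulaData_eq]
  simp only [setupTerm, bounded_letIn, bounded_comp, bounded_expr, eval, apply_cons, apply_nil,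
    apply_V_zero, apply_V_succ, apply_constExpr, eval_clogTerm (b := 8) (by norm_num),
    eval_revAppTerm_unary, eval_twoPowTerm, eval_mulTerm, true_and, and_true]
  refine ⟨bounded_clogTerm (by norm_num) hv, bounded_revAppTerm ?_, bounded_twoPowTerm ?_,
    bounded_mulTerm (by omega) ?_, bounded_mulTerm ?_ ?_, bounded_revAppTerm ?_,
    bounded_twoPowTerm hdim, bounded_twoPowTerm (hpow.trans hdim), bounded_revAppTerm ?_,
    bounded_mulTerm hlogDim hlogDim, bounded_twoPowTerm hlimit⟩
  · rw [length_unary]; omega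
  · change degree N v ≤ L; omega
  · change scale N v ≤ L; omega
  · change 4 * scale N v ≤ L; omega
  · change degree N v ≤ L; omega
  · rw [length_unary]; change counter N v ≤ L; omega
  · rw [length_unary]; change counter N v ≤ L; omega

end Setup

section Oracle

variable {v : ℕ} {φ : Formula v} {m r d : ℕ} (w₀ : Fin v → Bool)

theorem answer_queryTerm_of_not_call (hm : 0 < m) {q : Data}
    (hq : ∀ c : (Game.mdp φ m r d w₀).Call, c.toData ≠ q) :
    answer queryTerm (paramsData φ m r d) q = some .nil := by
  rw [answer, eval_queryTerm_of_not_call w₀ hm hq]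

open Classical in
theorem answer_queryTerm_call (c : (Game.mdp φ m r d w₀).Call) :
    answer queryTerm (paramsData φ m r d) c.toData =
      if Satisfies (callState w₀ c).2 φ then none else some (callAnswer w₀ c) := by
  rw [answer, eval_queryTerm_call]
  split_ifs <;> rfl

theorem answer_queryTerm_ne_none (hm : 0 < m) (hφ : ¬ ∃ w, Satisfies w φ) (q : Data) :
    answer queryTerm (paramsData φ m r d) q ≠ none := by
  by_cases hq : ∃ c : (Game.mdp φ m r d fun _ => false).Call, c.toData = q
  · obtain ⟨c, rfl⟩ := hq
    rw [answer_queryTerm_call, if_neg fun h => hφ ⟨_, h⟩]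
    exact Option.some_ne_none _
  · rw [answer_queryTerm_of_not_call (fun _ => false) hm fun c hc => hq ⟨c, hc⟩]
    exact Option.some_ne_none _

theorem oracle_toData {k d : ℕ} (M : FeaturedMDP k d) (c : M.Call) :
    M.oracle c.toData = c.answer := by
  have hex : ∃ c' : M.Call, c'.toData = c.toData := ⟨c, rfl⟩
  rw [FeaturedMDP.oracle, dif_pos hex, FeaturedMDP.Call.toData_injective M hex.choose_spec]

theorem tsum_reward_mul_le {s : Game.State m v} (hs : ¬ Satisfies s.2 φ) (a : Fin 3)
    {h : ℚ → ℝ≥0∞} (h1 : h 1 ≤ 1) :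
    ∑' q, (Game.mdp φ m r d w₀).reward s a q * h q ≤
      h 0 + ENNReal.ofReal (((1 + v) / 2 ^ m) ^ r) := by
  by_cases hn : Game.next φ m s a = none
  · rw [Game.reward_of_next_eq_none hn]
    refine (tsum_bernoulliReward_mul_le _ h h1).trans ?_
    gcongr
    exact Game.value_le_of_counter_eq r w₀ ((Game.next_eq_none.1 hn).resolve_left hs)
  · rw [Game.reward_of_next_ne_none hn, tsum_pure_mul]
    exact le_self_add

theorem tsum_answer_mul_le {c : (Game.mdp φ m r d w₀).Call}
    (hc : ¬ Satisfies (callState w₀ c).2 φ) (h : Data → ℝ≥0∞) (h1 : ∀ z, h z ≤ 1) :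
    ∑' z, FeaturedMDP.Call.answer _ c z * h z ≤
      h (callAnswer w₀ c) + ENNReal.ofReal (((1 + v) / 2 ^ m) ^ r) := by
  cases c with
  | reward s a =>
    refine (tsum_map_mul _ _ _).trans_le ?_
    exact tsum_reward_mul_le w₀ hc a (h := fun q => h (ofRat q)) (h1 _)
  | trans s a =>
    have hanswer : FeaturedMDP.Call.answer _ (.trans s a) =
        PMF.pure (callAnswer w₀ (.trans s a)) := by
      rw [callAnswer]
      cases hn : Game.next φ m s a <;>
        simp only [FeaturedMDP.Call.answer, Game.mdp, hn, FeaturedMDP.stateData] <;> rfl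
    rw [hanswer, tsum_pure_mul]
    exact le_self_add
  | featS s => exact (tsum_pure_mul _ _).trans_le le_self_add
  | featSA s a => exact (tsum_pure_mul _ _).trans_le le_self_add

/- The simulated oracle differs from the true one only in the rewards, which it takes to be zero.
The reward of a satisfying assignment may be large, but there the simulation has already stopped. -/
theorem tsum_oracle_mul_le (hm : 0 < m) {q y : Data}
    (hy : answer queryTerm (paramsData φ m r d) q = some y) (h : Data → ℝ≥0∞)
    (h1 : ∀ z, h z ≤ 1) :
    ∑' z, (Game.mdp φ m r d w₀).oracle q z * h z ≤
      h y + ENNReal.ofReal (((1 + v) / 2 ^ m) ^ r) := by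
  by_cases hq : ∃ c : (Game.mdp φ m r d w₀).Call, c.toData = q
  · obtain ⟨c, rfl⟩ := hq
    rw [answer_queryTerm_call] at hy
    split_ifs at hy with hsat
    obtain rfl : callAnswer w₀ c = y := Option.some_inj.1 hy
    rw [oracle_toData]
    exact tsum_answer_mul_le w₀ hsat h h1
  · rw [answer_queryTerm_of_not_call w₀ hm fun c h => hq ⟨c, h⟩] at hy
    obtain rfl : Data.nil = y := Option.some_inj.1 hy
    rw [FeaturedMDP.oracle, dif_neg hq, tsum_pure_mul]
    exact le_self_add

end Oracle

end Term

open Data Simulation Term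

theorem le_haltProb_driver_of_bounded {F Q W : Term} {A : Program} {x x' P : Data} {t L : ℕ}
    {Y : Set Data} (O : Oracle) (hF : F.eval x = .cons (.unary t) (.cons x' P)) (ht : t ≤ L)
    (hFL : F.Bounded L x) (hQL : ∀ q, Q.Bounded L (.cons q P))
    (hWL : ∀ y, W.Bounded L (.cons y P)) :
    (guardedRun (answer Q P) t (start A x')).toOuterMeasure (output W P ⁻¹' Y) ≤
      haltProb O ((F.size + Q.size + W.size + 31) * (L + 1) ^ (F.depth + Q.depth + W.depth + 1))
        (start (driver F Q W A) x) Y := by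
  refine le_haltProb_driver O hF (fun q => Nat.add_le_add_right (Q.cost_le _ (hQL q)) _)
    (fun y => Nat.add_le_add_right (W.cost_le _ (hWL y)) _) ?_
  set X := (L + 1) ^ (F.depth + Q.depth + W.depth + 1)
  have hpow {n : ℕ} (hn : n ≤ F.depth + Q.depth + W.depth + 1) : (L + 1) ^ n ≤ X :=
    Nat.pow_le_pow_right (by omega) hn
  have hsetup : F.cost x ≤ F.size * X :=
    (F.cost_le _ hFL).trans (Nat.mul_le_mul_left _ (hpow (by omega)))
  have hqueries : t * (Q.size * (L + 1) ^ Q.depth + 10) ≤ (Q.size + 10) * X :=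
    calc t * (Q.size * (L + 1) ^ Q.depth + 10)
        ≤ (L + 1) * (Q.size * (L + 1) ^ Q.depth + 10 * (L + 1) ^ Q.depth) := by
          gcongr
          · omega
          · exact Nat.le_mul_of_pos_right _ (by positivity)
      _ = (Q.size + 10) * (L + 1) ^ (Q.depth + 1) := by ring
      _ ≤ (Q.size + 10) * X := Nat.mul_le_mul_left _ (hpow (by omega))
  have hpost : W.size * (L + 1) ^ W.depth ≤ W.size * X :=
    Nat.mul_le_mul_left _ (hpow (by omega))
  have hL : L + 1 ≤ X := (pow_one (L + 1)).symm.trans_le (hpow (by omega))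
  linarith

section Reduction

variable (N c₀ : ℕ)

/-- The algorithm for 3-SAT that simulates the algorithm `A` for Linear-3-RL. -/
def reduction (A : Program) : Program := driver (setupTerm N c₀) queryTerm walkTerm A

/-- The coefficient of the time bound for `reduction`. -/
def timeCoeff : ℕ := (setupTerm N c₀).size + queryTerm.size + walkTerm.size + 31

/-- The exponent of the time bound for `reduction`. -/
def timeExponent : ℕ := (setupTerm N c₀).depth + queryTerm.depth + walkTerm.depth + 1

/-- The bound, for a formula with `v` variables and at most `c * v` clauses, on the lengths of all
lists that `reduction` iterates over. -/
def lengthBound (c v : ℕ) : ℕ := (c + 8) * limit N c₀ v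

/-- The time bound for `reduction`, for formulas with `v` variables and at most `c * v` clauses. -/
def time (c v : ℕ) : ℕ := timeCoeff N c₀ * (lengthBound N c₀ c v + 1) ^ timeExponent N c₀

variable {N c₀} {c v : ℕ} {φ : Formula v}

theorem limit_le_lengthBound : limit N c₀ v ≤ lengthBound N c₀ c v :=
  Nat.le_mul_of_pos_left _ (by omega)

theorem dim_le_lengthBound : dim N c₀ v ≤ lengthBound N c₀ c v :=
  (dim_le_limit v).trans limit_le_lengthBound

theorem eight_mul_limit_le_lengthBound : 8 * limit N c₀ v ≤ lengthBound N c₀ c v :=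
  Nat.mul_le_mul_right _ (by omega)

theorem counter_add_lt_limit (hN : 2 ≤ N) : counter N v + v < limit N c₀ v :=
  (counter_add_lt_two_pow v hN).trans_le ((two_pow_counter_le_dim v).trans (dim_le_limit v))

theorem fits_lengthBound (hN : 2 ≤ N) (hφ : φ.length ≤ c * v) :
    Fits φ (counter N v) (degree N v) (dim N c₀ v) (lengthBound N c₀ c v) := by
  have hcounter := counter_add_lt_limit (c₀ := c₀) (v := v) hN
  have height := eight_mul_limit_le_lengthBound (N := N) (c₀ := c₀) (c := c) (v := v)
  have hdim := dim_le_lengthBound (N := N) (c₀ := c₀) (c := c) (v := v)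
  have hpow := (two_pow_counter_le_dim (c₀ := c₀) v).trans hdim
  exact
    { three_le := by omega
      clauses := hφ.trans (Nat.mul_le_mul (by omega) (by omega))
      name := by omega
      exponent := (degree_le_two_pow_counter v).trans hpow
      dim := hdim
      steps := hpow
      tensor := (tensor_length_le v hN).trans hpow }

theorem bounded_setupTerm_lengthBound (hN : 2 ≤ N) (φ : Formula v) :
    (setupTerm N c₀).Bounded (lengthBound N c₀ c v) (formulaData φ) := by
  have hcounter := counter_add_lt_limit (c₀ := c₀) (v := v) hN
  have height := eight_mul_limit_le_lengthBound (N := N) (c₀ := c₀) (c := c) (v := v)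
  have hlogDim : logDim N c₀ v < dim N c₀ v := Nat.lt_two_pow_self
  exact bounded_setupTerm φ (by omega) limit_le_lengthBound dim_le_lengthBound
    (hlogDim.le.trans dim_le_lengthBound)

theorem le_haltProb_reduction {A : Program} {Y : Set Data} (O : Oracle) (w₀ : Fin v → Bool)
    (hN : 2 ≤ N) (hφ : φ.length ≤ c * v) :
    (guardedRun (answer queryTerm (paramsOf N c₀ φ)) (limit N c₀ v)
        (start A (gameOf N c₀ φ w₀).input)).toOuterMeasure
        (output walkTerm (paramsOf N c₀ φ) ⁻¹' Y) ≤
      haltProb O (time N c₀ c v) (start (reduction N c₀ A) (formulaData φ)) Y :=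
  le_haltProb_driver_of_bounded O (eval_setupTerm φ w₀) limit_le_lengthBound
    (bounded_setupTerm_lengthBound hN φ) (bounded_queryTerm (fits_lengthBound hN hφ))
    (bounded_walkTerm (fits_lengthBound hN hφ))

theorem haltsWithin_reduction (A : Program) (hN : 2 ≤ N) (hφ : φ.length ≤ c * v) :
    HaltsWithin noOracle (reduction N c₀ A) (formulaData φ) (time N c₀ c v) := by
  have hle := le_haltProb_reduction (c₀ := c₀) (A := A) (Y := Set.univ) noOracle
    (fun _ => false) hN hφ
  rw [Set.preimage_univ,
    (PMF.toOuterMeasure_apply_eq_one_iff _ _).2 (Set.subset_univ _)] at hle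
  exact haltsWithin_of_one_le_haltProb hle

theorem outputProb_reduction_of_unsat (A : Program) (hN : 2 ≤ N) (hφ : φ.length ≤ c * v)
    (hunsat : ¬ ∃ w, Satisfies w φ) :
    outputProb noOracle (reduction N c₀ A) (formulaData φ) (time N c₀ c v) {.nil} = 1 := by
  have hout (y : Data) : output walkTerm (paramsOf N c₀ φ) (some y) = .nil := by
    rw [output, eval_walkTerm fun _ => false, ofBool_eq_nil, Option.isNone_eq_false_iff,
      Option.isSome_iff_ne_none]
    exact iterate_walkStep_ne_none hunsat _ _
  have hle := le_haltProb_reduction (c₀ := c₀) (A := A) (Y := {.nil}) noOracle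
    (fun _ => false) hN hφ
  rw [toOuterMeasure_guardedRun_eq_one (answer_queryTerm_ne_none (counter_pos v hN) hunsat)
    hout] at hle
  rw [outputProb_eq, le_antisymm (haltProb_le_one ..) hle, ENNReal.toReal_one]

theorem haltProb_gameOf_sub_le (A : Program) (hN : 2 ≤ N) (hφ : φ.length ≤ c * v)
    {w₀ : Fin v → Bool} (hw₀ : Satisfies w₀ φ) {T : ℕ} (hT : T ≤ limit N c₀ v) :
    haltProb (gameOf N c₀ φ w₀).oracle T (start A (gameOf N c₀ φ w₀).input)
        (gameOf N c₀ φ w₀).goodOutputs -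
        T * ENNReal.ofReal (((1 + v) / 2 ^ counter N v) ^ degree N v) ≤
      haltProb noOracle (time N c₀ c v) (start (reduction N c₀ A) (formulaData φ))
        {y | y ≠ .nil} := by
  refine le_trans ?_ (le_haltProb_reduction noOracle w₀ hN hφ)
  refine haltProb_tsub_le_guardedRun (fun y hy => ?_) (by simp [output])
    (fun q y hy => tsum_oracle_mul_le w₀ (counter_pos v hN) hy) hT _
  rw [Set.mem_preimage, Set.mem_ofPred_eq, output, eval_walkTerm w₀,
    iterate_walkStep_eq_none hw₀ (value_loss_le v hN) hy]
  simp [ofBool]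

theorem outputProb_reduction_of_sat {A : Program} {T : ℕ} (hN : 2 ≤ N) (hφ : φ.length ≤ c * v)
    {w₀ : Fin v → Bool} (hw₀ : Satisfies w₀ φ)
    (hT : (40 * T : ℝ) ≤ 2 ^ (scale N v * degree N v ^ 2 + scale N v))
    (hA : 1 - 1 / 10 ≤ outputProb (gameOf N c₀ φ w₀).oracle A (gameOf N c₀ φ w₀).input T
      (gameOf N c₀ φ w₀).goodOutputs) :
    1 - 1 / 8 ≤ outputProb noOracle (reduction N c₀ A) (formulaData φ) (time N c₀ c v)
      {y | y ≠ .nil} := by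
  have hlimit : (2 : ℝ) ^ (scale N v * degree N v ^ 2 + scale N v) ≤ limit N c₀ v := by
    exact_mod_cast two_pow_scale_mul_degree_sq_le_limit v hN
  have hTlimit : (T : ℝ) ≤ limit N c₀ v := by linarith [Nat.cast_nonneg (α := ℝ) T]
  set p : ℝ := ((1 + v) / 2 ^ counter N v) ^ degree N v
  have hp0 : 0 ≤ p := by positivity
  have herror : T * p ≤ 1 / 40 := by
    linarith [mul_le_mul_of_nonneg_right hT hp0, simulation_error_le_one v hN]
  have hle := ENNReal.toReal_mono ((haltProb_le_one ..).trans_lt ENNReal.one_lt_top).ne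
    (haltProb_gameOf_sub_le A hN hφ hw₀ (Nat.cast_le.1 hTlimit))
  have hsub := (ENNReal.le_toReal_sub (a := haltProb (gameOf N c₀ φ w₀).oracle T
    (start A (gameOf N c₀ φ w₀).input) (gameOf N c₀ φ w₀).goodOutputs)
    (b := T * ENNReal.ofReal p) (by finiteness)).trans hle
  rw [ENNReal.toReal_mul, ENNReal.toReal_natCast, ENNReal.toReal_ofReal hp0] at hsub
  rw [outputProb_eq] at hA ⊢
  linarith

theorem horizon_gameOf_le {C : ℝ} (hC : 1 ≤ C * 2 ^ c₀) (φ : Formula v) (w₀ : Fin v → Bool) :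
    ((gameOf N c₀ φ w₀).horizon : ℝ) ≤ C * dim N c₀ v := by
  have hhorizon : (gameOf N c₀ φ w₀).horizon = 2 ^ counter N v := rfl
  have hpow : (0 : ℝ) < 2 ^ counter N v := by positivity
  rw [hhorizon, dim, logDim, pow_add]
  push_cast
  nlinarith

theorem sizeBound_gameOf {b : ℕ} (hN : 2 ≤ N) (hb : 1 ≤ b) (φ : Formula v) (w₀ : Fin v → Bool) :
    (gameOf N c₀ φ w₀).SizeBound (dim N c₀ v ^ b) := by
  have hcounter := counter_add_lt_two_pow v hN
  have hpos := counter_pos v hN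
  have hdim := (two_pow_counter_le_dim v).trans (Nat.le_self_pow (n := b) (by omega) (dim N c₀ v))
  exact Game.sizeBound (by omega) (by omega)

theorem isLinear_gameOf (hN : 2 ≤ N) {w₀ : Fin v → Bool} (hw₀ : Satisfies w₀ φ) :
    (gameOf N c₀ φ w₀).IsLinear :=
  Game.isLinear ((tensor_length_le v hN).trans (two_pow_counter_le_dim v)) hw₀

theorem limit_le_rpow (hc : c₀ ≤ N) (hv : 2 ≤ v) :
    (limit N c₀ v : ℝ) ≤ 2 ^ (5400 * 8 ^ N * (v / Real.logb 2 v)) := by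
  rw [limit, Nat.cast_pow, Nat.cast_ofNat, ← Real.rpow_natCast]
  refine Real.rpow_le_rpow_of_exponent_le one_le_two ?_
  exact_mod_cast logDim_sq_le v hc hv

theorem time_le (hc : c₀ ≤ N) (hv : 2 ≤ v) : (time N c₀ c v : ℝ) ≤
    (timeCoeff N c₀ * (c + 9) ^ timeExponent N c₀) *
      2 ^ (timeExponent N c₀ * (5400 * 8 ^ N) * (v / Real.logb 2 v)) := by
  have hone : (1 : ℝ) ≤ limit N c₀ v := by exact_mod_cast Nat.one_le_two_pow
  rw [time, lengthBound]
  push_cast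
  calc (timeCoeff N c₀ : ℝ) * ((c + 8) * limit N c₀ v + 1) ^ timeExponent N c₀
      ≤ timeCoeff N c₀ * ((c + 9) * limit N c₀ v) ^ timeExponent N c₀ := by
        gcongr
        linarith
    _ ≤ timeCoeff N c₀ *
        ((c + 9) * 2 ^ (5400 * 8 ^ N * (v / Real.logb 2 v))) ^ timeExponent N c₀ := by
        gcongr
        exact limit_le_rpow hc hv
    _ = _ := by
        rw [mul_pow, ← Real.rpow_mul_natCast two_pos.le, ← mul_assoc]
        ring_nf

theorem isBigO_time (hc : c₀ ≤ N) : (fun v => (time N c₀ c v : ℝ)) =O[atTop] fun v : ℕ =>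
    (2 : ℝ) ^ (timeExponent N c₀ * (5400 * 8 ^ N) * (v / Real.logb 2 v)) := by
  refine IsBigO.of_bound (timeCoeff N c₀ * (c + 9) ^ timeExponent N c₀) ?_
  filter_upwards [eventually_ge_atTop 2] with v hv
  rw [Real.norm_of_nonneg (Nat.cast_nonneg _), Real.norm_of_nonneg (by positivity)]
  exact time_le hc hv

theorem exists_parameters {C : ℝ} (hC : 0 < C) {T : ℕ → ℕ}
    (hT : (fun d => (T d : ℝ)) =O[atTop] fun d : ℕ =>
      (d : ℝ) ^ (Real.logb 2 d / (32 * Real.logb 2 (Real.logb 2 d)))) :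
    ∃ N c₀, 2 ≤ N ∧ c₀ ≤ N ∧ 1 ≤ C * 2 ^ c₀ ∧ ∀ v,
      (40 * T (dim N c₀ v) : ℝ) ≤ 2 ^ (scale N v * degree N v ^ 2 + scale N v) := by
  obtain ⟨K, hKpos, hK⟩ := hT.exists_pos
  obtain ⟨D, hD⟩ := eventually_atTop.1 hK.bound
  obtain ⟨c₀, hc₀⟩ := pow_unbounded_of_one_lt C⁻¹ one_lt_two
  obtain ⟨n, hn⟩ := pow_unbounded_of_one_lt (40 * K) one_lt_two
  obtain ⟨N, hN⟩ : ∃ N, 2 ≤ N ∧ c₀ ≤ N ∧ D ≤ N ∧ n ≤ N :=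
    ⟨2 + c₀ + D + n, by omega, by omega, by omega, by omega⟩
  refine ⟨N, c₀, hN.1, hN.2.1, ?_, fun v => ?_⟩
  · rw [inv_lt_iff_one_lt_mul₀ hC] at hc₀
    exact (mul_comm C _).symm ▸ hc₀.le
  have hscale := le_scale (N := N) v
  have hDdim : D ≤ dim N c₀ v :=
    calc D ≤ counter N v := hN.2.2.1.trans (hscale.trans (scale_le_counter v))
      _ ≤ logDim N c₀ v := Nat.le_add_right _ _
      _ ≤ dim N c₀ v := Nat.lt_two_pow_self.le
  have hTdim := hD _ hDdim
  rw [Real.norm_of_nonneg (Nat.cast_nonneg _), Real.norm_of_nonneg (by positivity)] at hTdim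
  calc (40 * T (dim N c₀ v) : ℝ) ≤ 40 * (K * 2 ^ (scale N v * degree N v ^ 2)) := by
        gcongr
        exact hTdim.trans (by gcongr; exact rpow_dim_le v hN.1 hN.2.1)
    _ = 2 ^ (scale N v * degree N v ^ 2) * (40 * K) := by ring
    _ ≤ 2 ^ (scale N v * degree N v ^ 2) * 2 ^ scale N v := by
        gcongr
        exact hn.le.trans (pow_le_pow_right₀ one_le_two (hN.2.2.2.trans hscale))
    _ = _ := by rw [pow_add]

end Reduction

/-- The problem of Unique-3-SAT without the promise of uniqueness: the answer on a formula has to be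
YES with probability at least `1 - ε` as soon as the formula is satisfiable. -/
def ThreeSATSolvable (c : ℕ) (t : ℕ → ℝ) (ε : ℝ) : Prop :=
  ∃ (A : Program) (T : ℕ → ℕ), (fun v => (T v : ℝ)) =O[atTop] t ∧
    ∀ (v : ℕ) (φ : Formula v), φ.length ≤ c * v →
      HaltsWithin noOracle A (formulaData φ) (T v) ∧
      ((∃ w, Satisfies w φ) →
        1 - ε ≤ outputProb noOracle A (formulaData φ) (T v) {y | y ≠ .nil}) ∧
      ((¬ ∃ w, Satisfies w φ) →
        outputProb noOracle A (formulaData φ) (T v) {.nil} = 1)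

theorem ThreeSATSolvable.unique3SATSolvable {c : ℕ} {t : ℕ → ℝ} {ε : ℝ}
    (h : ThreeSATSolvable c t ε) : Unique3SATSolvable c t ε := by
  obtain ⟨A, T, hT, hA⟩ := h
  refine ⟨A, T, hT, fun v φ hφ => ?_⟩
  obtain ⟨hhalts, hsat, hunsat⟩ := hA v φ hφ
  exact ⟨hhalts, fun h => hsat h.exists, hunsat⟩

end LinearRL

open LinearRL in
theorem mainTheorem6_general (C : ℝ) (hC : 0 < C) (b : ℕ) (hb : 1 ≤ b) (c : ℕ)
    (hRL : LinearRLSolvable 3 C b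
      (fun d => (d : ℝ) ^ (Real.logb 2 d / (32 * Real.logb 2 (Real.logb 2 d)))) (1 / 10)) :
    ∃ K : ℝ, ThreeSATSolvable c (fun v => (2 : ℝ) ^ (K * (v / Real.logb 2 v))) (1 / 8) := by
  obtain ⟨A, T, hT, hA⟩ := hRL
  obtain ⟨N, c₀, hN, hc₀, hdim, hT⟩ := exists_parameters hC hT
  refine ⟨timeExponent N c₀ * (5400 * 8 ^ N), reduction N c₀ A, time N c₀ c, isBigO_time hc₀,
    fun v φ hφ => ⟨haltsWithin_reduction A hN hφ, ?_, outputProb_reduction_of_unsat A hN hφ⟩⟩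
  rintro ⟨w₀, hw₀⟩
  exact outputProb_reduction_of_sat hN hφ hw₀ (hT v)
    (hA _ (gameOf N c₀ φ w₀) (horizon_gameOf_le hdim φ w₀) (sizeBound_gameOf hN hb φ w₀)
      (isLinear_gameOf hN hw₀)).2

theorem mainTheorem6 (C : ℝ) (hC : 0 < C) (b : ℕ) (hb : 1 ≤ b) (c : ℕ)
    (hRL : LinearRL.LinearRLSolvable 3 C b
      (fun d => (d : ℝ) ^ (Real.logb 2 d / (32 * Real.logb 2 (Real.logb 2 d)))) (1 / 10)) :
    ∃ K : ℝ, LinearRL.Unique3SATSolvable c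
      (fun v => (2 : ℝ) ^ (K * (v / Real.logb 2 v))) (1 / 8) :=
  (mainTheorem6_general C hC b hb c hRL).imp fun _ h => h.unique3SATSolvable
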